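/- Let $p$ and $q$ be distinct primes. Write $\mathcal C_n$ for the cyclic group of order $n$ and $\mathrm{Hol}(H)=H\rtimes\mathrm{Aut}(H)$ for the holomorph of $H$. In a product $N\rtimes K$ or $K\ltimes N$ the subgroup $N$ is normal. Consider the following eleven types of groups $G$, each with a condition and a group $A$. 1. $G=\mathcal C_{p^2}\times\mathcal C_q$; no condition; $A=\mathcal C_p\times\mathcal C_{p-1}\times\mathcal C_{q-1}$. 2. $G=\mathcal C_{p^2}\ltimes_p\mathcal C_q$, a semidirect product with centre of order $p$; $p\mid q-1$; $A=\mathcal C_p\times\mathrm{Hol}(\mathcal C_q)$. 3. $G=\mathcal C_{p^2}\ltimes_1\mathcal C_q$, a semidirect product with trivial centre; $p^2\mid q-1$; $A=\mathrm{Hol}(\mathcal C_q)$. 4. $G=\mathcal C_{p^2}\rtimes\mathcal C_q$ with non-trivial action; $q\mid p-1$; $A=\mathrm{Hol}(\mathcal C_{p^2})$. 5. $G=\mathcal C_p\times\mathcal C_p\times\mathcal C_q$; no condition; $A=\mathrm{GL}(2,p)\times\mathcal C_{q-1}$. 6. $G=\mathcal C_p\times(\mathcal C_p\rtimes\mathcal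 C_q)$ with non-trivial action; $q\mid p-1$; $A=\mathcal C_{p-1}\times\mathrm{Hol}(\mathcal C_p)$. 7. $G=(\mathcal C_p\times\mathcal C_p)\rtimes_S\mathcal C_q$, a generator of $\mathcal C_q$ acting as a non-identity scalar matrix; $q\mid p-1$; $A=\mathrm{Hol}(\mathcal C_p\times\mathcal C_p)$. 8. $G=(\mathcal C_p\times\mathcal C_p)\rtimes_{D0}\mathcal C_q$, a generator of $\mathcal C_q$ acting as a diagonal non-scalar matrix without eigenvalue $1$ and with determinant different from $1$; $3<q\mid p-1$; $A=\mathrm{Hol}(\mathcal C_p)\times\mathrm{Hol}(\mathcal C_p)$. 9. $G=(\mathcal C_p\times\mathcal C_p)\rtimes_{D1}\mathcal C_q$, a generator of $\mathcal C_q$ acting as a diagonal non-scalar matrix without eigenvalue $1$ and with determinant $1$; $2<q\mid p-1$; $A=\mathcal C_2\ltimes(\mathrm{Hol}(\mathcal C_p)\times\mathrm{Hol}(\mathcal C_p))$, where $\mathcal C_2$ exchanges the two factors. 10. $G=(\mathcal C_p\times\mathcal C_p)\rtimes_C\mathcal C_q$, a generator of $\mathcal C_q$ acting as a non-scalar power of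 a Singer cycle (an element of order $p^2-1$ of $\mathrm{GL}(2,p)$); $2<q\mid p+1$; $A=(\mathcal C_2\ltimes\mathcal C_{p^2-1})\ltimes(\mathcal C_p\times\mathcal C_p)$, where $\mathcal C_p\times\mathcal C_p$ is the additive group of $\mathbb F_{p^2}$, $\mathcal C_{p^2-1}=\mathbb F_{p^2}^{*}$ acts on it by multiplication, and the generator of $\mathcal C_2$ acts on both by $x\mapsto x^p$. 11. $G=\mathcal C_p\times(\mathcal C_p\ltimes\mathcal C_q)$ with non-trivial action; $p\mid q-1$; $A=\mathrm{Hol}(\mathcal C_p)\times\mathrm{Hol}(\mathcal C_q)$. Then: (a) every group of order $p^2q$ has a normal Sylow $p$-subgroup or a normal Sylow $q$-subgroup, and is of exactly one of the eleven types; (b) groups of a given type exist if and only if the condition of that type holds; (c) every group $G$ of a given type has order $p^2q$ and satisfies $\mathrm{Aut}(G)\cong A$, with $A$ the group listed for that type; (d) any two groups of the same type, other than type 8, are isomorphic; if $3<q\mid p-1$, the groups of type 8 form exactly $(q-3)/2$ isomorphism classes. -/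

import Mathlib

namespace PSqQ

open Matrix

/-- The cyclic group of order `n` (for `n ≥ 1`), written multiplicatively. -/
abbrev Cyc (n : ℕ) : Type := Multiplicative (ZMod n)

/-- The holomorph `H ⋊ Aut(H)` with the tautological action. -/
abbrev Hol (H : Type) [Group H] : Type := H ⋊[MonoidHom.id (MulAut H)] MulAut H

/-- The homomorphism from the cyclic group of order `n` that sends the standard generator to an
element `g` with `g ^ n = 1`. -/
def cycLift {A : Type} [Group A] (n : ℕ) (g : A) (h : g ^ n = 1) : Cyc n →* A :=
  AddMonoidHom.toMultiplicativeLeft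
    (ZMod.lift n ⟨zmultiplesHom (Additive A) (Additive.ofMul g), by
      rw [zmultiplesHom_apply, natCast_zsmul, ← ofMul_pow, h, ofMul_one]⟩)

theorem cycLift_gen {A : Type} [Group A] (n : ℕ) (g : A) (h : g ^ n = 1) :
    cycLift n g h (Multiplicative.ofAdd 1) = g := by
  have := ZMod.lift_coe n ⟨zmultiplesHom (Additive A) (Additive.ofMul g), by
      rw [zmultiplesHom_apply, natCast_zsmul, ← ofMul_pow, h, ofMul_one]⟩ 1
  simp only [Int.cast_one, zmultiplesHom_apply, one_zsmul] at this
  exact congrArg Additive.toMul this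

/-! ### Semidirect products of `C_p × C_p` by `C_q` -/

/-- `C_p × C_p`, written as the multiplicative version of the plane over `ℤ/p`. -/
abbrev Plane (p : ℕ) : Type := Multiplicative (Fin 2 → ZMod p)

/-- The natural action of `GL(2, p)` on `C_p × C_p`. -/
def glAct (p : ℕ) : GL (Fin 2) (ZMod p) →* MulAut (Plane p) where
  toFun A :=
    { toFun := fun v => Multiplicative.ofAdd ((A : Matrix (Fin 2) (Fin 2) (ZMod p)) *ᵥ v.toAdd)
      invFun := fun v =>
        Multiplicative.ofAdd (((A⁻¹ : GL (Fin 2) (ZMod p)) : Matrix (Fin 2) (Fin 2) (ZMod p)) *ᵥ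
          v.toAdd)
      left_inv := fun v => by
        simp only [toAdd_ofAdd, Matrix.mulVec_mulVec, ← Units.val_mul, inv_mul_cancel,
          Units.val_one, Matrix.one_mulVec, ofAdd_toAdd]
      right_inv := fun v => by
        simp only [toAdd_ofAdd, Matrix.mulVec_mulVec, ← Units.val_mul, mul_inv_cancel,
          Units.val_one, Matrix.one_mulVec, ofAdd_toAdd]
      map_mul' := fun v w => by
        simp only [toAdd_mul, Matrix.mulVec_add, ofAdd_add] }
  map_one' := MulEquiv.ext fun v => congrArg Multiplicative.ofAdd (Matrix.one_mulVec v.toAdd)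
  map_mul' A B := MulEquiv.ext fun v => congrArg Multiplicative.ofAdd
    (Matrix.mulVec_mulVec v.toAdd (A : Matrix (Fin 2) (Fin 2) (ZMod p)) B).symm

/-- `G` is a semidirect product `(C_p × C_p) ⋊ C_q` in which a generator of `C_q` acts as an
invertible matrix with the property `P`. -/
def IsPlaneSemidirect (p q : ℕ) (P : GL (Fin 2) (ZMod p) → Prop) (G : Type*) [Group G] : Prop :=
  ∃ φ : Cyc q →* GL (Fin 2) (ZMod p),
    P (φ (Multiplicative.ofAdd 1)) ∧ Nonempty (G ≃* Plane p ⋊[(glAct p).comp φ] Cyc q)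

/-- Scalar matrices. -/
def IsScalarMat {p : ℕ} (Z : GL (Fin 2) (ZMod p)) : Prop :=
  ∃ c : ZMod p, (Z : Matrix (Fin 2) (Fin 2) (ZMod p)) = Matrix.scalar (Fin 2) c

/-- Kind `S`: non-identity scalar matrices. -/
def KindS {p : ℕ} (Z : GL (Fin 2) (ZMod p)) : Prop :=
  IsScalarMat Z ∧ Z ≠ 1

/-- Diagonal non-scalar matrices without eigenvalue `1`. -/
def KindD {p : ℕ} (Z : GL (Fin 2) (ZMod p)) : Prop :=
  ∃ a b : ZMod p, (Z : Matrix (Fin 2) (Fin 2) (ZMod p)) = Matrix.diagonal ![a, b] ∧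
    a ≠ b ∧ a ≠ 1 ∧ b ≠ 1

/-- Kind `D0`: diagonal, non-scalar, no eigenvalue `1`, determinant different from `1`. -/
def KindD0 {p : ℕ} (Z : GL (Fin 2) (ZMod p)) : Prop :=
  KindD Z ∧ (Z : Matrix (Fin 2) (Fin 2) (ZMod p)).det ≠ 1

/-- Kind `D1`: diagonal, non-scalar, no eigenvalue `1`, determinant `1`. -/
def KindD1 {p : ℕ} (Z : GL (Fin 2) (ZMod p)) : Prop :=
  KindD Z ∧ (Z : Matrix (Fin 2) (Fin 2) (ZMod p)).det = 1

/-- Kind `C`: non-scalar powers of a Singer cycle, that is, of an element of order `p ^ 2 - 1` of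
`GL(2, p)`. -/
def KindC {p : ℕ} (Z : GL (Fin 2) (ZMod p)) : Prop :=
  (∃ σ : GL (Fin 2) (ZMod p), orderOf σ = p ^ 2 - 1 ∧ ∃ k : ℕ, Z = σ ^ k) ∧ ¬ IsScalarMat Z

/-! ### The eleven types -/

/-- Labels of the eleven types of groups of order `p ^ 2 * q`. -/
inductive TypeLabel
  | t1 | t2 | t3 | t4 | t5 | t6 | t7 | t8 | t9 | t10 | t11

/-- The arithmetic condition under which a type occurs. -/
def Condition (p q : ℕ) : TypeLabel → Prop
  | .t1 => True
  | .t2 => p ∣ q - 1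
  | .t3 => p ^ 2 ∣ q - 1
  | .t4 => q ∣ p - 1
  | .t5 => True
  | .t6 => q ∣ p - 1
  | .t7 => q ∣ p - 1
  | .t8 => 3 < q ∧ q ∣ p - 1
  | .t9 => 2 < q ∧ q ∣ p - 1
  | .t10 => 2 < q ∧ q ∣ p + 1
  | .t11 => p ∣ q - 1

/-- `G` is a group of the given type. -/
def IsOfType (p q : ℕ) (t : TypeLabel) (G : Type*) [Group G] : Prop :=
  match t with
  | .t1 => Nonempty (G ≃* Cyc (p ^ 2) × Cyc q)
  | .t2 => ∃ φ : Cyc (p ^ 2) →* MulAut (Cyc q),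
      Nat.card (Subgroup.center (Cyc q ⋊[φ] Cyc (p ^ 2))) = p ∧
        Nonempty (G ≃* Cyc q ⋊[φ] Cyc (p ^ 2))
  | .t3 => ∃ φ : Cyc (p ^ 2) →* MulAut (Cyc q),
      Subgroup.center (Cyc q ⋊[φ] Cyc (p ^ 2)) = ⊥ ∧
        Nonempty (G ≃* Cyc q ⋊[φ] Cyc (p ^ 2))
  | .t4 => ∃ φ : Cyc q →* MulAut (Cyc (p ^ 2)), φ ≠ 1 ∧
      Nonempty (G ≃* Cyc (p ^ 2) ⋊[φ] Cyc q)
  | .t5 => Nonempty (G ≃* Cyc p × Cyc p × Cyc q)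
  | .t6 => ∃ φ : Cyc q →* MulAut (Cyc p), φ ≠ 1 ∧
      Nonempty (G ≃* Cyc p × (Cyc p ⋊[φ] Cyc q))
  | .t7 => IsPlaneSemidirect p q KindS G
  | .t8 => IsPlaneSemidirect p q KindD0 G
  | .t9 => IsPlaneSemidirect p q KindD1 G
  | .t10 => IsPlaneSemidirect p q KindC G
  | .t11 => ∃ φ : Cyc p →* MulAut (Cyc q), φ ≠ 1 ∧
      Nonempty (G ≃* Cyc p × (Cyc q ⋊[φ] Cyc p))

/-! ### The automorphism groups -/

/-- `C_2` acting on `H × H` by exchanging the two factors. -/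
def swapAct (H : Type) [Group H] : Cyc 2 →* MulAut (H × H) :=
  cycLift 2 (MulEquiv.prodComm : H × H ≃* H × H) (by
    rw [sq]
    ext1 x
    rfl)

/-- The field with `p ^ 2` elements. -/
abbrev Fpp (p : ℕ) [Fact p.Prime] : Type := GaloisField p 2

/-- `C_2` acting on the field with `p ^ 2` elements, the generator acting as `x ↦ x ^ p`. -/
noncomputable def frobAct (p : ℕ) [Fact p.Prime] : Cyc 2 →* RingAut (Fpp p) :=
  cycLift 2 (frobeniusEquiv (Fpp p) p) (by
    ext x
    have hc : Nat.card (Fpp p) = p ^ 2 := GaloisField.card p 2 two_ne_zero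
    have : Fintype (Fpp p) := Fintype.ofFinite _
    have hx := FiniteField.pow_card x
    rw [← Nat.card_eq_fintype_card, hc] at hx
    rw [sq, RingAut.mul_apply, RingAut.one_apply]
    simp only [frobeniusEquiv_apply, frobenius_def]
    rw [← pow_mul, ← sq, hx])

/-- Ring automorphisms acting on the unit group. -/
def autUnits (K : Type) [Field K] : RingAut K →* MulAut Kˣ where
  toFun σ := Units.mapEquiv σ.toMulEquiv
  map_one' := by ext; rfl
  map_mul' _ _ := by ext; rfl

/-- Ring automorphisms acting on the additive group. -/
def autAdd (K : Type) [Field K] : RingAut K →* MulAut (Multiplicative K) where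
  toFun σ := AddEquiv.toMultiplicative σ.toAddEquiv
  map_one' := by ext1; rfl
  map_mul' _ _ := by ext1; rfl

/-- Units acting on the additive group by multiplication. -/
def unitsAdd (K : Type) [Field K] : Kˣ →* MulAut (Multiplicative K) where
  toFun u := AddEquiv.toMultiplicative (AddAut.mulLeft u)
  map_one' := by ext1 x; exact congrArg Multiplicative.ofAdd (one_mul x.toAdd)
  map_mul' u v := by
    ext1 x; exact congrArg Multiplicative.ofAdd (mul_assoc (u : K) v x.toAdd)

/-- `C_2 ⋉ C_{p ^ 2 - 1}`, with `C_{p ^ 2 - 1}` the multiplicative group of the field with `p ^ 2`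
elements, on which the generator of `C_2` acts as `g ↦ g ^ p`. -/
abbrev SemiLin (p : ℕ) [Fact p.Prime] : Type :=
  (Fpp p)ˣ ⋊[(autUnits (Fpp p)).comp (frobAct p)] Cyc 2

/-- The action of `C_2 ⋉ C_{p ^ 2 - 1}` on the additive group `C_p × C_p` of the field with `p ^ 2`
elements: units act by multiplication and the generator of `C_2` acts as `x ↦ x ^ p`. -/
noncomputable def semiLinAct (p : ℕ) [Fact p.Prime] :
    SemiLin p →* MulAut (Multiplicative (Fpp p)) :=
  SemidirectProduct.lift (unitsAdd (Fpp p)) ((autAdd (Fpp p)).comp (frobAct p)) (fun g => by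
    ext u x
    have h := map_mul (frobAct p g) (u : Fpp p) ((frobAct p g).symm x.toAdd)
    rw [RingEquiv.apply_symm_apply] at h
    exact congrArg Multiplicative.ofAdd h.symm)

/-- `A` is isomorphic to the automorphism group listed for the given type. -/
def HasListedAut (p q : ℕ) [Fact p.Prime] (t : TypeLabel) (A : Type*) [Group A] : Prop :=
  match t with
  | .t1 => Nonempty (A ≃* Cyc p × Cyc (p - 1) × Cyc (q - 1))
  | .t2 => Nonempty (A ≃* Cyc p × Hol (Cyc q))
  | .t3 => Nonempty (A ≃* Hol (Cyc q))
  | .t4 => Nonempty (A ≃* Hol (Cyc (p ^ 2)))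
  | .t5 => Nonempty (A ≃* GL (Fin 2) (ZMod p) × Cyc (q - 1))
  | .t6 => Nonempty (A ≃* Cyc (p - 1) × Hol (Cyc p))
  | .t7 => Nonempty (A ≃* Hol (Cyc p × Cyc p))
  | .t8 => Nonempty (A ≃* Hol (Cyc p) × Hol (Cyc p))
  | .t9 => Nonempty (A ≃* (Hol (Cyc p) × Hol (Cyc p)) ⋊[swapAct (Hol (Cyc p))] Cyc 2)
  | .t10 => Nonempty (A ≃* Multiplicative (Fpp p) ⋊[semiLinAct p] SemiLin p)
  | .t11 => Nonempty (A ≃* Hol (Cyc p) × Hol (Cyc q))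

end PSqQ

universe u

/-! A Sylow count, with Burnside transfer in one case, shows that a group of order p²q has a normal
Sylow subgroup (`exists_normal_sylow`). Hence it is a semidirect product N ⋊ K with abelian factors
of coprime orders p² and q, in one order or the other, and the factor of order p² is either cyclic
or the plane over ℤ/p. Everything then reduces to the study of actions. The kernel N is the set of
elements killed by |N|, so an isomorphism of such products induces isomorphisms of the factors that
intertwine the actions (`exists_compatible_of_mulEquiv`). Conversely, for cyclic K only the subgroup
generated by the action of a generator matters, up to conjugation (`nonempty_semidirect_congr`).

When C_q is normal or the kernel is C_{p²}, the action lands in a cyclic automorphism group, where a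
subgroup is determined by its order; this gives types 1 to 5 and 11. When the plane is normal, a
generator of C_q acts as a matrix Z with Z^q = 1. If Z has an eigenvector it is diagonalizable
because q ≠ p, and its eigenvalues decide between types 5 to 9. Otherwise its characteristic
polynomial is irreducible and Z acts as a multiplication in the field with p² elements, which is
type 10 (`exists_conj_kind`, `exists_field_model`). In type 8 the cyclic group generated by Z
contains diag(g, g^k) for a fixed g of order q, with k different from 0, 1 and -1. Exchanging the
coordinates replaces k by its inverse, which leaves (q - 3)/2 classes (`exists_family_kindD0`).

For the automorphism groups, cocycles between coprime orders are coboundaries. If K fixes no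
non-trivial element of N, then Aut(N ⋊ K) is therefore N ⋊ L, with L the group of pairs of
automorphisms of N and K compatible with the action (`holAut_bijective`). It remains to compute L
type by type; types 1, 5 and 6 use a splitting into direct factors preserved by all automorphisms
(`nonempty_mulAut_prod`).

Disjointness of the types follows from invariants: the existence of elements of order p², closure
under multiplication of the p²-torsion and of the q-torsion, the order of the centre, and properties
of Z stable under conjugation and powers (`IsOfType.unique`). -/

namespace PSqQ

open Matrix

/-! ### Semidirect products with coprime factors and abelian kernel -/

section CoprimeSemidirect

open SemidirectProduct

variable {N N' K K' : Type*} [CommGroup N] [CommGroup N'] [Group K] [Group K']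
  {φ : K →* MulAut N} {ψ : K' →* MulAut N'}

/-- If x is killed by |N|, its image in K has order dividing both |N| and |K|. This describes the
kernel without reference to the decomposition, so every isomorphism respects it. -/
theorem right_eq_one_iff_pow_card [Finite N] [Finite K]
    (h : (Nat.card N).Coprime (Nat.card K)) (x : N ⋊[φ] K) :
    x.right = 1 ↔ x ^ Nat.card N = 1 := by
  constructor
  · intro hx
    have : x = inl x.left := by
      ext <;> simp [hx]
    rw [this, ← map_pow, pow_card_eq_one', map_one]
  · intro hx
    have h1 : x.right ^ Nat.card N = 1 := by
      have := congrArg (rightHom (φ := φ)) hx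
      rwa [map_pow, map_one, rightHom_eq_right] at this
    have h2 : x.right ^ Nat.card K = 1 := pow_card_eq_one'
    rw [← orderOf_eq_one_iff]
    exact Nat.eq_one_of_dvd_coprimes h (orderOf_dvd_of_pow_eq_one h1)
      (orderOf_dvd_of_pow_eq_one h2)

/-- The commutator of n and k is the product of a conjugate of k with k⁻¹, both killed by |K|, yet
it lies in N. Coprimality makes it trivial, so k acts trivially. -/
theorem trivial_of_pow_card_closed [Finite N] [Finite K]
    (h : (Nat.card N).Coprime (Nat.card K))
    (hc : ∀ x y : N ⋊[φ] K, x ^ Nat.card K = 1 → y ^ Nat.card K = 1 → (x * y) ^ Nat.card K = 1) :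
    φ = 1 := by
  ext k n
  have hk : ∀ k : K, (inr k : N ⋊[φ] K) ^ Nat.card K = 1 := fun k => by
    rw [← map_pow, pow_card_eq_one', map_one]
  have h1 : (inl n * inr k * (inl n)⁻¹ : N ⋊[φ] K) ^ Nat.card K = 1 := by
    rw [conj_pow, hk, mul_one, mul_inv_cancel]
  have h2 := hc _ _ h1 (hk k⁻¹)
  have h3 : (inl n * inr k * (inl n)⁻¹ * inr k⁻¹ : N ⋊[φ] K) = inl (n * (φ k n)⁻¹) := by
    ext <;> simp
  rw [h3, ← map_pow, ← map_one inl, inl_inj] at h2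
  have h4 : (n * (φ k n)⁻¹) ^ Nat.card N = 1 := pow_card_eq_one'
  have h5 : n * (φ k n)⁻¹ = 1 := by
    rw [← orderOf_eq_one_iff]
    exact Nat.eq_one_of_dvd_coprimes h (orderOf_dvd_of_pow_eq_one h4)
      (orderOf_dvd_of_pow_eq_one h2)
  exact (mul_inv_eq_one.mp h5).symm

/-- An isomorphism of semidirect products with coprime factors and abelian kernel induces
compatible isomorphisms of the factors. -/
theorem exists_compatible_of_mulEquiv [Finite N] [Finite K] [Finite N'] [Finite K']
    (h : (Nat.card N).Coprime (Nat.card K)) (hN : Nat.card N = Nat.card N')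
    (hK : Nat.card K = Nat.card K') (f : N ⋊[φ] K ≃* N' ⋊[ψ] K') :
    ∃ (α : N ≃* N') (β : K ≃* K'), (∀ k n, α (φ k n) = ψ (β k) (α n)) ∧
      (∀ n, f (inl n) = inl (α n)) ∧ ∀ x, (f x).right = β x.right := by
  have h' : (Nat.card N').Coprime (Nat.card K') := hN ▸ hK ▸ h
  have hf : ∀ x, x.right = 1 → (f x).right = 1 := fun x hx => by
    rw [right_eq_one_iff_pow_card h', ← hN, ← map_pow, (right_eq_one_iff_pow_card h x).mp hx,
      map_one]
  have hf' : ∀ x, x.right = 1 → (f.symm x).right = 1 := fun x hx => by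
    rw [right_eq_one_iff_pow_card h, hN, ← map_pow, (right_eq_one_iff_pow_card h' x).mp hx,
      map_one]
  have e1 : ∀ x : N' ⋊[ψ] K', x.right = 1 → inl x.left = x := fun x hx => by
    ext <;> simp [hx]
  have e2 : ∀ x : N ⋊[φ] K, x.right = 1 → inl x.left = x := fun x hx => by
    ext <;> simp [hx]
  let α : N ≃* N' :=
    { toFun := fun n => (f (inl n)).left
      invFun := fun n => (f.symm (inl n)).left
      left_inv := fun n => by
        simp only
        rw [e1 _ (hf _ (right_inl n)), MulEquiv.symm_apply_apply, left_inl]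
      right_inv := fun n => by
        simp only
        rw [e2 _ (hf' _ (right_inl n)), MulEquiv.apply_symm_apply, left_inl]
      map_mul' := fun m n => by
        rw [map_mul, map_mul, mul_left, hf _ (right_inl m), map_one, MulAut.one_apply] }
  have hα : ∀ n, f (inl n) = inl (α n) := fun n => (e1 _ (hf _ (right_inl n))).symm
  have hα' : ∀ n, f.symm (inl n) = inl (α.symm n) := fun n => (e2 _ (hf' _ (right_inl n))).symm
  let β : K ≃* K' :=
    { toFun := fun k => (f (inr k)).right
      invFun := fun k => (f.symm (inr k)).right
      left_inv := fun k => by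
        simp only
        have h1 : (inr (f (inr k)).right : N' ⋊[ψ] K') =
            inl (f (inr k)).left⁻¹ * f (inr k) := by
          ext <;> simp
        rw [h1, map_mul, mul_right, hα', right_inl, one_mul, MulEquiv.symm_apply_apply, right_inr]
      right_inv := fun k => by
        simp only
        have h1 : (inr (f.symm (inr k)).right : N ⋊[φ] K) =
            inl (f.symm (inr k)).left⁻¹ * f.symm (inr k) := by
          ext <;> simp
        rw [h1, map_mul, mul_right, hα, right_inl, one_mul, MulEquiv.apply_symm_apply, right_inr]
      map_mul' := fun m n => by
        rw [map_mul, map_mul, mul_right] }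
  have hβ : ∀ x, (f x).right = β x.right := fun x => by
    conv_lhs => rw [← inl_left_mul_inr_right x, map_mul, mul_right, hα, right_inl, one_mul]
    rfl
  refine ⟨α, β, fun k n => ?_, hα, hβ⟩
  have h1 : inr k * inl n = (inl (φ k n) * inr k : N ⋊[φ] K) := by
    ext <;> simp
  have h2 := congrArg (fun x => (f x).left) h1
  simp only [map_mul, mul_left, hα, left_inl, right_inl, map_one, MulAut.one_apply] at h2
  -- Commutativity of N' lets the kernel component of `f (inr k)`, which need not vanish, cancel.
  rw [mul_comm] at h2
  exact (mul_right_cancel h2).symm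

/-- A complement-valued cocycle with coprime orders is a coboundary. -/
theorem exists_coboundary [Finite N] [Finite K]
    (h : (Nat.card N).Coprime (Nat.card K)) (c : K → N)
    (hc : ∀ k l, c (k * l) = c k * φ k (c l)) :
    ∃ n, ∀ k, c k = n * (φ k n)⁻¹ := by
  classical
  have : Fintype K := Fintype.ofFinite K
  -- Multiplying the cocycle identity over all l gives m = c(k)^|K| · φ_k(m). Raising to the power
  -- |K| is bijective on N, so the |K|-th root of m is the witness.
  let m := ∏ k, c k
  have hm : ∀ k, m = c k ^ Nat.card K * φ k m := fun k => by
    have h1 : m = ∏ l, c (k * l) := (Equiv.prod_comp (Equiv.mulLeft k) c).symm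
    simp only [hc, Finset.prod_mul_distrib, Finset.prod_const, Finset.card_univ,
      ← Nat.card_eq_fintype_card] at h1
    rw [← map_prod] at h1
    exact h1
  obtain ⟨n, hn⟩ : ∃ n : N, n ^ Nat.card K = m := (powCoprime h).surjective m
  refine ⟨n, fun k => (powCoprime h).injective ?_⟩
  change c k ^ Nat.card K = (n * (φ k n)⁻¹) ^ Nat.card K
  rw [mul_pow, inv_pow, ← map_pow, hn, eq_mul_inv_iff_mul_eq, ← hm]

section Aut

variable {L : Type*} [Group L] (a : L →* MulAut N) (b : L →* MulAut K)
  (hab : ∀ l k n, a l (φ k n) = φ (b l k) (a l n))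

/-- Compatible pairs of automorphisms act on a semidirect product. -/
def pairAut : L →* MulAut (N ⋊[φ] K) where
  toFun l := SemidirectProduct.congr (a l) (b l) fun k => MulEquiv.ext fun n => hab l k n
  map_one' := by ext <;> simp
  map_mul' l m := by ext <;> simp

/-- The natural map from `N ⋊ L` to the automorphisms of `N ⋊ K`, where `N` acts by conjugation. -/
def holAut : N ⋊[a] L →* MulAut (N ⋊[φ] K) :=
  SemidirectProduct.lift ((MulAut.conj).comp inl) (pairAut a b hab) fun l => by
    ext n x : 2
    apply (pairAut a b hab l).symm.injective
    ext <;> simp [pairAut]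

theorem holAut_apply (x : N ⋊[a] L) (y : N ⋊[φ] K) :
    holAut a b hab x y = inl x.left * ⟨a x.right y.left, b x.right y.right⟩ * (inl x.left)⁻¹ :=
  rfl

/-- Injectivity: the actions on N and on the quotient K determine the component in L, and then the
component in N is a fixed point of K. Surjectivity: dividing an automorphism by the pair it induces
leaves one that is trivial on N and on the quotient. It has the form k ↦ c(k)k with c a cocycle, and
since c is a coboundary it is conjugation by an element of N. -/
theorem holAut_bijective [Finite N] [Finite K] (h : (Nat.card N).Coprime (Nat.card K))
    (hfix : ∀ n, (∀ k, φ k n = n) → n = 1)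
    (hinj : ∀ l, a l = 1 → b l = 1 → l = 1)
    (hsurj : ∀ (α : MulAut N) (β : MulAut K), (∀ k n, α (φ k n) = φ (β k) (α n)) →
      ∃ l, a l = α ∧ b l = β) :
    Function.Bijective (holAut a b hab) := by
  constructor
  · rw [injective_iff_map_eq_one]
    intro x hx
    have h1 : ∀ y : N ⋊[φ] K, inl x.left * ⟨a x.right y.left, b x.right y.right⟩ *
        (inl x.left)⁻¹ = y := fun y => by
      rw [← holAut_apply a b hab, hx, MulAut.one_apply]
    have hr : x.right = 1 := by
      apply hinj
      · ext n
        have h2 := congrArg SemidirectProduct.left (h1 (inl n))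
        simpa using h2
      · ext k
        have h2 := congrArg SemidirectProduct.right (h1 (inr k))
        simpa using h2
    have hl : x.left = 1 := by
      refine hfix _ fun k => ?_
      have h2 := congrArg SemidirectProduct.left (h1 (inr k))
      simp [hr, mul_inv_eq_one] at h2
      exact h2.symm
    ext
    · exact hl
    · exact hr
  · intro f
    obtain ⟨α, β, hαβ, hα, hβ⟩ := exists_compatible_of_mulEquiv h rfl rfl f
    obtain ⟨l, rfl, rfl⟩ := hsurj α β hαβ
    let f' := f * (pairAut a b hab l)⁻¹
    have hf : f = f' * pairAut a b hab l := by simp [f']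
    have h1 : ∀ n, f' (inl n) = inl n := fun n => by
      have : (inl n : N ⋊[φ] K) = pairAut a b hab l (inl ((a l)⁻¹ n)) := by
        ext <;> simp [pairAut]
      rw [this, ← MulAut.mul_apply, ← hf, hα]
      ext <;> simp [pairAut]
    have h2 : ∀ x, (f' x).right = x.right := fun x => by
      obtain ⟨y, rfl⟩ := (pairAut a b hab l).surjective x
      rw [← MulAut.mul_apply, ← hf, hβ]
      simp [pairAut]
    let c : K → N := fun k => (f' (inr k)).left
    have hc : ∀ k, f' (inr k) = ⟨c k, k⟩ := fun k => by
      ext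
      · rfl
      · rw [h2, right_inr]
    obtain ⟨n, hn⟩ := exists_coboundary (φ := φ) h c fun k k' => by
      have h3 := congrArg SemidirectProduct.left (map_mul f' (inr k) (inr k'))
      rw [← map_mul, hc, hc, hc] at h3
      exact h3
    refine ⟨⟨n, l⟩, ?_⟩
    have h4 : f' = MulAut.conj (inl n) := by
      ext1 x
      rw [← inl_left_mul_inr_right x, map_mul, map_mul, h1, hc, hn]
      ext
      · simp [← mul_assoc, mul_comm x.left]
      · simp
    rw [hf, h4]
    ext1 x
    rfl

theorem nonempty_mulAut_semidirect [Finite N] [Finite K]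
    (hab : ∀ l k n, a l (φ k n) = φ (b l k) (a l n)) (h : (Nat.card N).Coprime (Nat.card K))
    (hfix : ∀ n, (∀ k, φ k n = n) → n = 1)
    (hinj : ∀ l, a l = 1 → b l = 1 → l = 1)
    (hsurj : ∀ (α : MulAut N) (β : MulAut K), (∀ k n, α (φ k n) = φ (β k) (α n)) →
      ∃ l, a l = α ∧ b l = β) :
    Nonempty (MulAut (N ⋊[φ] K) ≃* N ⋊[a] L) :=
  ⟨(MulEquiv.ofBijective _ (holAut_bijective a b hab h hfix hinj hsurj)).symm⟩

end Aut

end CoprimeSemidirect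

/-! ### Automorphisms of direct products -/

section ProdAut

variable {A B : Type*} [Group A] [Group B]

/-- If all automorphisms of `A × B` preserve both factors, they are pairs of automorphisms. -/
theorem nonempty_mulAut_prod
    (hA : ∀ (f : MulAut (A × B)) a, (f (a, 1)).2 = 1)
    (hB : ∀ (f : MulAut (A × B)) b, (f (1, b)).1 = 1) :
    Nonempty (MulAut (A × B) ≃* MulAut A × MulAut B) := by
  have hf : ∀ (f : MulAut (A × B)) x, f x = ((f (x.1, 1)).1, (f (1, x.2)).2) := fun f x => by
    have : x = (x.1, 1) * (1, x.2) := by simp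
    conv_lhs => rw [this, map_mul]
    ext <;> simp [hA, hB]
  let F : MulAut A × MulAut B →* MulAut (A × B) :=
    { toFun := fun x => MulEquiv.prodCongr x.1 x.2
      map_one' := rfl
      map_mul' := fun _ _ => rfl }
  refine ⟨(MulEquiv.ofBijective F ⟨?_, fun f => ?_⟩).symm⟩
  · rw [injective_iff_map_eq_one]
    intro x hx
    ext z
    · exact congrArg Prod.fst (DFunLike.congr_fun hx (z, 1))
    · exact congrArg Prod.snd (DFunLike.congr_fun hx (1, z))
  · have h1 : ∀ (f : MulAut (A × B)) a, ((f (a, 1)).1, 1) = f (a, 1) := fun f a =>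
      Prod.ext rfl (hA f a).symm
    have h2 : ∀ (f : MulAut (A × B)) b, (1, (f (1, b)).2) = f (1, b) := fun f b =>
      Prod.ext (hB f b).symm rfl
    refine ⟨(⟨⟨fun a => (f (a, 1)).1, fun a => (f.symm (a, 1)).1, fun a => ?_, fun a => ?_⟩,
      fun a a' => ?_⟩, ⟨⟨fun b => (f (1, b)).2, fun b => (f.symm (1, b)).2, fun b => ?_,
      fun b => ?_⟩, fun b b' => ?_⟩), MulEquiv.ext fun x => (hf f x).symm⟩
    · simp only [h1, MulEquiv.symm_apply_apply]
    · simp only [h1 f.symm, MulEquiv.apply_symm_apply]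
    · simp only [← Prod.fst_mul, ← map_mul, Prod.mk_mul_mk, mul_one]
    · simp only [h2, MulEquiv.symm_apply_apply]
    · simp only [h2 f.symm, MulEquiv.apply_symm_apply]
    · simp only [← Prod.snd_mul, ← map_mul, Prod.mk_mul_mk, mul_one]

end ProdAut

/-! ### Cyclic groups, their automorphisms and actions -/

/-- The standard generator of `Cyc n`. -/
abbrev cgen (n : ℕ) : Cyc n := Multiplicative.ofAdd 1

theorem cgen_pow (n k : ℕ) : cgen n ^ k = Multiplicative.ofAdd (k : ZMod n) := by
  rw [← ofAdd_nsmul, nsmul_one]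

theorem cgen_pow_self (n : ℕ) : cgen n ^ n = 1 := by
  rw [cgen_pow, ZMod.natCast_self, ofAdd_zero]

theorem eq_cgen_pow {n : ℕ} [NeZero n] (x : Cyc n) : x = cgen n ^ x.toAdd.val := by
  rw [cgen_pow, ZMod.natCast_zmod_val, ofAdd_toAdd]

theorem cyc_hom_ext {n : ℕ} [NeZero n] {A : Type*} [Monoid A] {φ ψ : Cyc n →* A}
    (h : φ (cgen n) = ψ (cgen n)) : φ = ψ := by
  refine MonoidHom.ext fun x => ?_
  rw [eq_cgen_pow x, map_pow, map_pow, h]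

theorem card_cyc (n : ℕ) : Nat.card (Cyc n) = n := by
  rw [Nat.card_congr Multiplicative.toAdd, Nat.card_zmod]

theorem orderOf_cgen (n : ℕ) : orderOf (cgen n) = n := by
  rw [orderOf_ofAdd_eq_addOrderOf, ZMod.addOrderOf_one]

theorem map_cgen_pow {n : ℕ} {A : Type*} [Monoid A] (φ : Cyc n →* A) : φ (cgen n) ^ n = 1 := by
  rw [← map_pow, cgen_pow_self, map_one]

theorem map_eq_one_iff_orderOf {n : ℕ} [NeZero n] {A : Type*} [Group A] (φ : Cyc n →* A) :
    φ = 1 ↔ φ (cgen n) = 1 :=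
  ⟨fun h => by rw [h]; rfl, fun h => cyc_hom_ext (by rw [h]; rfl)⟩

theorem toAdd_mulAut_cyc {n : ℕ} (α : MulAut (Cyc n)) (x : Cyc n) :
    (α x).toAdd = (α (cgen n)).toAdd * x.toAdd := by
  obtain ⟨k, hk⟩ := ZMod.intCast_surjective x.toAdd
  have : x = cgen n ^ k := by
    rw [← ofAdd_zsmul, zsmul_one, hk, ofAdd_toAdd]
  conv_lhs => rw [this, map_zpow, toAdd_zpow, zsmul_eq_mul, hk, mul_comm]

/-- Units of `ℤ/n` as automorphisms of the cyclic group. -/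
def unitsAut (n : ℕ) : (ZMod n)ˣ ≃* MulAut (Cyc n) where
  toFun u :=
    { toFun := fun x => Multiplicative.ofAdd (u * x.toAdd)
      invFun := fun x => Multiplicative.ofAdd (((u⁻¹ : (ZMod n)ˣ) : ZMod n) * x.toAdd)
      left_inv := fun x => by simp
      right_inv := fun x => by simp
      map_mul' := fun x y => by simp [mul_add] }
  invFun α :=
    ⟨(α (cgen n)).toAdd, (α.symm (cgen n)).toAdd,
      by rw [← toAdd_mulAut_cyc, MulEquiv.apply_symm_apply, toAdd_ofAdd],
      by rw [← toAdd_mulAut_cyc, MulEquiv.symm_apply_apply, toAdd_ofAdd]⟩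
  left_inv u := by ext; simp
  right_inv α := MulEquiv.ext fun x =>
    Multiplicative.toAdd.injective (toAdd_mulAut_cyc α x).symm
  map_mul' u v := by ext x; simp [mul_assoc]

theorem toAdd_unitsAut {n : ℕ} (u : (ZMod n)ˣ) (x : Cyc n) :
    (unitsAut n u x).toAdd = u * x.toAdd := rfl

theorem mulAut_cyc_apply {n : ℕ} (α : MulAut (Cyc n)) (x : Cyc n) :
    (α x).toAdd = ((unitsAut n).symm α : (ZMod n)ˣ) * x.toAdd := by
  rw [← toAdd_unitsAut, MulEquiv.apply_symm_apply]

theorem mulAut_cyc_comm {n : ℕ} (α β : MulAut (Cyc n)) : α * β = β * α :=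
  (unitsAut n).symm.injective (by rw [map_mul, map_mul, mul_comm])

theorem card_mulAut_cyc (n : ℕ) [NeZero n] : Nat.card (MulAut (Cyc n)) = n.totient := by
  rw [← Nat.card_congr (unitsAut n).toEquiv, Nat.card_eq_fintype_card, ZMod.card_units_eq_totient]

instance (p : ℕ) [Fact p.Prime] : IsCyclic (MulAut (Cyc p)) :=
  isCyclic_of_surjective (unitsAut p) (unitsAut p).surjective

instance (n : ℕ) [NeZero n] : Finite (MulAut (Cyc n)) :=
  Finite.of_equiv _ (unitsAut n).toEquiv

/-- In a cyclic group the equation a^d = 1 has at most d solutions, so any subgroup of order d is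
the whole solution set. -/
theorem zpowers_eq_of_orderOf_eq {A : Type*} [Group A] [Finite A] [IsCyclic A] {x y : A}
    (h : orderOf x = orderOf y) : Subgroup.zpowers x = Subgroup.zpowers y := by
  classical
  have : Fintype A := Fintype.ofFinite A
  let T : Finset A := Finset.univ.filter fun a => a ^ orderOf x = 1
  have hT : T.card ≤ orderOf x := IsCyclic.card_pow_eq_one_le (orderOf_pos x)
  have key : ∀ z : A, orderOf z = orderOf x → (Subgroup.zpowers z : Set A) = T := fun z hz => by
    have h1 : (Subgroup.zpowers z : Set A).toFinset ⊆ T := fun w hw => by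
      have hw' : w ∈ Subgroup.zpowers z := by simpa using hw
      simp only [T, Finset.mem_filter, Finset.mem_univ, true_and]
      rw [← hz]
      exact orderOf_dvd_iff_pow_eq_one.mp (orderOf_dvd_of_mem_zpowers hw')
    have h2 := Finset.eq_of_subset_of_card_le h1 (by
      rw [Set.toFinset_card]
      refine hT.trans ?_
      rw [← hz, ← Nat.card_zpowers, ← Nat.card_eq_fintype_card]
      rfl)
    rw [← h2, Set.coe_toFinset]
  exact SetLike.coe_injective ((key x rfl).trans (key y h.symm).symm)

theorem exists_orderOf_eq {A : Type*} [Group A] [Finite A] [IsCyclic A] {d : ℕ}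
    (h : d ∣ Nat.card A) : ∃ x : A, orderOf x = d := by
  obtain ⟨g, hg⟩ := IsCyclic.exists_ofOrder_eq_natCard (α := A)
  obtain ⟨e, he⟩ := h
  have he0 : e ≠ 0 := by
    rintro rfl
    exact Nat.card_pos.ne' (he.trans (mul_zero d))
  refine ⟨g ^ e, ?_⟩
  rw [orderOf_pow_of_dvd he0 (by rw [hg, he]; exact dvd_mul_left _ _), hg, he,
    Nat.mul_div_cancel _ (Nat.pos_of_ne_zero he0)]

/-- Two homomorphisms from a cyclic group with the same image differ by an automorphism. -/
theorem exists_twist {n : ℕ} [NeZero n] {A : Type*} [Group A] {φ ψ : Cyc n →* A}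
    (h : Subgroup.zpowers (φ (cgen n)) = Subgroup.zpowers (ψ (cgen n))) :
    ∃ β : MulAut (Cyc n), ∀ k, ψ (β k) = φ k := by
  classical
  set x := φ (cgen n) with hx
  set y := ψ (cgen n) with hy
  have hd : orderOf y ∣ n := orderOf_dvd_of_pow_eq_one (map_cgen_pow ψ)
  have hxy : orderOf x = orderOf y := by
    rw [← Nat.card_zpowers, h, Nat.card_zpowers]
  have hfin : IsOfFinOrder y := orderOf_pos_iff.mp (Nat.pos_of_dvd_of_pos hd (NeZero.pos n))
  obtain ⟨m, hm⟩ := hfin.mem_zpowers_iff_mem_range_orderOf.mp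
    (h ▸ Subgroup.mem_zpowers x) |> fun h => Finset.mem_image.mp h
  have hm' : y ^ m = x := hm.2
  have hcop : m.Coprime (orderOf y) := by
    have h1 : orderOf (y ^ m) = orderOf y := by rw [hm', hxy]
    rw [hfin.orderOf_pow] at h1
    have h2 := hfin.orderOf_pos
    have h3 : Nat.gcd (orderOf y) m = 1 := by
      have h4 := Nat.div_mul_cancel (Nat.gcd_dvd_left (orderOf y) m)
      rw [h1] at h4
      exact Nat.eq_of_mul_eq_mul_left h2 (by rw [h4, mul_one])
    rw [Nat.coprime_comm]
    exact h3
  -- The exponent m is a unit only modulo the order of y. An automorphism of `Cyc n` needs a unit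
  -- modulo n, which exists since units lift along ℤ/n → ℤ/d for d ∣ n.
  obtain ⟨u, hu⟩ := ZMod.unitsMap_surjective hd (ZMod.unitOfCoprime m hcop)
  refine ⟨unitsAut n u, fun k => ?_⟩
  have : (ψ.comp (unitsAut n u).toMonoidHom) = φ := by
    apply cyc_hom_ext
    have h1 : unitsAut n u (cgen n) = cgen n ^ (u : ZMod n).val := by
      rw [cgen_pow, ZMod.natCast_zmod_val]
      simp [unitsAut]
    change ψ (unitsAut n u (cgen n)) = φ (cgen n)
    rw [h1, map_pow, ← hy, ← hx, ← hm', pow_eq_pow_iff_modEq, ← ZMod.natCast_eq_natCast_iff]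
    have h2 := congrArg Units.val hu
    rw [ZMod.unitsMap_val, ZMod.coe_unitOfCoprime] at h2
    rw [← h2, ZMod.natCast_val]
  rw [← this]
  rfl

/-- The basic source of isomorphisms: only the image of the action counts, since a change of
generator of the image is absorbed by an automorphism of the acting cyclic group. -/
theorem nonempty_semidirect_congr {n : ℕ} [NeZero n] {N N' : Type*} [Group N] [Group N']
    (α : N ≃* N') {φ : Cyc n →* MulAut N} {ψ : Cyc n →* MulAut N'}
    (h : Subgroup.zpowers (MulAut.congr α (φ (cgen n))) = Subgroup.zpowers (ψ (cgen n))) :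
    Nonempty (N ⋊[φ] Cyc n ≃* N' ⋊[ψ] Cyc n) := by
  obtain ⟨β, hβ⟩ := exists_twist (φ := (MulAut.congr α).toMonoidHom.comp φ) (ψ := ψ) h
  refine ⟨SemidirectProduct.congr α β fun k => ?_⟩
  ext x
  rw [hβ]
  simp

theorem zpowers_eq_of_pow_eq {A : Type*} [Group A] {q : ℕ} [Fact q.Prime] {x y : A} (k : ℕ)
    (hy : y ^ q = 1) (hx : x ≠ 1) (h : x = y ^ k) : Subgroup.zpowers x = Subgroup.zpowers y := by
  have hy1 : y ≠ 1 := by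
    rintro rfl
    exact hx (by rw [h, one_pow])
  have hx' : x ^ q = 1 := by rw [h, ← pow_mul, mul_comm, pow_mul, hy, one_pow]
  have : Finite (Subgroup.zpowers y) := by
    apply Nat.finite_of_card_ne_zero
    rw [Nat.card_zpowers, orderOf_eq_prime hy hy1]
    exact (Fact.out : q.Prime).ne_zero
  refine Subgroup.eq_of_le_of_card_ge ?_ ?_
  · rw [Subgroup.zpowers_le, h]
    exact pow_mem (Subgroup.mem_zpowers y) k
  · rw [Nat.card_zpowers, Nat.card_zpowers, orderOf_eq_prime hy hy1, orderOf_eq_prime hx' hx]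

theorem card_ker_mul_orderOf {n : ℕ} [NeZero n] {A : Type*} [Group A] (φ : Cyc n →* A) :
    Nat.card φ.ker * orderOf (φ (cgen n)) = n := by
  have h1 := φ.ker.card_mul_index
  rw [Subgroup.index_ker, card_cyc] at h1
  have h2 : φ.range = Subgroup.zpowers (φ (cgen n)) := by
    apply le_antisymm
    · rintro _ ⟨x, rfl⟩
      rw [eq_cgen_pow x, map_pow]
      exact pow_mem (Subgroup.mem_zpowers _) _
    · rw [Subgroup.zpowers_le]
      exact ⟨_, rfl⟩
  rwa [h2, Nat.card_zpowers] at h1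

/-- Each k acts as multiplication by a scalar of the field ℤ/q, and a scalar that fixes a nonzero
element is 1. -/
theorem fixedPointFree_of_ne_one {q : ℕ} [Fact q.Prime] {K : Type*} [Group K]
    {φ : K →* MulAut (Cyc q)} (h : φ ≠ 1) (n : Cyc q) (hn : ∀ k, φ k n = n) : n = 1 := by
  by_contra hne
  apply h
  ext1 k
  have h1 := congrArg Multiplicative.toAdd (hn k)
  rw [mulAut_cyc_apply] at h1
  have h2 : n.toAdd ≠ 0 := hne
  have h3 : ((unitsAut q).symm (φ k) : ZMod q) = 1 := by
    apply mul_right_cancel₀ h2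
    rw [h1, one_mul]
  have h4 : (unitsAut q).symm (φ k) = 1 := Units.ext h3
  rw [MulEquiv.map_eq_one_iff] at h4
  exact h4

/-- The centre is the copy of ker φ inside K: commuting with the abelian kernel forces the
K-component to act trivially, and commuting with K makes the other component a fixed point. -/
theorem card_center_semidirect {q : ℕ} [Fact q.Prime] {K : Type*} [CommGroup K]
    {φ : K →* MulAut (Cyc q)} (h : φ ≠ 1) :
    Nat.card (Subgroup.center (Cyc q ⋊[φ] K)) = Nat.card φ.ker := by
  have : Subgroup.center (Cyc q ⋊[φ] K) = φ.ker.map SemidirectProduct.inr := by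
    ext x
    rw [Subgroup.mem_center_iff, Subgroup.mem_map]
    constructor
    · intro hx
      have h1 : φ x.right = 1 := by
        ext m
        have := congrArg SemidirectProduct.left (hx (SemidirectProduct.inl m))
        simp only [SemidirectProduct.mul_left, SemidirectProduct.left_inl,
          SemidirectProduct.right_inl, map_one, MulAut.one_apply] at this
        rw [mul_comm] at this
        exact (mul_left_cancel this).symm
      have h2 : x.left = 1 := by
        refine fixedPointFree_of_ne_one h _ fun k => ?_
        have := congrArg SemidirectProduct.left (hx (SemidirectProduct.inr k))
        simpa using this
      refine ⟨x.right, h1, ?_⟩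
      ext <;> simp [h2]
    · rintro ⟨k, hk, rfl⟩ g
      have hk' : φ k = 1 := hk
      ext
      · simp [hk']
      · simp [mul_comm]
  rw [this]
  exact (Nat.card_congr (Subgroup.equivMapOfInjective _ _
    SemidirectProduct.inr_injective).toEquiv).symm

/-- The automorphisms of the complement that fix the action. -/
def actionStab {N K : Type*} [Group N] [Group K] (φ : K →* MulAut N) : Subgroup (MulAut K) where
  carrier := {β | ∀ k, φ (β k) = φ k}
  one_mem' := fun _ => rfl
  mul_mem' := fun {a b} ha hb k => by
    rw [MulAut.mul_apply, ha, hb]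
  inv_mem' := fun {a} ha k => by
    rw [← ha (a⁻¹ k), MulAut.apply_inv_self]

/-- Aut(C_n) is abelian, so a pair (α, β) is compatible exactly when φ ∘ β = φ, with α arbitrary.
The β do not act on C_n and split off as a direct factor. -/
theorem nonempty_mulAut_cyc_semidirect {n : ℕ} [NeZero n] {K : Type} [Group K] [Finite K]
    {φ : K →* MulAut (Cyc n)} (h : n.Coprime (Nat.card K))
    (hfix : ∀ n, (∀ k, φ k n = n) → n = 1) :
    Nonempty (MulAut (Cyc n ⋊[φ] K) ≃* Hol (Cyc n) × actionStab φ) := by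
  obtain ⟨e⟩ := nonempty_mulAut_semidirect (φ := φ)
    (MonoidHom.fst (MulAut (Cyc n)) (actionStab φ))
    ((actionStab φ).subtype.comp (MonoidHom.snd (MulAut (Cyc n)) (actionStab φ)))
    (fun l k x => by
      have h1 : φ (l.2.1 k) = φ k := l.2.2 k
      change (l.1 * φ k) x = (φ (l.2.1 k) * l.1) x
      rw [h1, mulAut_cyc_comm])
    (by rwa [card_cyc])
    hfix (fun l h1 h2 => Prod.ext h1 (Subtype.ext h2))
    (fun α β hab => ⟨(α, ⟨β, fun k => by
      have h1 : α * φ k = φ (β k) * α := MulEquiv.ext (hab k)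
      rw [mulAut_cyc_comm] at h1
      exact (mul_right_cancel h1).symm⟩), rfl, rfl⟩)
  refine ⟨e.trans
    { toFun := fun x => (⟨x.left, x.right.1⟩, x.right.2)
      invFun := fun x => ⟨x.1.left, (x.1.right, x.2)⟩
      left_inv := fun _ => rfl
      right_inv := fun _ => rfl
      map_mul' := fun _ _ => rfl }⟩

theorem nonempty_mulAut_prod_of_coprime {A B : Type*} [Group A] [Group B] [Finite A] [Finite B]
    (h : (Nat.card A).Coprime (Nat.card B)) :
    Nonempty (MulAut (A × B) ≃* MulAut A × MulAut B) := by
  refine nonempty_mulAut_prod (fun f a => ?_) (fun f b => ?_) <;> rw [← orderOf_eq_one_iff]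
  · refine Nat.eq_one_of_dvd_coprimes h ?_ (orderOf_dvd_natCard _)
    apply orderOf_dvd_of_pow_eq_one
    rw [← Prod.pow_snd, ← map_pow, Prod.pow_mk, pow_card_eq_one', one_pow, Prod.mk_one_one,
      map_one, Prod.snd_one]
  · refine Nat.eq_one_of_dvd_coprimes h (orderOf_dvd_natCard _) ?_
    apply orderOf_dvd_of_pow_eq_one
    rw [← Prod.pow_fst, ← map_pow, Prod.pow_mk, pow_card_eq_one', one_pow, Prod.mk_one_one,
      map_one, Prod.fst_one]

theorem injective_of_orderOf_map_cgen {n : ℕ} [NeZero n] {A : Type*} [Group A] {φ : Cyc n →* A}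
    (h : orderOf (φ (cgen n)) = n) : Function.Injective φ := by
  rw [← MonoidHom.ker_eq_bot_iff, ← Subgroup.card_eq_one]
  have := card_ker_mul_orderOf φ
  rw [h] at this
  exact Nat.eq_of_mul_eq_mul_right (NeZero.pos n) (by rw [this, one_mul])

theorem orderOf_map_cgen_of_ne_one {p : ℕ} [Fact p.Prime] {A : Type*} [Group A] {φ : Cyc p →* A}
    (h : φ ≠ 1) : orderOf (φ (cgen p)) = p :=
  orderOf_eq_prime (map_cgen_pow φ) fun h' => h ((map_eq_one_iff_orderOf φ).mpr h')

theorem card_mulAut_cyc_prime (q : ℕ) [Fact q.Prime] : Nat.card (MulAut (Cyc q)) = q - 1 := by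
  rw [card_mulAut_cyc, Nat.totient_prime Fact.out]

theorem card_mulAut_cyc_sq (p : ℕ) [Fact p.Prime] :
    Nat.card (MulAut (Cyc (p ^ 2))) = p * (p - 1) := by
  rw [card_mulAut_cyc, Nat.totient_prime_pow Fact.out two_pos]
  simp

instance (p : ℕ) [Fact p.Prime] : IsCyclic (MulAut (Cyc (p ^ 2))) := by
  have h : IsCyclic (ZMod (p ^ 2))ˣ := by
    rw [ZMod.isCyclic_units_iff]
    rcases (Fact.out : p.Prime).eq_two_or_odd' with rfl | hodd
    · norm_num
    · exact Or.inr (Or.inr (Or.inr (Or.inr ⟨p, 2, Fact.out, hodd, one_le_two, Or.inl rfl⟩)))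
  exact isCyclic_of_surjective (unitsAut (p ^ 2)) (unitsAut (p ^ 2)).surjective

theorem nonempty_mulEquiv_cyc_of_card {A : Type*} [Group A] [IsCyclic A] {n : ℕ}
    (h : Nat.card A = n) : Nonempty (A ≃* Cyc n) :=
  ⟨mulEquivOfCyclicCardEq (by rw [h, card_cyc])⟩

theorem nonempty_cyc_mul {m n : ℕ} (h : m.Coprime n) : Nonempty (Cyc (m * n) ≃* Cyc m × Cyc n) :=
  ⟨(AddEquiv.toMultiplicative (ZMod.chineseRemainder h).toAddEquiv).trans
    (MulEquiv.prodMultiplicative _ _)⟩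

/-! ### Types with cyclic kernel: centres and automorphism groups -/

section

variable (p q : ℕ) [Fact p.Prime] [Fact q.Prime]

theorem nonempty_mulAut_cyc_sq : Nonempty (MulAut (Cyc (p ^ 2)) ≃* Cyc p × Cyc (p - 1)) := by
  obtain ⟨e⟩ := nonempty_mulEquiv_cyc_of_card (card_mulAut_cyc_sq p)
  have h2 := (Fact.out : p.Prime).two_le
  obtain ⟨e'⟩ := nonempty_cyc_mul (m := p) (n := p - 1) (by
    rw [Nat.Prime.coprime_iff_not_dvd Fact.out]
    exact Nat.not_dvd_of_pos_of_lt (by omega) (by omega))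
  exact ⟨e.trans e'⟩

variable {p q}

theorem coprime_sq (hpq : p ≠ q) : (p ^ 2).Coprime q :=
  Nat.Coprime.pow_left 2 ((Nat.coprime_primes Fact.out Fact.out).mpr hpq)

theorem nonempty_mulAut_cyc_sq_prod (hpq : p ≠ q) :
    Nonempty (MulAut (Cyc (p ^ 2) × Cyc q) ≃* Cyc p × Cyc (p - 1) × Cyc (q - 1)) := by
  obtain ⟨e⟩ := nonempty_mulAut_prod_of_coprime (A := Cyc (p ^ 2)) (B := Cyc q) (by
    rw [card_cyc, card_cyc]
    exact coprime_sq hpq)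
  obtain ⟨e1⟩ := nonempty_mulAut_cyc_sq p
  obtain ⟨e2⟩ := nonempty_mulEquiv_cyc_of_card (card_mulAut_cyc_prime q)
  exact ⟨(e.trans (MulEquiv.prodCongr e1 e2)).trans MulEquiv.prodAssoc⟩

theorem card_center_cyc_semidirect_eq {φ : Cyc (p ^ 2) →* MulAut (Cyc q)} (hφ : φ ≠ 1) :
    Nat.card (Subgroup.center (Cyc q ⋊[φ] Cyc (p ^ 2))) * orderOf (φ (cgen _)) = p ^ 2 := by
  rw [card_center_semidirect hφ, card_ker_mul_orderOf]

theorem card_cyc_semidirect {m n : ℕ} (φ : Cyc m →* MulAut (Cyc n)) :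
    Nat.card (Cyc n ⋊[φ] Cyc m) = n * m := by
  rw [SemidirectProduct.card, card_cyc, card_cyc]

theorem not_prime_sq_mul_dvd : ¬ p ^ 2 * q ∣ p := fun h => by
  have h1 := Nat.le_of_dvd (Fact.out : p.Prime).pos h
  have h2 := (Fact.out : p.Prime).two_le
  have h3 := (Fact.out : q.Prime).two_le
  nlinarith

/-- For non-trivial φ the order of the centre times the order of φ on the generator is p². A trivial
φ satisfies neither side, the centre then having order p²q. This and `center_eq_bot_iff` turn the
conditions on centres in types 2 and 3 into conditions on orders. -/
theorem card_center_eq_prime_iff (φ : Cyc (p ^ 2) →* MulAut (Cyc q)) :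
    Nat.card (Subgroup.center (Cyc q ⋊[φ] Cyc (p ^ 2))) = p ↔ orderOf (φ (cgen _)) = p := by
  have hp := (Fact.out : p.Prime).pos
  by_cases hφ : φ = 1
  · have h1 : ¬ orderOf (φ (cgen _)) = p := by
      rw [hφ, MonoidHom.one_apply, orderOf_one]
      exact (Fact.out : p.Prime).one_lt.ne
    refine iff_of_false (fun h => ?_) h1
    have h2 : Subgroup.center (Cyc q ⋊[φ] Cyc (p ^ 2)) = ⊤ := by
      rw [eq_top_iff]
      intro x _
      rw [Subgroup.mem_center_iff]
      intro g
      subst hφ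
      ext <;> simp [mul_comm]
    rw [h2, Subgroup.card_top, card_cyc_semidirect] at h
    exact not_prime_sq_mul_dvd (p := p) (q := q) (dvd_of_eq (by rw [mul_comm, h]))
  · have h := (card_center_cyc_semidirect_eq hφ).trans (sq p)
    constructor
    · intro h1
      rw [h1] at h
      exact Nat.eq_of_mul_eq_mul_left hp h
    · intro h1
      rw [h1] at h
      exact Nat.eq_of_mul_eq_mul_right hp h

theorem center_eq_bot_iff (φ : Cyc (p ^ 2) →* MulAut (Cyc q)) :
    Subgroup.center (Cyc q ⋊[φ] Cyc (p ^ 2)) = ⊥ ↔ orderOf (φ (cgen _)) = p ^ 2 := by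
  have hp : 0 < p ^ 2 := NeZero.pos _
  have hp1 : 1 < p ^ 2 := Nat.one_lt_pow two_ne_zero (Fact.out : p.Prime).one_lt
  rw [← Subgroup.card_eq_one]
  by_cases hφ : φ = 1
  · have h1 : ¬ orderOf (φ (cgen _)) = p ^ 2 := by
      rw [hφ, MonoidHom.one_apply, orderOf_one]
      exact hp1.ne
    refine iff_of_false (fun h => ?_) h1
    have h2 : Subgroup.center (Cyc q ⋊[φ] Cyc (p ^ 2)) = ⊤ := by
      rw [eq_top_iff]
      intro x _
      rw [Subgroup.mem_center_iff]
      intro g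
      subst hφ
      ext <;> simp [mul_comm]
    rw [h2, Subgroup.card_top, card_cyc_semidirect, mul_eq_one] at h
    exact (Fact.out : q.Prime).one_lt.ne' h.1
  · have h := card_center_cyc_semidirect_eq hφ
    constructor
    · intro h1
      rwa [h1, one_mul] at h
    · intro h1
      rw [h1] at h
      exact Nat.eq_of_mul_eq_mul_right hp (by rw [h, one_mul])

theorem ne_one_of_one_lt_orderOf {n : ℕ} {A : Type*} [Group A] {φ : Cyc n →* A}
    (h : 1 < orderOf (φ (cgen _))) : φ ≠ 1 := by
  rintro rfl
  rw [MonoidHom.one_apply, orderOf_one] at h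
  exact lt_irrefl _ h

theorem nonempty_cyc_semidirect_congr {m n : ℕ} [NeZero m] [NeZero n] [IsCyclic (MulAut (Cyc n))]
    {φ ψ : Cyc m →* MulAut (Cyc n)} (h : orderOf (φ (cgen _)) = orderOf (ψ (cgen _))) :
    Nonempty (Cyc n ⋊[φ] Cyc m ≃* Cyc n ⋊[ψ] Cyc m) :=
  nonempty_semidirect_congr (MulEquiv.refl _) (zpowers_eq_of_orderOf_eq (by
    rw [← h]
    exact congrArg orderOf (MulEquiv.ext fun _ => rfl)))

theorem exists_hom_orderOf_eq {A : Type} [Group A] [Finite A] [IsCyclic A] {n d : ℕ}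
    (hd : d ∣ n) (h : d ∣ Nat.card A) : ∃ φ : Cyc n →* A, orderOf (φ (cgen n)) = d := by
  obtain ⟨g, hg⟩ := exists_orderOf_eq h
  refine ⟨cycLift n g (orderOf_dvd_iff_pow_eq_one.mp (hg ▸ hd)), ?_⟩
  rw [cycLift_gen, hg]

theorem actionStab_eq_bot {N K : Type*} [Group N] [Group K] {φ : K →* MulAut N}
    (h : Function.Injective φ) : actionStab φ = ⊥ := by
  rw [eq_bot_iff]
  intro β hβ
  rw [Subgroup.mem_bot]
  ext k
  exact h (hβ k)

theorem nonempty_mulAut_cyc_semidirect_of_injective {n : ℕ} [NeZero n] {K : Type} [Group K]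
    [Finite K] {φ : K →* MulAut (Cyc n)} (h : n.Coprime (Nat.card K))
    (hfix : ∀ n, (∀ k, φ k n = n) → n = 1) (hφ : Function.Injective φ) :
    Nonempty (MulAut (Cyc n ⋊[φ] K) ≃* Hol (Cyc n)) := by
  obtain ⟨e⟩ := nonempty_mulAut_cyc_semidirect h hfix
  have : Unique (actionStab φ) := by
    rw [actionStab_eq_bot hφ]
    infer_instance
  exact ⟨e.trans MulEquiv.prodUnique⟩

theorem nonempty_mulAut_cyc_semidirect_sq (hpq : p ≠ q) {φ : Cyc (p ^ 2) →* MulAut (Cyc q)}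
    (h : orderOf (φ (cgen _)) = p ^ 2) :
    Nonempty (MulAut (Cyc q ⋊[φ] Cyc (p ^ 2)) ≃* Hol (Cyc q)) :=
  nonempty_mulAut_cyc_semidirect_of_injective (by
      rw [card_cyc]
      exact (coprime_sq hpq).symm)
    (fixedPointFree_of_ne_one (ne_one_of_one_lt_orderOf
      ((Nat.one_lt_pow two_ne_zero (Fact.out : p.Prime).one_lt).trans_eq h.symm)))
    (injective_of_orderOf_map_cgen h)

theorem card_ker_unitsMap_sq : Nat.card (ZMod.unitsMap (dvd_pow_self p two_ne_zero)).ker = p := by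
  have h1 := (ZMod.unitsMap (dvd_pow_self p two_ne_zero)).ker.card_mul_index
  rw [Subgroup.index_ker, MonoidHom.range_eq_top.mpr (ZMod.unitsMap_surjective _),
    Subgroup.card_top, Nat.card_congr (unitsAut p).toEquiv,
    Nat.card_congr (unitsAut (p ^ 2)).toEquiv, card_mulAut_cyc_prime, card_mulAut_cyc_sq] at h1
  have := (Fact.out : p.Prime).two_le
  exact Nat.eq_of_mul_eq_mul_right (by omega) h1

/-- As φ factors through the quotient of order p, multiplication by a unit u of ℤ/p² preserves it
exactly when u ≡ 1 mod p. Such units form the kernel of reduction, which has order p. -/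
theorem nonempty_actionStab_sq {φ : Cyc (p ^ 2) →* MulAut (Cyc q)}
    (h : orderOf (φ (cgen _)) = p) : Nonempty (actionStab φ ≃* Cyc p) := by
  have h1 : actionStab φ =
      (ZMod.unitsMap (dvd_pow_self p two_ne_zero)).ker.map (unitsAut (p ^ 2)).toMonoidHom := by
    ext β
    obtain ⟨u, rfl⟩ := (unitsAut (p ^ 2)).surjective β
    have h2 : unitsAut (p ^ 2) u (cgen _) = cgen _ ^ (u : ZMod (p ^ 2)).val := by
      rw [cgen_pow, ZMod.natCast_zmod_val]
      apply Multiplicative.toAdd.injective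
      rw [toAdd_unitsAut, toAdd_ofAdd, mul_one, toAdd_ofAdd]
    have h3 : unitsAut (p ^ 2) u ∈ actionStab φ ↔ φ (cgen _) ^ (u : ZMod (p ^ 2)).val =
        φ (cgen _) ^ 1 := by
      rw [← map_pow, ← h2, pow_one]
      refine ⟨fun hu => hu _, fun hu k => ?_⟩
      exact DFunLike.congr_fun (cyc_hom_ext (φ := φ.comp (unitsAut (p ^ 2) u).toMonoidHom) hu) k
    rw [h3, pow_eq_pow_iff_modEq, h, ← ZMod.natCast_eq_natCast_iff, ZMod.natCast_val]
    change _ ↔ unitsAut (p ^ 2) u ∈ Subgroup.map _ _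
    rw [Subgroup.mem_map_equiv, MulEquiv.symm_apply_apply, MonoidHom.mem_ker, Units.ext_iff,
      ZMod.unitsMap_val, Nat.cast_one, Units.val_one]
  have h2 : Nat.card (actionStab φ) = p := by
    rw [h1]
    refine Eq.trans ?_ (card_ker_unitsMap_sq (p := p))
    exact (Nat.card_congr (Subgroup.equivMapOfInjective _
      (unitsAut (p ^ 2)).toMonoidHom (unitsAut (p ^ 2)).injective).toEquiv).symm
  have := isCyclic_of_prime_card h2
  exact nonempty_mulEquiv_cyc_of_card h2

theorem nonempty_mulAut_cyc_semidirect_prime (hpq : p ≠ q) {φ : Cyc (p ^ 2) →* MulAut (Cyc q)}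
    (h : orderOf (φ (cgen _)) = p) :
    Nonempty (MulAut (Cyc q ⋊[φ] Cyc (p ^ 2)) ≃* Cyc p × Hol (Cyc q)) := by
  obtain ⟨e⟩ := nonempty_mulAut_cyc_semidirect (φ := φ) (by
      rw [card_cyc]
      exact (coprime_sq hpq).symm)
    (fixedPointFree_of_ne_one (ne_one_of_one_lt_orderOf
      ((Fact.out : p.Prime).one_lt.trans_eq h.symm)))
  obtain ⟨e'⟩ := nonempty_actionStab_sq h
  exact ⟨(e.trans (MulEquiv.prodCongr (MulEquiv.refl _) e')).trans MulEquiv.prodComm⟩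

/-- The generator acts as a unit u of order q. The units congruent to 1 mod p form a group of order
p ≠ q, so u is not among them, and u - 1 is invertible modulo p². -/
theorem fixedPointFree_cyc_sq (hpq : p ≠ q) {φ : Cyc q →* MulAut (Cyc (p ^ 2))} (h : φ ≠ 1)
    (n : Cyc (p ^ 2)) (hn : ∀ k, φ k n = n) : n = 1 := by
  set u := (unitsAut (p ^ 2)).symm (φ (cgen q)) with hu
  have hu1 : u ≠ 1 := by
    rw [hu, Ne, MulEquiv.map_eq_one_iff]
    exact fun h' => h ((map_eq_one_iff_orderOf φ).mpr h')
  have huq : u ^ q = 1 := by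
    rw [hu, ← map_pow, map_cgen_pow, map_one]
  have hker : u ∉ (ZMod.unitsMap (dvd_pow_self p two_ne_zero)).ker := fun hk => by
    have h1 : u ^ p = 1 := by
      have := pow_card_eq_one' (x := (⟨u, hk⟩ : (ZMod.unitsMap (dvd_pow_self p two_ne_zero)).ker))
      rw [card_ker_unitsMap_sq] at this
      exact congrArg Subtype.val this
    apply hu1
    rw [← orderOf_eq_one_iff]
    exact Nat.eq_one_of_dvd_coprimes ((Nat.coprime_primes Fact.out Fact.out).mpr hpq)
      (orderOf_dvd_of_pow_eq_one h1) (orderOf_dvd_of_pow_eq_one huq)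
  have hunit : IsUnit ((u : ZMod (p ^ 2)) - 1) := by
    rw [← ZMod.natCast_zmod_val ((u : ZMod (p ^ 2)) - 1), ZMod.isUnit_iff_coprime]
    apply Nat.Coprime.pow_right
    rw [Nat.coprime_comm, Nat.Prime.coprime_iff_not_dvd Fact.out, ← ZMod.natCast_eq_zero_iff]
    intro h0
    apply hker
    rw [MonoidHom.mem_ker, Units.ext_iff, ZMod.unitsMap_val, Units.val_one, ← sub_eq_zero]
    rw [ZMod.natCast_val, ZMod.cast_sub (dvd_pow_self p two_ne_zero),
      ZMod.cast_one (dvd_pow_self p two_ne_zero)] at h0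
    exact h0
  have h1 := congrArg Multiplicative.toAdd (hn (cgen q))
  rw [mulAut_cyc_apply, ← hu, ← sub_eq_zero, ← sub_one_mul, hunit.mul_right_eq_zero] at h1
  exact h1

theorem nonempty_mulAut_cyc_sq_semidirect (hpq : p ≠ q) {φ : Cyc q →* MulAut (Cyc (p ^ 2))}
    (h : φ ≠ 1) : Nonempty (MulAut (Cyc (p ^ 2) ⋊[φ] Cyc q) ≃* Hol (Cyc (p ^ 2))) :=
  nonempty_mulAut_cyc_semidirect_of_injective (by
      rw [card_cyc]
      exact coprime_sq hpq)
    (fixedPointFree_cyc_sq hpq h) (injective_of_orderOf_map_cgen (orderOf_map_cgen_of_ne_one h))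

/-- `A × (N ⋊ K)` as a semidirect product by `A × K`. -/
def prodSemidirect (A : Type*) {N K : Type*} [Group A] [Group N] [Group K] (φ : K →* MulAut N) :
    A × (N ⋊[φ] K) ≃* N ⋊[φ.comp (MonoidHom.snd A K)] (A × K) where
  toFun x := ⟨x.2.left, (x.1, x.2.right)⟩
  invFun x := (x.right.1, ⟨x.left, x.right.2⟩)
  left_inv _ := rfl
  right_inv _ := rfl
  map_mul' _ _ := rfl

/-- Affine maps of the cyclic group as automorphisms of its square fixing the second coordinate. -/
def shear (n : ℕ) : Hol (Cyc n) →* MulAut (Cyc n × Cyc n) where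
  toFun h :=
    { toFun := fun x =>
        (h.right x.1 * Multiplicative.ofAdd (h.left.toAdd * x.2.toAdd), x.2)
      invFun := fun x =>
        (h.right.symm (x.1 * (Multiplicative.ofAdd (h.left.toAdd * x.2.toAdd))⁻¹), x.2)
      left_inv := fun x => by simp
      right_inv := fun x => by simp
      map_mul' := fun x y => by
        ext
        · simp only [Prod.fst_mul, map_mul, Prod.snd_mul, toAdd_mul, mul_add, ofAdd_add]
          exact add_add_add_comm _ _ _ _
        · rfl }
  map_one' := by
    ext x
    · simp
    · rfl
  map_mul' g h := by
    ext x
    · simp only [MulEquiv.coe_mk, Equiv.coe_fn_mk, SemidirectProduct.mul_left,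
        SemidirectProduct.mul_right, MulAut.mul_apply, toAdd_mul, toAdd_ofAdd, MonoidHom.id_apply,
        map_mul]
      rw [mulAut_cyc_apply g.right h.left, mulAut_cyc_apply g.right (Multiplicative.ofAdd _),
        toAdd_ofAdd]
      ring
    · rfl

/-- A non-trivial φ is injective on C_p, so the stabilizer consists of the automorphisms of C_p ×
C_p that keep the second coordinate. These are the maps (x, y) ↦ (αx + cy, y), which compose like
affine maps. -/
theorem nonempty_actionStab_comp_snd {φ : Cyc p →* MulAut (Cyc q)} (h : φ ≠ 1) :
    Nonempty (actionStab (φ.comp (MonoidHom.snd (Cyc p) (Cyc p))) ≃* Hol (Cyc p)) := by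
  have hφ := injective_of_orderOf_map_cgen (orderOf_map_cgen_of_ne_one h)
  have hinj : Function.Injective (shear p) := by
    rw [injective_iff_map_eq_one]
    intro g hg
    have h1 : ∀ x, shear p g x = x := fun x => by rw [hg, MulAut.one_apply]
    ext1
    · have := congrArg Prod.fst (h1 (1, cgen p))
      simpa [shear] using this
    · ext x
      have := congrArg Prod.fst (h1 (x, 1))
      simpa [shear] using this
  have hrange : (shear p).range = actionStab (φ.comp (MonoidHom.snd (Cyc p) (Cyc p))) := by
    ext β
    constructor
    · rintro ⟨g, rfl⟩ k
      rfl
    · intro hβ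
      have h2 : ∀ x, (β x).2 = x.2 := fun x => hφ (hβ x)
      have h3 : ∀ x, β (x, 1) = ((β (x, 1)).1, 1) := fun x => Prod.ext rfl (h2 _)
      have h2' : ∀ x, (β.symm x).2 = x.2 := fun x => by
        rw [← h2, MulEquiv.apply_symm_apply]
      have h3' : ∀ x, β.symm (x, 1) = ((β.symm (x, 1)).1, 1) := fun x => Prod.ext rfl (h2' _)
      refine ⟨⟨(β (1, cgen p)).1, ⟨⟨fun x => (β (x, 1)).1, fun x => (β.symm (x, 1)).1,
        fun x => ?_, fun x => ?_⟩, fun x y => ?_⟩⟩, ?_⟩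
      · simp only
        rw [← h3, MulEquiv.symm_apply_apply]
      · simp only
        rw [← h3', MulEquiv.apply_symm_apply]
      · simp only
        rw [← Prod.fst_mul, ← map_mul, Prod.mk_mul_mk, mul_one]
      · ext1 x
        have h4 : x = (x.1, 1) * (1, cgen p) ^ x.2.toAdd.val := by
          ext1
          · simp
          · simp [← eq_cgen_pow]
        conv_rhs => rw [h4, map_mul, map_pow]
        ext1
        · simp [shear]
          apply Multiplicative.toAdd.injective
          simp [mul_comm]
        · simp [shear, h2, ← eq_cgen_pow]
  exact ⟨((MonoidHom.ofInjective hinj).trans (MulEquiv.subgroupCongr hrange)).symm⟩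

theorem nonempty_mulAut_cyc_prod_semidirect (hpq : p ≠ q) {φ : Cyc p →* MulAut (Cyc q)}
    (h : φ ≠ 1) :
    Nonempty (MulAut (Cyc p × (Cyc q ⋊[φ] Cyc p)) ≃* Hol (Cyc p) × Hol (Cyc q)) := by
  obtain ⟨e⟩ := nonempty_mulAut_cyc_semidirect (φ := φ.comp (MonoidHom.snd (Cyc p) (Cyc p))) (by
      rw [Nat.card_prod, card_cyc, ← sq]
      exact (coprime_sq hpq).symm)
    (fixedPointFree_of_ne_one fun h' => h (MonoidHom.ext fun k =>
      DFunLike.congr_fun h' ((1, k) : Cyc p × Cyc p)))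
  obtain ⟨e'⟩ := nonempty_actionStab_comp_snd h
  exact ⟨((MulAut.congr (prodSemidirect _ φ)).trans (e.trans
    (MulEquiv.prodCongr (MulEquiv.refl _) e'))).trans MulEquiv.prodComm⟩

end

/-! ### Matrices acting on the plane: eigenvectors and diagonalization -/

section

variable {p : ℕ} [Fact p.Prime]

theorem toAdd_glAct (A : GL (Fin 2) (ZMod p)) (v : Plane p) :
    (glAct p A v).toAdd = (A : Matrix (Fin 2) (Fin 2) (ZMod p)) *ᵥ v.toAdd := rfl

/-- An additive map between vector spaces over the prime field is automatically linear, so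
automorphisms of C_p × C_p are invertible matrices. -/
theorem glAct_bijective : Function.Bijective (glAct p) := by
  constructor
  · intro A B h
    apply Units.ext
    apply Matrix.mulVec_injective
    ext1 v
    exact congrArg Multiplicative.toAdd (DFunLike.congr_fun h (Multiplicative.ofAdd v))
  · intro α
    let f : MulAut (Plane p) → (Fin 2 → ZMod p) →ₗ[ZMod p] (Fin 2 → ZMod p) := fun α =>
      (AddMonoidHom.toMultiplicative.symm α.toMonoidHom).toZModLinearMap p
    have hf : ∀ α v, f α v = (α (Multiplicative.ofAdd v)).toAdd := fun _ _ => rfl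
    have h : ∀ α β : MulAut (Plane p), α * β = 1 →
        LinearMap.toMatrix' (f α) * LinearMap.toMatrix' (f β) = 1 := fun α β hab => by
      rw [← LinearMap.toMatrix'_comp, ← LinearMap.toMatrix'_id]
      congr 1
      refine LinearMap.ext fun v => ?_
      rw [LinearMap.comp_apply, hf, hf, ofAdd_toAdd, ← MulAut.mul_apply, hab]
      rfl
    refine ⟨⟨LinearMap.toMatrix' (f α), LinearMap.toMatrix' (f α⁻¹), h _ _ (mul_inv_cancel α),
      h _ _ (inv_mul_cancel α)⟩, ?_⟩
    ext1 v
    apply Multiplicative.toAdd.injective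
    rw [toAdd_glAct]
    change LinearMap.toMatrix' (f α) *ᵥ v.toAdd = _
    rw [LinearMap.toMatrix'_mulVec]
    rfl

theorem card_plane : Nat.card (Plane p) = p ^ 2 := by
  rw [Nat.card_congr Multiplicative.toAdd]
  simp

section Iso

variable {q : ℕ} [Fact q.Prime] {φ ψ : Cyc q →* GL (Fin 2) (ZMod p)}

/-- With `exists_conj_eq_pow` this translates isomorphism of plane semidirect products into
conjugacy up to powers. Here non-triviality, together with q prime, ensures that the k-th power
still generates the same cyclic group. -/
theorem nonempty_plane_congr (P : GL (Fin 2) (ZMod p)) (k : ℕ)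
    (h : P * φ (cgen q) * P⁻¹ = ψ (cgen q) ^ k) (h1 : φ (cgen q) ≠ 1) :
    Nonempty (Plane p ⋊[(glAct p).comp φ] Cyc q ≃* Plane p ⋊[(glAct p).comp ψ] Cyc q) := by
  refine nonempty_semidirect_congr (glAct p P) ?_
  have h2 : MulAut.congr (glAct p P) (((glAct p).comp φ) (cgen q)) =
      glAct p (P * φ (cgen q) * P⁻¹) := by
    rw [map_mul, map_mul, map_inv]
    rfl
  rw [h2, MonoidHom.comp_apply, ← MonoidHom.map_zpowers, ← MonoidHom.map_zpowers]
  congr 1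
  refine zpowers_eq_of_pow_eq k (map_cgen_pow ψ) (fun h3 => h1 ?_) h
  rwa [conj_eq_one_iff] at h3

theorem exists_conj_eq_pow (hpq : p ≠ q)
    (h : Nonempty (Plane p ⋊[(glAct p).comp φ] Cyc q ≃* Plane p ⋊[(glAct p).comp ψ] Cyc q)) :
    ∃ (P : GL (Fin 2) (ZMod p)) (k : ℕ), P * φ (cgen q) * P⁻¹ = ψ (cgen q) ^ k := by
  obtain ⟨f⟩ := h
  obtain ⟨α, β, hab, -⟩ := exists_compatible_of_mulEquiv (by
    rw [card_plane, card_cyc]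
    exact coprime_sq hpq) rfl rfl f
  obtain ⟨P, rfl⟩ := glAct_bijective.2 α
  refine ⟨P, (β (cgen q)).toAdd.val, glAct_bijective.1 ?_⟩
  rw [← map_pow, ← eq_cgen_pow, map_mul, map_mul, map_inv, mul_inv_eq_iff_eq_mul]
  exact MulEquiv.ext (hab (cgen q))

end Iso

/-- Having an eigenvector. -/
def HasEig (Z : GL (Fin 2) (ZMod p)) : Prop :=
  ∃ v : Fin 2 → ZMod p, v ≠ 0 ∧ ∃ c : ZMod p, (Z : Matrix (Fin 2) (Fin 2) (ZMod p)) *ᵥ v = c • v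

/-- Having a nonzero fixed vector. -/
def HasFix (Z : GL (Fin 2) (ZMod p)) : Prop :=
  ∃ v : Fin 2 → ZMod p, v ≠ 0 ∧ (Z : Matrix (Fin 2) (Fin 2) (ZMod p)) *ᵥ v = v

/-- Diagonal matrices with second diagonal entry different from the first, which is `1`. -/
def KindF (Z : GL (Fin 2) (ZMod p)) : Prop :=
  ∃ a : ZMod p, a ≠ 1 ∧ (Z : Matrix (Fin 2) (Fin 2) (ZMod p)) = Matrix.diagonal ![1, a]

theorem mulVec_pow_of_mulVec_eq {Z : Matrix (Fin 2) (Fin 2) (ZMod p)} {v : Fin 2 → ZMod p}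
    {c : ZMod p} (h : Z *ᵥ v = c • v) (k : ℕ) : (Z ^ k) *ᵥ v = c ^ k • v := by
  induction k with
  | zero => simp
  | succ k ih => rw [pow_succ', ← Matrix.mulVec_mulVec, ih, Matrix.mulVec_smul, h, smul_smul,
      pow_succ]

theorem mulVec_ne_zero (P : GL (Fin 2) (ZMod p)) {v : Fin 2 → ZMod p} (hv : v ≠ 0) :
    (P : Matrix (Fin 2) (Fin 2) (ZMod p)) *ᵥ v ≠ 0 := fun h => by
  apply hv
  have := congrArg (fun w => ((P⁻¹ : GL (Fin 2) (ZMod p)) : Matrix (Fin 2) (Fin 2) (ZMod p)) *ᵥ w) h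
  simpa only [Matrix.mulVec_mulVec, ← Units.val_mul, inv_mul_cancel, Units.val_one,
    Matrix.one_mulVec, Matrix.mulVec_zero] using this

section Conj

variable {Z Z' P : GL (Fin 2) (ZMod p)} {k : ℕ}

theorem eq_conj_pow (h : P * Z * P⁻¹ = Z' ^ k) : Z = P⁻¹ * Z' ^ k * P := by
  rw [← h]; group

theorem mulVec_conj_pow {v : Fin 2 → ZMod p} {c : ZMod p} (h : P * Z * P⁻¹ = Z' ^ k)
    (hc : (Z' : Matrix (Fin 2) (Fin 2) (ZMod p)) *ᵥ v = c • v) :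
    (Z : Matrix (Fin 2) (Fin 2) (ZMod p)) *ᵥ
      (((P⁻¹ : GL (Fin 2) (ZMod p)) : Matrix (Fin 2) (Fin 2) (ZMod p)) *ᵥ v) =
        c ^ k • (((P⁻¹ : GL (Fin 2) (ZMod p)) : Matrix (Fin 2) (Fin 2) (ZMod p)) *ᵥ v) := by
  rw [Matrix.mulVec_mulVec, ← Units.val_mul]
  have h1 : Z * P⁻¹ = P⁻¹ * Z' ^ k := by rw [← h]; group
  rw [h1, Units.val_mul, Units.val_pow_eq_pow_val, ← Matrix.mulVec_mulVec,
    mulVec_pow_of_mulVec_eq hc, Matrix.mulVec_smul]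

/-- This and the next three lemmas transfer a property of Z' to every conjugate of a power of Z'.
Isomorphic groups give such relations in both directions, so these properties become isomorphism
invariants. -/
theorem HasEig.of_conj (h : P * Z * P⁻¹ = Z' ^ k) : HasEig Z' → HasEig Z := by
  rintro ⟨v, hv, c, hc⟩
  exact ⟨_, mulVec_ne_zero _ hv, _, mulVec_conj_pow h hc⟩

theorem HasFix.of_conj (h : P * Z * P⁻¹ = Z' ^ k) : HasFix Z' → HasFix Z := by
  rintro ⟨v, hv, hc⟩
  refine ⟨_, mulVec_ne_zero P⁻¹ hv, ?_⟩
  have := mulVec_conj_pow (c := 1) h (by rw [hc, one_smul])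
  rwa [one_pow, one_smul] at this

theorem IsScalarMat.of_conj (h : P * Z * P⁻¹ = Z' ^ k) : IsScalarMat Z' → IsScalarMat Z := by
  rintro ⟨c, hc⟩
  refine ⟨c ^ k, ?_⟩
  rw [eq_conj_pow h, Units.val_mul, Units.val_mul, Units.val_pow_eq_pow_val, hc, ← map_pow,
    mul_assoc, (Matrix.scalar_commute (c ^ k) (fun r => mul_comm _ r) _).eq, ← mul_assoc,
    ← Units.val_mul, inv_mul_cancel, Units.val_one, one_mul]

theorem det_eq_one_of_conj (h : P * Z * P⁻¹ = Z' ^ k)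
    (hd : (Z' : Matrix (Fin 2) (Fin 2) (ZMod p)).det = 1) :
    (Z : Matrix (Fin 2) (Fin 2) (ZMod p)).det = 1 := by
  have h1 := congrArg (fun A : GL (Fin 2) (ZMod p) => (A : Matrix (Fin 2) (Fin 2) (ZMod p)).det) h
  simp only [Units.val_mul, Matrix.det_mul, Units.val_pow_eq_pow_val, Matrix.det_pow, hd,
    one_pow] at h1
  rwa [mul_right_comm, ← Matrix.det_mul, ← Units.val_mul, mul_inv_cancel, Units.val_one,
    Matrix.det_one, one_mul] at h1

end Conj

theorem HasFix.hasEig {Z : GL (Fin 2) (ZMod p)} : HasFix Z → HasEig Z := by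
  rintro ⟨v, hv, h⟩
  exact ⟨v, hv, 1, by rw [h, one_smul]⟩

theorem hasEig_of_diagonal {Z : GL (Fin 2) (ZMod p)} {a b : ZMod p}
    (h : (Z : Matrix (Fin 2) (Fin 2) (ZMod p)) = Matrix.diagonal ![a, b]) : HasEig Z := by
  refine ⟨![1, 0], fun h0 => one_ne_zero (congrFun h0 0), a, ?_⟩
  rw [h]
  ext i
  fin_cases i <;> simp [Matrix.mulVec_diagonal]

theorem not_hasFix_of_diagonal {Z : GL (Fin 2) (ZMod p)} {a b : ZMod p}
    (h : (Z : Matrix (Fin 2) (Fin 2) (ZMod p)) = Matrix.diagonal ![a, b]) (ha : a ≠ 1)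
    (hb : b ≠ 1) : ¬ HasFix Z := by
  rintro ⟨v, hv, hf⟩
  rw [h] at hf
  apply hv
  have h0 := congrFun hf 0
  have h1 := congrFun hf 1
  rw [Matrix.mulVec_diagonal] at h0 h1
  have h0' : a * v 0 = v 0 := h0
  have h1' : b * v 1 = v 1 := h1
  ext i
  fin_cases i
  · by_contra hv0
    exact ha (mul_right_cancel₀ hv0 (h0'.trans (one_mul _).symm))
  · by_contra hv0
    exact hb (mul_right_cancel₀ hv0 (h1'.trans (one_mul _).symm))

theorem not_isScalarMat_of_diagonal {Z : GL (Fin 2) (ZMod p)} {a b : ZMod p}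
    (h : (Z : Matrix (Fin 2) (Fin 2) (ZMod p)) = Matrix.diagonal ![a, b]) (hab : a ≠ b) :
    ¬ IsScalarMat Z := by
  rintro ⟨c, hc⟩
  rw [h] at hc
  have h0 := congrFun (congrFun hc 0) 0
  have h1 := congrFun (congrFun hc 1) 1
  simp at h0 h1
  exact hab (h0.trans h1.symm)

theorem scalar_eq_diagonal (c : ZMod p) :
    Matrix.scalar (Fin 2) c = Matrix.diagonal ![c, c] := by
  ext i j
  fin_cases i <;> fin_cases j <;> simp

/-- The off-diagonal entry of the n-th power is n c^(n-1) x; the additional scalar factor c avoids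
the exponent n - 1. -/
theorem upper_pow (c x : ZMod p) (n : ℕ) :
    (!![c, x; 0, c] : Matrix (Fin 2) (Fin 2) (ZMod p)) ^ n * !![c, 0; 0, c] =
      !![c ^ (n + 1), n * c ^ n * x; 0, c ^ (n + 1)] := by
  induction n with
  | zero => simp
  | succ n ih =>
    rw [pow_succ', mul_assoc, ih]
    ext i j
    fin_cases i <;> fin_cases j <;> simp <;> ring

/-- A matrix of finite order prime to `p` with an eigenvector is diagonalizable. -/
theorem HasEig.exists_diagonal {Z : GL (Fin 2) (ZMod p)} (hZ : HasEig Z) {q : ℕ}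
    (hq : (q : ZMod p) ≠ 0) (hZq : Z ^ q = 1) :
    ∃ (P : GL (Fin 2) (ZMod p)) (a b : ZMod p),
      ((P * Z * P⁻¹ : GL (Fin 2) (ZMod p)) : Matrix (Fin 2) (Fin 2) (ZMod p)) =
        Matrix.diagonal ![a, b] := by
  obtain ⟨v, hv, c, hc⟩ := hZ
  -- M completes the eigenvector v to a basis by a standard vector, chosen according to which
  -- coordinate of v is nonzero.
  obtain ⟨M, hM⟩ : ∃ M : GL (Fin 2) (ZMod p),
      (M : Matrix (Fin 2) (Fin 2) (ZMod p)) *ᵥ ![1, 0] = v := by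
    by_cases h0 : v 0 = 0
    · have h1 : v 1 ≠ 0 := fun h1 => hv (by ext i; fin_cases i <;> assumption)
      refine ⟨Matrix.GeneralLinearGroup.mkOfDetNeZero !![v 0, 1; v 1, 0] (by
        simpa [Matrix.det_fin_two] using h1), ?_⟩
      ext i
      fin_cases i <;> simp [Matrix.GeneralLinearGroup.mkOfDetNeZero, Matrix.mulVec,
        dotProduct, Fin.sum_univ_two]
    · refine ⟨Matrix.GeneralLinearGroup.mkOfDetNeZero !![v 0, 0; v 1, 1] (by
        simpa [Matrix.det_fin_two] using h0), ?_⟩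
      ext i
      fin_cases i <;> simp [Matrix.GeneralLinearGroup.mkOfDetNeZero, Matrix.mulVec,
        dotProduct, Fin.sum_univ_two]
  set T := M⁻¹ * Z * M with hT
  have hTq : T ^ q = 1 := by
    have : T = M⁻¹ * Z * M⁻¹⁻¹ := by rw [inv_inv]
    rw [this, conj_pow, hZq, mul_one, mul_inv_cancel]
  have hTv : (T : Matrix (Fin 2) (Fin 2) (ZMod p)) *ᵥ ![1, 0] = c • ![1, 0] := by
    rw [hT, mul_assoc, Units.val_mul, Units.val_mul, ← Matrix.mulVec_mulVec,
      ← Matrix.mulVec_mulVec, hM, hc, Matrix.mulVec_smul, ← hM, Matrix.mulVec_mulVec,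
      ← Units.val_mul, inv_mul_cancel, Units.val_one, Matrix.one_mulVec]
  obtain ⟨x, d, hxd⟩ : ∃ x d, (T : Matrix (Fin 2) (Fin 2) (ZMod p)) = !![c, x; 0, d] := by
    refine ⟨(T : Matrix (Fin 2) (Fin 2) (ZMod p)) 0 1, (T : Matrix (Fin 2) (Fin 2) (ZMod p)) 1 1,
      ?_⟩
    have h0 := congrFun hTv 0
    have h1 := congrFun hTv 1
    simp [Matrix.mulVec, dotProduct, Fin.sum_univ_two] at h0 h1
    ext i j
    fin_cases i <;> fin_cases j <;> simp [h0, h1]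
  by_cases hcd : c = d
  · subst hcd
    refine ⟨M⁻¹, c, c, ?_⟩
    rw [inv_inv, ← hT, hxd]
    have hc0 : c ≠ 0 := by
      rintro rfl
      have h2 := congrArg Matrix.det hxd
      have h3 : IsUnit (T : Matrix (Fin 2) (Fin 2) (ZMod p)).det :=
        (Matrix.isUnit_iff_isUnit_det _).mp T.isUnit
      rw [h2, Matrix.det_fin_two_of] at h3
      simp at h3
    -- With a repeated eigenvalue, T^q = 1 forces q c^q x = 0, hence x = 0 because q and c are
    -- nonzero modulo p.
    have h1 := upper_pow c x q
    rw [← hxd, ← Units.val_pow_eq_pow_val, hTq, Units.val_one, one_mul] at h1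
    have h2 := congrFun (congrFun h1 0) 1
    simp [hq, hc0] at h2
    rw [h2]
    ext i j
    fin_cases i <;> fin_cases j <;> simp
  -- The value of t for which conjugation by the shear (1, t; 0, 1) removes the off-diagonal entry
  -- x.
  · let t := x / (c - d)
    have ht : x + t * d = c * t := by
      have : c - d ≠ 0 := sub_ne_zero.mpr hcd
      simp only [t]
      field_simp
      ring
    let Q : GL (Fin 2) (ZMod p) := Matrix.GeneralLinearGroup.mkOfDetNeZero !![1, t; 0, 1] (by simp)
    have hQ : (Q : Matrix (Fin 2) (Fin 2) (ZMod p)) = !![1, t; 0, 1] := rfl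
    refine ⟨Q * M⁻¹, c, d, ?_⟩
    have h1 : Q * M⁻¹ * Z * (Q * M⁻¹)⁻¹ = Q * T * Q⁻¹ := by rw [hT]; group
    have h2 : (Q : Matrix (Fin 2) (Fin 2) (ZMod p)) * T =
        Matrix.diagonal ![c, d] * (Q : Matrix (Fin 2) (Fin 2) (ZMod p)) := by
      rw [hQ, hxd]
      ext i j
      fin_cases i <;> fin_cases j <;> simp [ht]
    rw [h1, Units.val_mul, Units.val_mul, h2, mul_assoc, ← Units.val_mul, mul_inv_cancel,
      Units.val_one, mul_one]

end

/-! ### Matrices without eigenvectors, Singer cycles and the field with p² elements -/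

section

variable {p : ℕ} [Fact p.Prime]

theorem charpoly_irreducible_of_not_hasEig {Z : GL (Fin 2) (ZMod p)} (h : ¬ HasEig Z) :
    Irreducible (Z : Matrix (Fin 2) (Fin 2) (ZMod p)).charpoly := by
  have hd : (Z : Matrix (Fin 2) (Fin 2) (ZMod p)).charpoly.natDegree = 2 := by
    rw [Matrix.charpoly_natDegree_eq_dim, Fintype.card_fin]
  refine Polynomial.irreducible_of_degree_le_three_of_not_isRoot (by rw [hd]; decide)
    fun c hc => h ?_
  rw [Polynomial.IsRoot, Matrix.eval_charpoly] at hc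
  obtain ⟨v, hv, hv'⟩ := Matrix.exists_mulVec_eq_zero_iff.mpr hc
  refine ⟨v, hv, c, ?_⟩
  rw [Matrix.sub_mulVec, sub_eq_zero, Matrix.scalar_apply, ← Matrix.smul_one_eq_diagonal,
    Matrix.smul_mulVec, Matrix.one_mulVec] at hv'
  exact hv'.symm

instance : Finite (Fpp p) := Nat.finite_of_card_ne_zero (by
  rw [GaloisField.card p 2 two_ne_zero]
  exact pow_ne_zero 2 (Fact.out : p.Prime).ne_zero)

theorem card_fpp : Nat.card (Fpp p) = p ^ 2 := GaloisField.card p 2 two_ne_zero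

/-- The quotient of the polynomial ring by the irreducible characteristic polynomial is a field with
p² elements. By Cayley–Hamilton, evaluation at Z is defined on it and sends the class of X to Z. -/
theorem exists_field_hom {Z : GL (Fin 2) (ZMod p)} (h : ¬ HasEig Z) :
    ∃ (F : Fpp p →+* Matrix (Fin 2) (Fin 2) (ZMod p)) (ζ : Fpp p), F ζ = Z := by
  set f := (Z : Matrix (Fin 2) (Fin 2) (ZMod p)).charpoly with hf
  have hirr : Irreducible f := charpoly_irreducible_of_not_hasEig h
  have : Fact (Irreducible f) := ⟨hirr⟩
  have hmonic : f.Monic := Matrix.charpoly_monic _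
  have hd : f.natDegree = 2 := by
    rw [hf, Matrix.charpoly_natDegree_eq_dim, Fintype.card_fin]
  let pb := AdjoinRoot.powerBasis' hmonic
  have : Module.Finite (ZMod p) (AdjoinRoot f) := pb.finite
  have hcard : Nat.card (AdjoinRoot f) = p ^ 2 := by
    rw [Module.natCard_eq_pow_finrank (K := ZMod p), pb.finrank, AdjoinRoot.powerBasis'_dim, hd,
      Nat.card_zmod]
  have : Finite (AdjoinRoot f) := Module.finite_of_finite (ZMod p)
  let _ := Fintype.ofFinite (AdjoinRoot f)
  let _ := Fintype.ofFinite (Fpp p)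
  let e : Fpp p ≃+* AdjoinRoot f := FiniteField.ringEquivOfCardEq (by
    rw [← Nat.card_eq_fintype_card, ← Nat.card_eq_fintype_card, hcard, card_fpp])
  let F : AdjoinRoot f →+* Matrix (Fin 2) (Fin 2) (ZMod p) :=
    Ideal.Quotient.lift (Ideal.span {f})
      (Polynomial.aeval (Z : Matrix (Fin 2) (Fin 2) (ZMod p))).toRingHom fun a ha => by
        obtain ⟨b, rfl⟩ := Ideal.mem_span_singleton.mp ha
        change Polynomial.aeval _ (f * b) = 0
        rw [map_mul, hf, Matrix.aeval_self_charpoly, zero_mul]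
  refine ⟨F.comp e.toRingHom, e.symm (AdjoinRoot.root f), ?_⟩
  change F (e (e.symm _)) = _
  rw [RingEquiv.apply_symm_apply]
  exact Polynomial.aeval_X _

/-- An invertible matrix without eigenvectors acts as a multiplication in the field with `p ^ 2`
elements. -/
theorem exists_field_model {Z : GL (Fin 2) (ZMod p)} (h : ¬ HasEig Z) :
    ∃ (γ : Multiplicative (Fpp p) ≃* Plane p) (ζ : (Fpp p)ˣ),
      MulAut.congr γ (unitsAdd (Fpp p) ζ) = glAct p Z ∧
        ∀ c : ZMod p, (ζ : Fpp p) ≠ algebraMap (ZMod p) (Fpp p) c := by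
  obtain ⟨F, ζ, hF⟩ := exists_field_hom h
  have hζ : ζ ≠ 0 := by
    rintro rfl
    rw [map_zero] at hF
    exact Z.ne_zero hF.symm
  -- The identification of the field with the plane is the orbit map x ↦ F(x)e. It is injective
  -- because F(x) is invertible for x ≠ 0, and bijective by counting.
  let e : Fin 2 → ZMod p := ![1, 0]
  have he : e ≠ 0 := fun h => one_ne_zero (congrFun h 0)
  let g : Multiplicative (Fpp p) →* Plane p :=
    { toFun := fun x => Multiplicative.ofAdd (F x.toAdd *ᵥ e)
      map_one' := by simp
      map_mul' := fun x y => by rw [toAdd_mul, map_add, Matrix.add_mulVec, ofAdd_add] }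
  have hg : Function.Injective g := by
    rw [injective_iff_map_eq_one]
    intro x hx
    by_contra hx0
    have hx' : F x.toAdd *ᵥ e = 0 := hx
    have hne : x.toAdd ≠ 0 := hx0
    apply he
    have h1 : F (x.toAdd⁻¹) *ᵥ (F x.toAdd *ᵥ e) = e := by
      rw [Matrix.mulVec_mulVec, ← map_mul, inv_mul_cancel₀ hne, map_one, Matrix.one_mulVec]
    rw [← h1, hx', Matrix.mulVec_zero]
  have hb : Function.Bijective g := (Nat.bijective_iff_injective_and_card g).mpr ⟨hg, by
    rw [card_plane, Nat.card_congr Multiplicative.toAdd, card_fpp]⟩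
  refine ⟨MulEquiv.ofBijective g hb, Units.mk0 ζ hζ, ?_, fun c hc => h ?_⟩
  · refine MulEquiv.ext fun v => ?_
    obtain ⟨x, rfl⟩ := hb.2 v
    change MulEquiv.ofBijective g hb (unitsAdd (Fpp p) (Units.mk0 ζ hζ)
      ((MulEquiv.ofBijective g hb).symm (g x))) = _
    have h1 : (MulEquiv.ofBijective g hb).symm (g x) = x :=
      (MulEquiv.ofBijective g hb).symm_apply_apply x
    rw [h1]
    apply Multiplicative.toAdd.injective
    rw [toAdd_glAct]
    change F (ζ * x.toAdd) *ᵥ e = _ *ᵥ (F x.toAdd *ᵥ e)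
    rw [map_mul, hF, Matrix.mulVec_mulVec]
  · refine ⟨e, he, c, ?_⟩
    rw [← hF]
    have h1 : ζ = ((c.val : ℕ) : Fpp p) := by
      rw [Units.val_mk0] at hc
      rw [hc, ← map_natCast (algebraMap (ZMod p) (Fpp p)), ZMod.natCast_zmod_val]
    rw [h1, map_natCast, ← nsmul_one, Matrix.smul_mulVec, Matrix.one_mulVec,
      ← Nat.cast_smul_eq_nsmul (ZMod p), ZMod.natCast_zmod_val]

theorem exists_generator_fpp : ∃ g : (Fpp p)ˣ, orderOf g = p ^ 2 - 1 ∧ ∀ x, ∃ k : ℕ, x = g ^ k := by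
  obtain ⟨g, hg⟩ := IsCyclic.exists_monoid_generator (α := (Fpp p)ˣ)
  refine ⟨g, ?_, fun x => ?_⟩
  · rw [orderOf_eq_card_of_forall_mem_powers hg, Nat.card_units, card_fpp]
  · obtain ⟨k, hk⟩ := hg x
    exact ⟨k, hk.symm⟩

theorem unitsAdd_injective {K : Type} [Field K] : Function.Injective (unitsAdd K) := by
  intro u v h
  have := congrArg Multiplicative.toAdd (DFunLike.congr_fun h (Multiplicative.ofAdd 1))
  have h1 : (u : K) * 1 = v * 1 := this
  rw [mul_one, mul_one] at h1
  exact Units.ext h1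

theorem IsScalarMat.hasEig {Z : GL (Fin 2) (ZMod p)} : IsScalarMat Z → HasEig Z := by
  rintro ⟨c, hc⟩
  exact hasEig_of_diagonal (hc.trans (scalar_eq_diagonal c))

/-- Multiplication by a generator of the cyclic group of field units, transported to the plane, is a
Singer cycle, and every unit is a power of that generator. -/
theorem kindC_of_field_model {Z : GL (Fin 2) (ZMod p)} (h : ¬ IsScalarMat Z)
    (γ : Multiplicative (Fpp p) ≃* Plane p) (ζ : (Fpp p)ˣ)
    (hγ : MulAut.congr γ (unitsAdd (Fpp p) ζ) = glAct p Z) : KindC Z := by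
  obtain ⟨g, hg, hgen⟩ := exists_generator_fpp (p := p)
  obtain ⟨k, rfl⟩ := hgen ζ
  obtain ⟨σ, hσ⟩ := glAct_bijective.2 (MulAut.congr γ (unitsAdd (Fpp p) g))
  refine ⟨⟨σ, ?_, k, glAct_bijective.1 ?_⟩, h⟩
  · rw [← orderOf_injective (glAct p) glAct_bijective.1, hσ, MulEquiv.orderOf_eq,
      orderOf_injective _ unitsAdd_injective, hg]
  · rw [← hγ, map_pow, map_pow, map_pow, hσ]

/-- With an eigenvector, Z would be diagonalizable with distinct eigenvalues. The Singer cycle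
commutes with Z, so it would be diagonal in the same basis and killed by p - 1, which is less than
its order p² - 1. -/
theorem KindC.not_hasEig {Z : GL (Fin 2) (ZMod p)} (h : KindC Z) {q : ℕ}
    (hq : (q : ZMod p) ≠ 0) (hZq : Z ^ q = 1) : ¬ HasEig Z := by
  intro he
  obtain ⟨⟨σ, hσ, k, rfl⟩, hns⟩ := h
  obtain ⟨P, a, b, hP⟩ := he.exists_diagonal hq hZq
  have hab : a ≠ b := by
    rintro rfl
    apply hns
    have h1 : P * σ ^ k * P⁻¹ = (P * σ ^ k * P⁻¹) ^ 1 := (pow_one _).symm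
    exact IsScalarMat.of_conj h1 ⟨a, hP.trans (scalar_eq_diagonal a).symm⟩
  set τ := P * σ * P⁻¹ with hτ
  have hcomm : τ * (P * σ ^ k * P⁻¹) = (P * σ ^ k * P⁻¹) * τ := by
    rw [← conj_pow, ← hτ, ← pow_succ, ← pow_succ']
  have hcomm' : (τ : Matrix (Fin 2) (Fin 2) (ZMod p)) * Matrix.diagonal ![a, b] =
      Matrix.diagonal ![a, b] * (τ : Matrix (Fin 2) (Fin 2) (ZMod p)) := by
    rw [← hP, ← Units.val_mul, hcomm, Units.val_mul]
  have h01 := congrFun (congrFun hcomm' 0) 1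
  have h10 := congrFun (congrFun hcomm' 1) 0
  rw [Matrix.mul_diagonal, Matrix.diagonal_mul] at h01 h10
  have h01' : (τ : Matrix (Fin 2) (Fin 2) (ZMod p)) 0 1 * b =
      a * (τ : Matrix (Fin 2) (Fin 2) (ZMod p)) 0 1 := h01
  have h10' : (τ : Matrix (Fin 2) (Fin 2) (ZMod p)) 1 0 * a =
      b * (τ : Matrix (Fin 2) (Fin 2) (ZMod p)) 1 0 := h10
  have z01 : (τ : Matrix (Fin 2) (Fin 2) (ZMod p)) 0 1 = 0 := by
    by_contra h0
    exact hab (mul_right_cancel₀ h0 (by rw [← h01', mul_comm]))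
  have z10 : (τ : Matrix (Fin 2) (Fin 2) (ZMod p)) 1 0 = 0 := by
    by_contra h0
    exact hab (mul_right_cancel₀ h0 (by rw [← h10', mul_comm]))
  have hdiag : (τ : Matrix (Fin 2) (Fin 2) (ZMod p)) = Matrix.diagonal
      ![(τ : Matrix (Fin 2) (Fin 2) (ZMod p)) 0 0, (τ : Matrix (Fin 2) (Fin 2) (ZMod p)) 1 1] := by
    ext i j
    fin_cases i <;> fin_cases j <;> simp [z01, z10]
  have hdet : (τ : Matrix (Fin 2) (Fin 2) (ZMod p)).det ≠ 0 :=
    ((Matrix.isUnit_iff_isUnit_det _).mp τ.isUnit).ne_zero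
  rw [Matrix.det_fin_two, z01, zero_mul, sub_zero] at hdet
  have h1 : τ ^ (p - 1) = 1 := by
    apply Units.ext
    rw [Units.val_pow_eq_pow_val, hdiag, Matrix.diagonal_pow, Units.val_one,
      ← Matrix.diagonal_one]
    congr 1
    ext i
    fin_cases i
    · exact ZMod.pow_card_sub_one_eq_one (left_ne_zero_of_mul hdet)
    · exact ZMod.pow_card_sub_one_eq_one (right_ne_zero_of_mul hdet)
  have h2 : σ ^ (p - 1) = 1 := by
    rw [hτ, conj_pow, conj_eq_one_iff] at h1
    exact h1
  have h3 := orderOf_dvd_of_pow_eq_one h2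
  rw [hσ] at h3
  have h4 := (Fact.out : p.Prime).two_le
  have h5 := Nat.le_of_dvd (by omega) h3
  have h6 : p * 2 ≤ p ^ 2 := by rw [sq]; exact Nat.mul_le_mul_left p h4
  omega

theorem natCast_ne_zero_of_ne {q : ℕ} [Fact q.Prime] (hpq : p ≠ q) : (q : ZMod p) ≠ 0 := by
  rw [Ne, ZMod.natCast_eq_zero_iff]
  exact fun h => hpq ((Nat.prime_dvd_prime_iff_eq Fact.out Fact.out).mp h)

theorem kindC_iff {q : ℕ} [Fact q.Prime] (hpq : p ≠ q) {Z : GL (Fin 2) (ZMod p)}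
    (hZq : Z ^ q = 1) : KindC Z ↔ ¬ HasEig Z := by
  refine ⟨fun h => h.not_hasEig (natCast_ne_zero_of_ne hpq) hZq, fun h => ?_⟩
  obtain ⟨γ, ζ, hγ, -⟩ := exists_field_model h
  exact kindC_of_field_model (fun hs => h hs.hasEig) γ ζ hγ

/-- The matrix that exchanges the two basis vectors. -/
def swapGL (p : ℕ) : GL (Fin 2) (ZMod p) :=
  ⟨!![0, 1; 1, 0], !![0, 1; 1, 0], by ext i j; fin_cases i <;> fin_cases j <;> simp, by
    ext i j; fin_cases i <;> fin_cases j <;> simp⟩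

theorem swapGL_conj_diagonal {Z : GL (Fin 2) (ZMod p)} {a b : ZMod p}
    (h : (Z : Matrix (Fin 2) (Fin 2) (ZMod p)) = Matrix.diagonal ![a, b]) :
    ((swapGL p * Z * (swapGL p)⁻¹ : GL (Fin 2) (ZMod p)) : Matrix (Fin 2) (Fin 2) (ZMod p)) =
      Matrix.diagonal ![b, a] := by
  have h1 : (swapGL p : Matrix (Fin 2) (Fin 2) (ZMod p)) * Matrix.diagonal ![a, b] =
      Matrix.diagonal ![b, a] * (swapGL p : Matrix (Fin 2) (Fin 2) (ZMod p)) := by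
    ext i j
    rw [Matrix.mul_diagonal, Matrix.diagonal_mul]
    fin_cases i <;> fin_cases j <;> simp [swapGL]
  rw [Units.val_mul, Units.val_mul, h, h1, mul_assoc, ← Units.val_mul, mul_inv_cancel,
    Units.val_one, mul_one]

/-- Without an eigenvector Z is of kind C. Otherwise Z is diagonalized and the cases are read off
the two eigenvalues; when only the second is 1, a swap of coordinates brings it to the first place.
-/
theorem exists_conj_kind {q : ℕ} [Fact q.Prime] (hpq : p ≠ q) {Z : GL (Fin 2) (ZMod p)}
    (hZq : Z ^ q = 1) : ∃ P : GL (Fin 2) (ZMod p), P * Z * P⁻¹ = 1 ∨ KindF (P * Z * P⁻¹) ∨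
      KindS (P * Z * P⁻¹) ∨ KindD0 (P * Z * P⁻¹) ∨ KindD1 (P * Z * P⁻¹) ∨ KindC (P * Z * P⁻¹) := by
  by_cases hE : HasEig Z
  · obtain ⟨P, a, b, hP⟩ := hE.exists_diagonal (natCast_ne_zero_of_ne hpq) hZq
    by_cases hab : a = b
    · subst hab
      refine ⟨P, ?_⟩
      by_cases h1 : P * Z * P⁻¹ = 1
      · exact Or.inl h1
      · exact Or.inr (Or.inr (Or.inl ⟨⟨a, hP.trans (scalar_eq_diagonal a).symm⟩, h1⟩))
    by_cases ha : a = 1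
    · subst ha
      exact ⟨P, Or.inr (Or.inl ⟨b, Ne.symm hab, hP⟩)⟩
    by_cases hb : b = 1
    · subst hb
      refine ⟨swapGL p * P, Or.inr (Or.inl ⟨a, ha, ?_⟩)⟩
      have h1 : swapGL p * P * Z * (swapGL p * P)⁻¹ =
          swapGL p * (P * Z * P⁻¹) * (swapGL p)⁻¹ := by group
      rw [h1]
      exact swapGL_conj_diagonal hP
    have hD : KindD (P * Z * P⁻¹) := ⟨a, b, hP, hab, ha, hb⟩
    by_cases hdet : ((P * Z * P⁻¹ : GL (Fin 2) (ZMod p)) : Matrix (Fin 2) (Fin 2) (ZMod p)).det = 1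
    · exact ⟨P, Or.inr (Or.inr (Or.inr (Or.inr (Or.inl ⟨hD, hdet⟩))))⟩
    · exact ⟨P, Or.inr (Or.inr (Or.inr (Or.inl ⟨hD, hdet⟩)))⟩
  · refine ⟨1, Or.inr (Or.inr (Or.inr (Or.inr (Or.inr ?_))))⟩
    rw [one_mul, inv_one, mul_one]
    exact (kindC_iff hpq hZq).mpr hE

theorem exists_planeSemidirect {q : ℕ} [Fact q.Prime] (hpq : p ≠ q)
    (θ : Cyc q →* MulAut (Plane p)) {G : Type*} [Group G] (e : G ≃* Plane p ⋊[θ] Cyc q) :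
    IsPlaneSemidirect p q (fun Z => Z = 1) G ∨ IsPlaneSemidirect p q KindF G ∨
      IsPlaneSemidirect p q KindS G ∨ IsPlaneSemidirect p q KindD0 G ∨
      IsPlaneSemidirect p q KindD1 G ∨ IsPlaneSemidirect p q KindC G := by
  let E : GL (Fin 2) (ZMod p) ≃* MulAut (Plane p) := MulEquiv.ofBijective (glAct p) glAct_bijective
  obtain ⟨φ, rfl⟩ : ∃ φ : Cyc q →* GL (Fin 2) (ZMod p), (glAct p).comp φ = θ :=
    ⟨E.symm.toMonoidHom.comp θ, MonoidHom.ext fun k => E.apply_symm_apply (θ k)⟩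
  obtain ⟨P, hP⟩ := exists_conj_kind hpq (map_cgen_pow φ)
  let ψ : Cyc q →* GL (Fin 2) (ZMod p) := (MulAut.conj P).toMonoidHom.comp φ
  have hψ : ψ (cgen q) = P * φ (cgen q) * P⁻¹ := rfl
  have hiso : Nonempty (G ≃* Plane p ⋊[(glAct p).comp ψ] Cyc q) := by
    by_cases h1 : φ (cgen q) = 1
    · have : φ = ψ := cyc_hom_ext (by rw [hψ, h1, mul_one, mul_inv_cancel])
      rw [← this]
      exact ⟨e⟩
    · obtain ⟨f⟩ := nonempty_plane_congr (φ := φ) (ψ := ψ) P 1 (by rw [hψ, pow_one]) h1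
      exact ⟨e.trans f⟩
  rw [← hψ] at hP
  exact hP.imp (fun h => ⟨ψ, h, hiso⟩) (Or.imp (fun h => ⟨ψ, h, hiso⟩)
    (Or.imp (fun h => ⟨ψ, h, hiso⟩) (Or.imp (fun h => ⟨ψ, h, hiso⟩)
    (Or.imp (fun h => ⟨ψ, h, hiso⟩) (fun h => ⟨ψ, h, hiso⟩)))))

theorem isPlaneSemidirect_exclusive {q : ℕ} [Fact q.Prime] (hpq : p ≠ q)
    {Q R : GL (Fin 2) (ZMod p) → Prop} {G : Type*} [Group G]
    (h : ∀ Z Z' : GL (Fin 2) (ZMod p), Z ^ q = 1 → Z' ^ q = 1 → Q Z → R Z' →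
      (∃ P k, P * Z * P⁻¹ = Z' ^ k) → (∃ P k, P * Z' * P⁻¹ = Z ^ k) → False)
    (hQ : IsPlaneSemidirect p q Q G) (hR : IsPlaneSemidirect p q R G) : False := by
  obtain ⟨φ, hφ, ⟨e⟩⟩ := hQ
  obtain ⟨ψ, hψ, ⟨e'⟩⟩ := hR
  exact h _ _ (map_cgen_pow φ) (map_cgen_pow ψ) hφ hψ (exists_conj_eq_pow hpq ⟨e.symm.trans e'⟩)
    (exists_conj_eq_pow hpq ⟨e'.symm.trans e⟩)

theorem KindF.props {Z : GL (Fin 2) (ZMod p)} (h : KindF Z) :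
    HasFix Z ∧ ¬ IsScalarMat Z := by
  obtain ⟨a, ha, hZ⟩ := h
  refine ⟨⟨![1, 0], fun h0 => one_ne_zero (congrFun h0 0), ?_⟩,
    not_isScalarMat_of_diagonal hZ (Ne.symm ha)⟩
  rw [hZ]
  ext i
  fin_cases i <;> simp [Matrix.mulVec_diagonal]

theorem KindS.props {Z : GL (Fin 2) (ZMod p)} (h : KindS Z) : ¬ HasFix Z ∧ IsScalarMat Z := by
  obtain ⟨⟨c, hc⟩, h1⟩ := h
  have hc1 : c ≠ 1 := by
    rintro rfl
    exact h1 (Units.ext (hc.trans (map_one _)))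
  exact ⟨not_hasFix_of_diagonal (hc.trans (scalar_eq_diagonal c)) hc1 hc1, c, hc⟩

theorem KindD.props {Z : GL (Fin 2) (ZMod p)} (h : KindD Z) :
    ¬ HasFix Z ∧ ¬ IsScalarMat Z ∧ HasEig Z := by
  obtain ⟨a, b, hZ, hab, ha, hb⟩ := h
  exact ⟨not_hasFix_of_diagonal hZ ha hb, not_isScalarMat_of_diagonal hZ hab,
    hasEig_of_diagonal hZ⟩

end

/-! ### Diagonal matrices: types 5 to 9 -/

section

variable {p : ℕ} [Fact p.Prime]

/-- The plane as a product of two cyclic groups. -/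
def planeProd (p : ℕ) : Plane p ≃* Cyc p × Cyc p where
  toFun v := (Multiplicative.ofAdd (v.toAdd 0), Multiplicative.ofAdd (v.toAdd 1))
  invFun x := Multiplicative.ofAdd ![x.1.toAdd, x.2.toAdd]
  left_inv v := by
    apply Multiplicative.toAdd.injective
    ext i
    fin_cases i <;> simp
  right_inv x := by simp
  map_mul' v w := by simp

theorem diagonal_pair_mul {R : Type*} [CommRing R] (a b c d : R) :
    Matrix.diagonal ![a, b] * Matrix.diagonal ![c, d] = Matrix.diagonal ![a * c, b * d] := by
  rw [Matrix.diagonal_mul_diagonal]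
  congr 1
  ext i
  fin_cases i <;> rfl

theorem diagonal_pair_one {R : Type*} [CommRing R] :
    (Matrix.diagonal ![1, 1] : Matrix (Fin 2) (Fin 2) R) = 1 := by
  rw [← Matrix.diagonal_one]
  congr 1
  ext i
  fin_cases i <;> rfl

/-- Invertible diagonal matrices. -/
def diagGL (p : ℕ) : (ZMod p)ˣ × (ZMod p)ˣ →* GL (Fin 2) (ZMod p) where
  toFun u := ⟨Matrix.diagonal ![(u.1 : ZMod p), (u.2 : ZMod p)],
    Matrix.diagonal ![((u.1⁻¹ : (ZMod p)ˣ) : ZMod p), ((u.2⁻¹ : (ZMod p)ˣ) : ZMod p)], by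
      rw [diagonal_pair_mul, Units.mul_inv, Units.mul_inv, diagonal_pair_one], by
      rw [diagonal_pair_mul, Units.inv_mul, Units.inv_mul, diagonal_pair_one]⟩
  map_one' := Units.ext diagonal_pair_one
  map_mul' u v := Units.ext (diagonal_pair_mul _ _ _ _).symm

theorem diagGL_val (u : (ZMod p)ˣ × (ZMod p)ˣ) :
    (diagGL p u : Matrix (Fin 2) (Fin 2) (ZMod p)) =
      Matrix.diagonal ![(u.1 : ZMod p), (u.2 : ZMod p)] := rfl

theorem diagGL_injective : Function.Injective (diagGL p) := fun u v h => by
  have h1 := congrArg Units.val h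
  rw [diagGL_val, diagGL_val] at h1
  have h2 := Matrix.diagonal_injective h1
  exact Prod.ext (Units.ext (congrFun h2 0)) (Units.ext (congrFun h2 1))

theorem exists_diagGL_eq {Z : GL (Fin 2) (ZMod p)} {a b : ZMod p}
    (h : (Z : Matrix (Fin 2) (Fin 2) (ZMod p)) = Matrix.diagonal ![a, b]) :
    ∃ u v : (ZMod p)ˣ, Z = diagGL p (u, v) ∧ (u : ZMod p) = a ∧ (v : ZMod p) = b := by
  have hdet : (Z : Matrix (Fin 2) (Fin 2) (ZMod p)).det ≠ 0 :=
    ((Matrix.isUnit_iff_isUnit_det _).mp Z.isUnit).ne_zero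
  rw [h, Matrix.det_diagonal, Fin.prod_univ_two] at hdet
  exact ⟨Units.mk0 a (left_ne_zero_of_mul hdet), Units.mk0 b (right_ne_zero_of_mul hdet),
    Units.ext h, rfl, rfl⟩

theorem kindF_iff {Z : GL (Fin 2) (ZMod p)} :
    KindF Z ↔ ∃ u : (ZMod p)ˣ, u ≠ 1 ∧ Z = diagGL p (1, u) := by
  constructor
  · rintro ⟨a, ha, h⟩
    obtain ⟨u, v, hZ, hu, rfl⟩ := exists_diagGL_eq h
    refine ⟨v, fun hv => ha (by rw [hv, Units.val_one]), ?_⟩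
    rw [hZ, Units.val_eq_one.mp hu]
  · rintro ⟨u, hu, rfl⟩
    exact ⟨u, fun h => hu (Units.val_eq_one.mp h), by rw [diagGL_val, Units.val_one]⟩

theorem kindS_iff {Z : GL (Fin 2) (ZMod p)} :
    KindS Z ↔ ∃ u : (ZMod p)ˣ, u ≠ 1 ∧ Z = diagGL p (u, u) := by
  constructor
  · rintro ⟨⟨c, hc⟩, h1⟩
    obtain ⟨u, v, hZ, rfl, hv⟩ := exists_diagGL_eq (hc.trans (scalar_eq_diagonal c))
    obtain rfl := Units.ext hv
    refine ⟨v, ?_, hZ⟩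
    rintro rfl
    exact h1 (hZ.trans (map_one _))
  · rintro ⟨u, hu, rfl⟩
    refine ⟨⟨u, by rw [diagGL_val, scalar_eq_diagonal]⟩, fun h => hu ?_⟩
    rw [← map_one (diagGL p)] at h
    exact congrArg Prod.fst (diagGL_injective h)

theorem kindD_iff {Z : GL (Fin 2) (ZMod p)} :
    KindD Z ↔ ∃ u v : (ZMod p)ˣ, u ≠ v ∧ u ≠ 1 ∧ v ≠ 1 ∧ Z = diagGL p (u, v) := by
  constructor
  · rintro ⟨a, b, h, hab, ha, hb⟩
    obtain ⟨u, v, hZ, rfl, rfl⟩ := exists_diagGL_eq h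
    exact ⟨u, v, fun h => hab (congrArg Units.val h), fun h => ha (Units.val_eq_one.mpr h),
      fun h => hb (Units.val_eq_one.mpr h), hZ⟩
  · rintro ⟨u, v, huv, hu, hv, rfl⟩
    exact ⟨u, v, rfl, fun h => huv (Units.ext h), fun h => hu (Units.val_eq_one.mp h),
      fun h => hv (Units.val_eq_one.mp h)⟩

theorem det_diagGL (u v : (ZMod p)ˣ) :
    (diagGL p (u, v) : Matrix (Fin 2) (Fin 2) (ZMod p)).det = 1 ↔ u * v = 1 := by
  rw [diagGL_val, Matrix.det_diagonal, Fin.prod_univ_two, Units.ext_iff, Units.val_mul,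
    Units.val_one]
  rfl

theorem kindD0_iff {Z : GL (Fin 2) (ZMod p)} :
    KindD0 Z ↔ ∃ u v : (ZMod p)ˣ, u ≠ v ∧ u ≠ 1 ∧ v ≠ 1 ∧ u * v ≠ 1 ∧ Z = diagGL p (u, v) := by
  rw [KindD0, kindD_iff]
  constructor
  · rintro ⟨⟨u, v, h1, h2, h3, rfl⟩, h⟩
    exact ⟨u, v, h1, h2, h3, fun h' => h ((det_diagGL u v).mpr h'), rfl⟩
  · rintro ⟨u, v, h1, h2, h3, h4, rfl⟩
    exact ⟨⟨u, v, h1, h2, h3, rfl⟩, fun h' => h4 ((det_diagGL u v).mp h')⟩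

theorem kindD1_iff {Z : GL (Fin 2) (ZMod p)} :
    KindD1 Z ↔ ∃ u : (ZMod p)ˣ, u ≠ u⁻¹ ∧ u ≠ 1 ∧ Z = diagGL p (u, u⁻¹) := by
  rw [KindD1, kindD_iff]
  constructor
  · rintro ⟨⟨u, v, h1, h2, h3, rfl⟩, h⟩
    have h4 := (eq_inv_of_mul_eq_one_right ((det_diagGL u v).mp h))
    subst h4
    exact ⟨u, h1, h2, rfl⟩
  · rintro ⟨u, h1, h2, rfl⟩
    exact ⟨⟨u, u⁻¹, h1, h2, fun h => h2 (inv_eq_one.mp h), rfl⟩,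
      (det_diagGL u _).mpr (mul_inv_cancel u)⟩

theorem diagGL_commute (u v : (ZMod p)ˣ × (ZMod p)ˣ) :
    diagGL p u * diagGL p v = diagGL p v * diagGL p u := by
  rw [← map_mul, mul_comm, map_mul]

theorem swapGL_mul_diagGL (u v : (ZMod p)ˣ) :
    swapGL p * diagGL p (u, v) = diagGL p (v, u) * swapGL p := by
  rw [← mul_inv_eq_iff_eq_mul]
  exact Units.ext (swapGL_conj_diagonal rfl)

theorem swapGL_mul_self : swapGL p * swapGL p = 1 := by
  apply Units.ext
  ext i j
  fin_cases i <;> fin_cases j <;> simp [swapGL]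

/-- Matrices that intertwine a diagonal non-scalar matrix with a diagonal matrix are monomial. -/
theorem intertwine_diagGL {A : GL (Fin 2) (ZMod p)} {a b c d : (ZMod p)ˣ} (hab : a ≠ b)
    (h : A * diagGL p (a, b) = diagGL p (c, d) * A) :
    (∃ u, A = diagGL p u ∧ c = a ∧ d = b) ∨ (∃ u, A = diagGL p u * swapGL p ∧ c = b ∧ d = a) := by
  set M := (A : Matrix (Fin 2) (Fin 2) (ZMod p)) with hM
  have h' : M * Matrix.diagonal ![(a : ZMod p), (b : ZMod p)] =
      Matrix.diagonal ![(c : ZMod p), (d : ZMod p)] * M := congrArg Units.val h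
  have hdet : M.det ≠ 0 := ((Matrix.isUnit_iff_isUnit_det _).mp A.isUnit).ne_zero
  rw [Matrix.det_fin_two] at hdet
  -- A nonzero entry (i, j) of an intertwiner forces the i-th eigenvalue of the target to equal the
  -- j-th of the source. As a ≠ b, no row can have two nonzero entries.
  have key : ∀ (i j : Fin 2) (x y : (ZMod p)ˣ), ![(a : ZMod p), (b : ZMod p)] j = x →
      ![(c : ZMod p), (d : ZMod p)] i = y → M i j ≠ 0 → y = x := fun i j x y hx hy hij => by
    have h1 := congrFun (congrFun h' i) j
    rw [Matrix.mul_diagonal, Matrix.diagonal_mul, hx, hy, mul_comm] at h1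
    exact Units.ext (mul_right_cancel₀ hij h1).symm
  have k00 := key 0 0 a c rfl rfl
  have k01 := key 0 1 b c rfl rfl
  have k10 := key 1 0 a d rfl rfl
  have k11 := key 1 1 b d rfl rfl
  by_cases h00 : M 0 0 = 0
  · right
    rw [h00, zero_mul, zero_sub, neg_ne_zero] at hdet
    have h01 := left_ne_zero_of_mul hdet
    have h10 := right_ne_zero_of_mul hdet
    have h11 : M 1 1 = 0 := by
      by_contra h0
      exact hab ((k10 h10).symm.trans (k11 h0))
    refine ⟨(Units.mk0 _ h01, Units.mk0 _ h10), ?_, k01 h01, k10 h10⟩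
    apply Units.ext
    rw [Units.val_mul, diagGL_val]
    ext i j
    rw [Matrix.diagonal_mul]
    fin_cases i <;> fin_cases j <;> simp [swapGL, ← hM, h00, h11]
  · left
    have h01 : M 0 1 = 0 := by
      by_contra h0
      exact hab ((k00 h00).symm.trans (k01 h0))
    rw [h01, zero_mul, sub_zero] at hdet
    have h11 := right_ne_zero_of_mul hdet
    have h10 : M 1 0 = 0 := by
      by_contra h0
      exact hab ((k10 h0).symm.trans (k11 h11))
    refine ⟨(Units.mk0 _ h00, Units.mk0 _ h11), ?_, k00 h00, k11 h11⟩
    apply Units.ext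
    rw [diagGL_val]
    ext i j
    fin_cases i <;> fin_cases j <;> simp [← hM, h01, h10]

theorem exists_unit_orderOf {q : ℕ} (h : q ∣ p - 1) : ∃ u : (ZMod p)ˣ, orderOf u = q :=
  exists_orderOf_eq (by
    rwa [Nat.card_congr (unitsAut p).toEquiv, card_mulAut_cyc_prime])

section

variable {q : ℕ} [Fact q.Prime]

theorem isOfType_five_iff {G : Type*} [Group G] :
    IsOfType p q .t5 G ↔ IsPlaneSemidirect p q (fun Z => Z = 1) G := by
  let e : Plane p ⋊[1] Cyc q ≃* Cyc p × Cyc p × Cyc q :=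
    (SemidirectProduct.mulEquivProd.trans
      (MulEquiv.prodCongr (planeProd p) (MulEquiv.refl _))).trans MulEquiv.prodAssoc
  have h1 : (glAct p).comp (1 : Cyc q →* GL (Fin 2) (ZMod p)) = 1 := MonoidHom.comp_one _
  constructor
  · rintro ⟨f⟩
    refine ⟨1, rfl, ?_⟩
    rw [h1]
    exact ⟨f.trans e.symm⟩
  · rintro ⟨φ, hφ, ⟨f⟩⟩
    obtain rfl := (map_eq_one_iff_orderOf φ).mpr hφ
    rw [h1] at f
    exact ⟨f.trans e⟩

/-- The direct product of a cyclic group with a metacyclic group as a plane semidirect product. -/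
def cycProdSemidirect (φ : Cyc q →* MulAut (Cyc p)) (ψ : Cyc q →* GL (Fin 2) (ZMod p))
    (h : ∀ k, ψ k = diagGL p (1, (unitsAut p).symm (φ k))) :
    Cyc p × (Cyc p ⋊[φ] Cyc q) ≃* Plane p ⋊[(glAct p).comp ψ] Cyc q where
  toFun x := ⟨(planeProd p).symm (x.1, x.2.left), x.2.right⟩
  invFun x := ((planeProd p x.left).1, ⟨(planeProd p x.left).2, x.right⟩)
  left_inv x := by simp
  right_inv x := by simp
  map_mul' x y := by
    have h1 : ∀ k (v : Cyc p × Cyc p), glAct p (ψ k) ((planeProd p).symm v) =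
        (planeProd p).symm (v.1, φ k v.2) := fun k v => by
      apply Multiplicative.toAdd.injective
      rw [h, toAdd_glAct, diagGL_val]
      ext i
      rw [Matrix.mulVec_diagonal]
      fin_cases i
      · simp [planeProd]
      · exact (mulAut_cyc_apply (φ k) v.2).symm
    ext1
    · simp only [SemidirectProduct.mul_left, MonoidHom.comp_apply, h1, ← map_mul]
      rfl
    · rfl

/-- The extra direct factor C_p becomes the eigenline for the eigenvalue 1. Type 6 thus joins types
7 to 10, and the same matrix invariants apply to it. -/
theorem isOfType_six_iff {G : Type*} [Group G] :
    IsOfType p q .t6 G ↔ IsPlaneSemidirect p q KindF G := by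
  constructor
  · rintro ⟨φ, hφ, ⟨f⟩⟩
    let ψ : Cyc q →* GL (Fin 2) (ZMod p) :=
      (diagGL p).comp ((MonoidHom.inr _ _).comp ((unitsAut p).symm.toMonoidHom.comp φ))
    refine ⟨ψ, kindF_iff.mpr ⟨(unitsAut p).symm (φ (cgen q)), ?_, rfl⟩,
      ⟨f.trans (cycProdSemidirect φ ψ fun _ => rfl)⟩⟩
    rw [Ne, MulEquiv.map_eq_one_iff]
    exact fun h' => hφ ((map_eq_one_iff_orderOf φ).mpr h')
  · rintro ⟨ψ, hψ, ⟨f⟩⟩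
    obtain ⟨u, hu, h1⟩ := kindF_iff.mp hψ
    have huq : u ^ q = 1 := by
      have h2 := map_cgen_pow ψ
      rw [h1, ← map_pow, ← map_one (diagGL p)] at h2
      exact congrArg Prod.snd (diagGL_injective h2)
    let φ : Cyc q →* MulAut (Cyc p) := cycLift q (unitsAut p u) (by
      rw [← map_pow, huq, map_one])
    have hφ : φ (cgen q) = unitsAut p u := cycLift_gen _ _ _
    have hψφ : (diagGL p).comp ((MonoidHom.inr _ _).comp
        ((unitsAut p).symm.toMonoidHom.comp φ)) = ψ := by
      apply cyc_hom_ext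
      rw [h1]
      change diagGL p (1, (unitsAut p).symm (φ (cgen q))) = _
      rw [hφ, MulEquiv.symm_apply_apply]
    refine ⟨φ, fun h => hu ?_, ⟨f.trans (cycProdSemidirect φ ψ fun k =>
      (DFunLike.congr_fun hψφ k).symm).symm⟩⟩
    rw [map_eq_one_iff_orderOf, hφ, MulEquiv.map_eq_one_iff] at h
    exact h

theorem exists_pow_eq_of_pow_eq_one {A : Type*} [Group A] [Finite A] [IsCyclic A] {x y : A}
    (hx : x ^ q = 1) (hy : y ^ q = 1) (hy1 : y ≠ 1) : ∃ k : ℕ, x = y ^ k := by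
  by_cases hx1 : x = 1
  · exact ⟨0, by rw [hx1, pow_zero]⟩
  · have h := zpowers_eq_of_orderOf_eq ((orderOf_eq_prime hx hx1).trans
      (orderOf_eq_prime hy hy1).symm)
    have h2 : x ∈ Subgroup.zpowers y := h ▸ Subgroup.mem_zpowers x
    rw [← mem_powers_iff_mem_zpowers] at h2
    obtain ⟨k, hk⟩ := h2
    exact ⟨k, hk.symm⟩

theorem diagGL_pow_eq_one {φ : Cyc q →* GL (Fin 2) (ZMod p)} {u v : (ZMod p)ˣ}
    (h : φ (cgen q) = diagGL p (u, v)) : u ^ q = 1 ∧ v ^ q = 1 := by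
  have h2 := map_cgen_pow φ
  rw [h, ← map_pow, ← map_one (diagGL p)] at h2
  exact ⟨congrArg Prod.fst (diagGL_injective h2), congrArg Prod.snd (diagGL_injective h2)⟩

theorem dvd_sub_one_of_pow_eq_one {u : (ZMod p)ˣ} (h : u ^ q = 1) (h1 : u ≠ 1) : q ∣ p - 1 := by
  rw [← orderOf_eq_prime h h1, ← card_mulAut_cyc_prime p, ← Nat.card_congr (unitsAut p).toEquiv]
  exact orderOf_dvd_natCard u

theorem nonempty_planeSemidirect_congr {Q : GL (Fin 2) (ZMod p) → Prop}
    (hQ : ∀ φ ψ : Cyc q →* GL (Fin 2) (ZMod p), Q (φ (cgen q)) → Q (ψ (cgen q)) →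
      φ (cgen q) ≠ 1 ∧ ∃ k, φ (cgen q) = ψ (cgen q) ^ k) {G H : Type*} [Group G] [Group H]
    (hG : IsPlaneSemidirect p q Q G) (hH : IsPlaneSemidirect p q Q H) : Nonempty (G ≃* H) := by
  obtain ⟨φ, hφ, ⟨e⟩⟩ := hG
  obtain ⟨ψ, hψ, ⟨e'⟩⟩ := hH
  obtain ⟨h1, k, hk⟩ := hQ φ ψ hφ hψ
  obtain ⟨f⟩ := nonempty_plane_congr (φ := φ) (ψ := ψ) 1 k (by
    rw [one_mul, inv_one, mul_one, hk]) h1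
  exact ⟨(e.trans f).trans e'.symm⟩

/-- In kinds F, S and D1 the matrix depends multiplicatively on a single unit of order q. Two such
units are powers of each other because the unit group of ℤ/p is cyclic, hence so are the matrices.
-/
theorem nonempty_congr_kindF {G H : Type*} [Group G] [Group H]
    (hG : IsPlaneSemidirect p q KindF G) (hH : IsPlaneSemidirect p q KindF H) :
    Nonempty (G ≃* H) := by
  refine nonempty_planeSemidirect_congr (fun φ ψ hφ hψ => ?_) hG hH
  obtain ⟨u, hu, h1⟩ := kindF_iff.mp hφ
  obtain ⟨v, hv, h2⟩ := kindF_iff.mp hψ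
  obtain ⟨k, rfl⟩ := exists_pow_eq_of_pow_eq_one (diagGL_pow_eq_one h1).2
    (diagGL_pow_eq_one h2).2 hv
  refine ⟨fun h => hu ?_, k, ?_⟩
  · rw [h1, ← map_one (diagGL p)] at h
    exact congrArg Prod.snd (diagGL_injective h)
  · rw [h1, h2, ← map_pow, Prod.pow_mk, one_pow]

theorem nonempty_congr_kindS {G H : Type*} [Group G] [Group H]
    (hG : IsPlaneSemidirect p q KindS G) (hH : IsPlaneSemidirect p q KindS H) :
    Nonempty (G ≃* H) := by
  refine nonempty_planeSemidirect_congr (fun φ ψ hφ hψ => ⟨hφ.2, ?_⟩) hG hH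
  obtain ⟨u, hu, h1⟩ := kindS_iff.mp hφ
  obtain ⟨v, hv, h2⟩ := kindS_iff.mp hψ
  obtain ⟨k, rfl⟩ := exists_pow_eq_of_pow_eq_one (diagGL_pow_eq_one h1).1
    (diagGL_pow_eq_one h2).1 hv
  exact ⟨k, by rw [h1, h2, ← map_pow, Prod.pow_mk]⟩

theorem nonempty_congr_kindD1 {G H : Type*} [Group G] [Group H]
    (hG : IsPlaneSemidirect p q KindD1 G) (hH : IsPlaneSemidirect p q KindD1 H) :
    Nonempty (G ≃* H) := by
  refine nonempty_planeSemidirect_congr (fun φ ψ hφ hψ => ?_) hG hH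
  obtain ⟨u, -, hu, h1⟩ := kindD1_iff.mp hφ
  obtain ⟨v, -, hv, h2⟩ := kindD1_iff.mp hψ
  obtain ⟨k, rfl⟩ := exists_pow_eq_of_pow_eq_one (diagGL_pow_eq_one h1).1
    (diagGL_pow_eq_one h2).1 hv
  refine ⟨fun h => hu ?_, k, ?_⟩
  · rw [h1, ← map_one (diagGL p)] at h
    exact congrArg Prod.fst (diagGL_injective h)
  · rw [h1, h2, ← map_pow, Prod.pow_mk, inv_pow]

/-- The second eigenvalue is u^k, where k modulo q must avoid 0 (eigenvalue 1), 1 (scalar) and -1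
(determinant 1). For q ≤ 3 no residue is left. -/
theorem condition_of_kindD0 {φ : Cyc q →* GL (Fin 2) (ZMod p)} (h : KindD0 (φ (cgen q))) :
    3 < q ∧ q ∣ p - 1 := by
  obtain ⟨u, v, huv, hu, hv, huv1, h1⟩ := kindD0_iff.mp h
  obtain ⟨hu', hv'⟩ := diagGL_pow_eq_one h1
  refine ⟨?_, dvd_sub_one_of_pow_eq_one hu' hu⟩
  obtain ⟨k, rfl⟩ := exists_pow_eq_of_pow_eq_one hv' hu' hu
  by_contra! hq
  have h2 := (Fact.out : q.Prime).two_le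
  have h3 : k % q < q := Nat.mod_lt _ (by omega)
  have h4 : u ^ k = u ^ (k % q) := by
    rw [pow_eq_pow_iff_modEq, orderOf_eq_prime hu' hu]
    exact (Nat.mod_modEq k q).symm
  rw [h4] at huv hv huv1
  generalize k % q = m at *
  interval_cases q <;> interval_cases m
  · exact hv (pow_zero u)
  · exact huv (pow_one u).symm
  · exact hv (pow_zero u)
  · exact huv (pow_one u).symm
  · exact huv1 (by rw [← pow_succ', hu'])

theorem condition_of_kindD1 {φ : Cyc q →* GL (Fin 2) (ZMod p)} (h : KindD1 (φ (cgen q))) :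
    2 < q ∧ q ∣ p - 1 := by
  obtain ⟨u, huv, hu, h1⟩ := kindD1_iff.mp h
  obtain ⟨hu', -⟩ := diagGL_pow_eq_one h1
  refine ⟨?_, dvd_sub_one_of_pow_eq_one hu' hu⟩
  refine lt_of_le_of_ne (Fact.out : q.Prime).two_le fun h2 => huv ?_
  subst h2
  rw [eq_inv_iff_mul_eq_one, ← sq, hu']

theorem exists_hom_map_cgen {A : Type} [Group A] {g : A} (h : g ^ q = 1) :
    ∃ φ : Cyc q →* A, φ (cgen q) = g := ⟨cycLift q g h, cycLift_gen q g h⟩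

theorem exists_hom_diagGL {u v : (ZMod p)ˣ} (hu : u ^ q = 1) (hv : v ^ q = 1) :
    ∃ φ : Cyc q →* GL (Fin 2) (ZMod p), φ (cgen q) = diagGL p (u, v) :=
  exists_hom_map_cgen (by rw [← map_pow, Prod.pow_mk, hu, hv]; exact map_one _)

end

end

/-! ### Automorphism groups of types 5 to 9 -/

section

variable {p q : ℕ} [Fact p.Prime] [Fact q.Prime]

/-- Isomorphic groups have isomorphic holomorphs. -/
def holCongr {H H' : Type} [Group H] [Group H'] (e : H ≃* H') : Hol H ≃* Hol H' :=
  SemidirectProduct.congr e (MulAut.congr e) fun g => by ext; simp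

theorem nonempty_mulAut_five (hpq : p ≠ q) :
    Nonempty (MulAut (Cyc p × Cyc p × Cyc q) ≃* GL (Fin 2) (ZMod p) × Cyc (q - 1)) := by
  obtain ⟨e⟩ := nonempty_mulAut_prod_of_coprime (A := Plane p) (B := Cyc q) (by
    rw [card_plane, card_cyc]
    exact coprime_sq hpq)
  obtain ⟨e2⟩ := nonempty_mulEquiv_cyc_of_card (card_mulAut_cyc_prime q)
  have f : Cyc p × Cyc p × Cyc q ≃* Plane p × Cyc q :=
    MulEquiv.prodAssoc.symm.trans (MulEquiv.prodCongr (planeProd p).symm (MulEquiv.refl _))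
  exact ⟨(MulAut.congr f).trans (e.trans
    (MulEquiv.prodCongr (MulEquiv.ofBijective (glAct p) glAct_bijective).symm e2))⟩

/-- Both direct factors are preserved by all automorphisms: C_p ⋊ C_q has trivial centre, so the
central factor C_p cannot map into it non-trivially. Moreover C_p ⋊ C_q has no non-trivial
homomorphism to C_p: one that was injective on the kernel would make the action trivial, and the
complement has order prime to p. -/
theorem nonempty_mulAut_six (hpq : p ≠ q) {φ : Cyc q →* MulAut (Cyc p)} (hφ : φ ≠ 1) :
    Nonempty (MulAut (Cyc p × (Cyc p ⋊[φ] Cyc q)) ≃* Cyc (p - 1) × Hol (Cyc p)) := by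
  have hcop : p.Coprime q := (Nat.coprime_primes Fact.out Fact.out).mpr hpq
  have hinj := injective_of_orderOf_map_cgen (orderOf_map_cgen_of_ne_one hφ)
  have hcenter : Subgroup.center (Cyc p ⋊[φ] Cyc q) = ⊥ := by
    rw [← Subgroup.card_eq_one, card_center_semidirect hφ, (MonoidHom.ker_eq_bot_iff φ).mpr hinj,
      Subgroup.card_bot]
  have hhom : ∀ g : (Cyc p ⋊[φ] Cyc q) →* Cyc p, g = 1 := fun g => by
    apply SemidirectProduct.hom_ext
    · change g.comp SemidirectProduct.inl = 1
      by_contra h1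
      have h2 := injective_of_orderOf_map_cgen (orderOf_map_cgen_of_ne_one h1)
      apply hφ
      refine MonoidHom.ext fun k => MulEquiv.ext fun n => ?_
      apply h2
      change g (SemidirectProduct.inl (φ k n)) = g (SemidirectProduct.inl n)
      rw [SemidirectProduct.inl_aut, map_mul, map_mul, mul_right_comm, ← map_mul, ← map_mul
        SemidirectProduct.inr, mul_inv_cancel, map_one, map_one, one_mul]
    · refine MonoidHom.ext fun k => ?_
      change g (SemidirectProduct.inr k) = 1
      rw [← orderOf_eq_one_iff]
      refine Nat.eq_one_of_dvd_coprimes hcop ?_ (orderOf_dvd_of_pow_eq_one (n := q) ?_)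
      · have := orderOf_dvd_natCard (g (SemidirectProduct.inr k))
        rwa [card_cyc] at this
      · have := pow_card_eq_one' (x := k)
        rw [card_cyc] at this
        rw [← map_pow, ← map_pow, this, map_one, map_one]
  obtain ⟨e⟩ := nonempty_mulAut_prod (A := Cyc p) (B := Cyc p ⋊[φ] Cyc q) (fun f a => by
      have h1 : (f (a, 1)).2 ∈ Subgroup.center (Cyc p ⋊[φ] Cyc q) := by
        rw [Subgroup.mem_center_iff]
        intro g
        obtain ⟨x, hx⟩ := f.surjective (1, g)
        have h2 : f x * f (a, 1) = f (a, 1) * f x := by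
          rw [← map_mul, ← map_mul]
          congr 1
          ext1
          · exact mul_comm _ _
          · change x.2 * 1 = 1 * x.2
            rw [mul_one, one_mul]
        rw [hx] at h2
        exact congrArg Prod.snd h2
      rwa [hcenter, Subgroup.mem_bot] at h1)
    (fun f b => DFunLike.congr_fun (hhom ((MonoidHom.fst _ _).comp
      (f.toMonoidHom.comp (MonoidHom.inr _ _)))) b)
  obtain ⟨e1⟩ := nonempty_mulEquiv_cyc_of_card (card_mulAut_cyc_prime p)
  obtain ⟨e2⟩ := nonempty_mulAut_cyc_semidirect_of_injective (φ := φ) (by rwa [card_cyc])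
    (fixedPointFree_of_ne_one hφ) hinj
  exact ⟨e.trans (MulEquiv.prodCongr e1 e2)⟩

theorem plane_fixedPointFree {φ : Cyc q →* GL (Fin 2) (ZMod p)} (h : ¬ HasFix (φ (cgen q)))
    (n : Plane p) (hn : ∀ k, ((glAct p).comp φ) k n = n) : n = 1 := by
  by_contra hne
  exact h ⟨n.toAdd, hne, congrArg Multiplicative.toAdd (hn (cgen q))⟩

theorem coprime_card_plane (hpq : p ≠ q) : (Nat.card (Plane p)).Coprime (Nat.card (Cyc q)) := by
  rw [card_plane, card_cyc]
  exact coprime_sq hpq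

theorem injective_of_map_cgen_ne_one {A : Type*} [Group A] {φ : Cyc q →* A}
    (h : φ (cgen q) ≠ 1) : Function.Injective φ :=
  injective_of_orderOf_map_cgen (orderOf_map_cgen_of_ne_one fun h' =>
    h ((map_eq_one_iff_orderOf φ).mp h'))

theorem mulAut_cyc_ext {n : ℕ} [NeZero n] {α β : MulAut (Cyc n)} (h : α (cgen n) = β (cgen n)) :
    α = β :=
  MulEquiv.ext fun x => DFunLike.congr_fun
    (cyc_hom_ext (φ := α.toMonoidHom) (ψ := β.toMonoidHom) h) x

/-- Scalars are central in GL(2, p), so every α is compatible with β = 1 and, the action being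
faithful, with no other β. The group of pairs is therefore the full automorphism group of the plane.
-/
theorem nonempty_mulAut_kindS (hpq : p ≠ q) {φ : Cyc q →* GL (Fin 2) (ZMod p)}
    (h : KindS (φ (cgen q))) :
    Nonempty (MulAut (Plane p ⋊[(glAct p).comp φ] Cyc q) ≃* Hol (Cyc p × Cyc p)) := by
  have hcomm : ∀ (A : GL (Fin 2) (ZMod p)) k, A * φ k = φ k * A := fun A k => by
    obtain ⟨c, hc⟩ := h.1
    have h1 : A * φ (cgen q) = φ (cgen q) * A := by
      apply Units.ext
      rw [Units.val_mul, Units.val_mul, hc]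
      exact (Matrix.scalar_commute c (fun r => mul_comm _ r) _).eq.symm
    rw [eq_cgen_pow k, map_pow]
    exact (Commute.pow_right h1 _).eq
  have hcomm' : ∀ (α : MulAut (Plane p)) k, α * glAct p (φ k) = glAct p (φ k) * α := fun α k => by
    obtain ⟨A, rfl⟩ := glAct_bijective.2 α
    rw [← map_mul, hcomm, map_mul]
  obtain ⟨e⟩ := nonempty_mulAut_semidirect (φ := (glAct p).comp φ) (MonoidHom.id (MulAut (Plane p)))
    1 (fun α k n => DFunLike.congr_fun (hcomm' α k) n) (coprime_card_plane hpq)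
    (plane_fixedPointFree h.props.1) (fun _ hl _ => hl) (fun α β hab => ⟨α, rfl, by
      symm
      apply mulAut_cyc_ext
      apply injective_of_map_cgen_ne_one h.2
      apply glAct_bijective.1
      have h1 : α * glAct p (φ (cgen q)) = glAct p (φ (β (cgen q))) * α :=
        MulEquiv.ext (hab (cgen q))
      rw [hcomm'] at h1
      exact (mul_right_cancel h1).symm⟩)
  exact ⟨e.trans (holCongr (planeProd p))⟩

/-- The plane extended by diagonal matrices as a product of holomorphs. -/
def planeDiag (p : ℕ) [Fact p.Prime] :
    Plane p ⋊[(glAct p).comp (diagGL p)] ((ZMod p)ˣ × (ZMod p)ˣ) ≃* Hol (Cyc p) × Hol (Cyc p) where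
  toFun x := (⟨(planeProd p x.left).1, unitsAut p x.right.1⟩,
    ⟨(planeProd p x.left).2, unitsAut p x.right.2⟩)
  invFun y := ⟨(planeProd p).symm (y.1.left, y.2.left),
    ((unitsAut p).symm y.1.right, (unitsAut p).symm y.2.right)⟩
  left_inv x := by simp
  right_inv y := by simp
  map_mul' x y := by
    have h1 : ∀ (u : (ZMod p)ˣ × (ZMod p)ˣ) (v : Plane p), planeProd p (glAct p (diagGL p u) v) =
        (unitsAut p u.1 (planeProd p v).1, unitsAut p u.2 (planeProd p v).2) := fun u v => by
      ext1 <;> apply Multiplicative.toAdd.injective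
      · change (_ *ᵥ v.toAdd) 0 = _
        rw [diagGL_val, Matrix.mulVec_diagonal]
        rfl
      · change (_ *ᵥ v.toAdd) 1 = _
        rw [diagGL_val, Matrix.mulVec_diagonal]
        rfl
    simp only [SemidirectProduct.mul_left, SemidirectProduct.mul_right, MonoidHom.comp_apply,
      map_mul, h1, Prod.fst_mul, Prod.snd_mul]
    rfl

/-- A compatible matrix either is diagonal, with β = 1, or exchanges the eigenlines. In the latter
case a^m = b and b^m = a, so (ab)^m = ab. Since ab ≠ 1 has order q, this gives m ≡ 1 mod q and a =
b, a contradiction. -/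
theorem nonempty_mulAut_kindD0 (hpq : p ≠ q) {φ : Cyc q →* GL (Fin 2) (ZMod p)}
    (h : KindD0 (φ (cgen q))) :
    Nonempty (MulAut (Plane p ⋊[(glAct p).comp φ] Cyc q) ≃* Hol (Cyc p) × Hol (Cyc p)) := by
  obtain ⟨a, b, hne, ha, hb, hab1, hφ⟩ := kindD0_iff.mp h
  obtain ⟨haq, hbq⟩ := diagGL_pow_eq_one hφ
  have hcomm : ∀ u k, diagGL p u * φ k = φ k * diagGL p u := fun u k => by
    rw [eq_cgen_pow k, map_pow, hφ, ← map_pow, diagGL_commute]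
  have hinj : Function.Injective φ := injective_of_map_cgen_ne_one fun h1 => by
    rw [hφ, ← map_one (diagGL p)] at h1
    exact ha (congrArg Prod.fst (diagGL_injective h1))
  obtain ⟨e⟩ := nonempty_mulAut_semidirect (φ := (glAct p).comp φ) ((glAct p).comp (diagGL p))
    1 (fun u k n => by
      have h1 := congrArg (glAct p) (hcomm u k)
      rw [map_mul, map_mul] at h1
      exact DFunLike.congr_fun h1 n) (coprime_card_plane hpq)
    (plane_fixedPointFree h.1.props.1) (fun l hl _ => by
      apply diagGL_injective
      apply glAct_bijective.1
      rw [map_one, map_one]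
      exact hl) (fun α β hαβ => by
      obtain ⟨A, rfl⟩ := glAct_bijective.2 α
      have h1 : A * φ (cgen q) = φ (β (cgen q)) * A := by
        apply glAct_bijective.1
        rw [map_mul, map_mul]
        exact MulEquiv.ext (hαβ (cgen q))
      set m := (β (cgen q)).toAdd.val with hm
      have h2 : φ (β (cgen q)) = diagGL p (a ^ m, b ^ m) := by
        rw [eq_cgen_pow (β (cgen q)), map_pow, hφ, ← map_pow, Prod.pow_mk]
      rw [h2, hφ] at h1
      rcases intertwine_diagGL hne h1 with ⟨u, hu, h3, h4⟩ | ⟨u, hu, h3, h4⟩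
      · refine ⟨u, by rw [hu]; rfl, ?_⟩
        symm
        apply mulAut_cyc_ext
        apply hinj
        rw [h2, h3, h4, ← hφ]
        rfl
      · exfalso
        have h5 : (a * b) ^ m = (a * b) ^ 1 := by rw [mul_pow, h3, h4, pow_one, mul_comm]
        have h6 : (a * b) ^ q = 1 := by rw [mul_pow, haq, hbq, one_mul]
        rw [pow_eq_pow_iff_modEq, orderOf_eq_prime h6 hab1] at h5
        have h7 : a ^ m = a ^ 1 := by
          rw [pow_eq_pow_iff_modEq, orderOf_eq_prime haq ha]
          exact h5
        exact hne (by rw [← h3, h7, pow_one]))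
  exact ⟨e.trans (planeDiag p)⟩

/-- Inversion as an action of the group of order two. -/
def invAct (A : Type) [CommGroup A] : Cyc 2 →* MulAut A :=
  cycLift 2 (MulEquiv.inv A) (by
    rw [sq]
    ext x
    exact inv_inv x)

theorem invAct_gen {A : Type} [CommGroup A] (x : A) : invAct A (cgen 2) x = x⁻¹ := by
  rw [invAct, cycLift_gen]
  rfl

theorem swapAct_gen {H : Type} [Group H] (x : H × H) : swapAct H (cgen 2) x = (x.2, x.1) := by
  rw [swapAct, cycLift_gen]
  rfl

theorem cyc_two_cases (c : Cyc 2) : c = 1 ∨ c = cgen 2 := by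
  revert c
  decide

/-- The transposition matrix as an action of the group of order two. -/
def swapGLHom (p : ℕ) [Fact p.Prime] : Cyc 2 →* GL (Fin 2) (ZMod p) :=
  cycLift 2 (swapGL p) (by rw [sq, swapGL_mul_self])

theorem swapGLHom_gen : swapGLHom p (cgen 2) = swapGL p := cycLift_gen _ _ _

/-- The monomial matrices. -/
def monomialGL (p : ℕ) [Fact p.Prime] :
    ((ZMod p)ˣ × (ZMod p)ˣ) ⋊[swapAct (ZMod p)ˣ] Cyc 2 →* GL (Fin 2) (ZMod p) :=
  SemidirectProduct.lift (diagGL p) (swapGLHom p) fun c => by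
    rcases cyc_two_cases c with rfl | rfl
    · rw [map_one, map_one, map_one]
      rfl
    · refine MonoidHom.ext fun u => ?_
      change diagGL p (swapAct _ _ u) = swapGLHom p (cgen 2) * diagGL p u * (swapGLHom p (cgen 2))⁻¹
      rw [swapAct_gen, swapGLHom_gen, eq_mul_inv_iff_mul_eq, swapGL_mul_diagGL]

theorem monomialGL_apply (x : ((ZMod p)ˣ × (ZMod p)ˣ) ⋊[swapAct (ZMod p)ˣ] Cyc 2) :
    monomialGL p x = diagGL p x.left * swapGLHom p x.right := rfl

theorem planeProd_glAct_swapGL (v : Plane p) :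
    planeProd p (glAct p (swapGL p) v) = ((planeProd p v).2, (planeProd p v).1) := by
  ext1 <;> apply Multiplicative.toAdd.injective
  · change ((swapGL p : Matrix (Fin 2) (Fin 2) (ZMod p)) *ᵥ v.toAdd) 0 = v.toAdd 1
    simp [swapGL, Matrix.mulVec, dotProduct, Fin.sum_univ_two]
  · change ((swapGL p : Matrix (Fin 2) (Fin 2) (ZMod p)) *ᵥ v.toAdd) 1 = v.toAdd 0
    simp [swapGL, Matrix.mulVec, dotProduct, Fin.sum_univ_two]

theorem planeDiag_swap (v : Plane p) (u : (ZMod p)ˣ × (ZMod p)ˣ) :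
    planeDiag p ⟨glAct p (swapGL p) v, (u.2, u.1)⟩ =
      ((planeDiag p ⟨v, u⟩).2, (planeDiag p ⟨v, u⟩).1) := by
  simp only [planeDiag, MulEquiv.coe_mk, Equiv.coe_fn_mk, planeProd_glAct_swapGL]

/-- The plane extended by monomial matrices as a wreath product. -/
def planeMonomial (p : ℕ) [Fact p.Prime] :
    Plane p ⋊[(glAct p).comp (monomialGL p)]
      (((ZMod p)ˣ × (ZMod p)ˣ) ⋊[swapAct (ZMod p)ˣ] Cyc 2) ≃*
      (Hol (Cyc p) × Hol (Cyc p)) ⋊[swapAct (Hol (Cyc p))] Cyc 2 where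
  toFun x := ⟨planeDiag p ⟨x.left, x.right.left⟩, x.right.right⟩
  invFun y := ⟨((planeDiag p).symm y.left).left, ⟨((planeDiag p).symm y.left).right, y.right⟩⟩
  left_inv x := by simp
  right_inv y := by simp
  map_mul' x y := by
    ext1
    · simp only [SemidirectProduct.mul_left, SemidirectProduct.mul_right, MonoidHom.comp_apply,
        monomialGL_apply]
      have h1 : swapAct (Hol (Cyc p)) x.right.right (planeDiag p ⟨y.left, y.right.left⟩) =
          planeDiag p ⟨glAct p (swapGLHom p x.right.right) y.left,
            swapAct _ x.right.right y.right.left⟩ := by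
        rcases cyc_two_cases x.right.right with h | h
        · rw [h, map_one, map_one, map_one, map_one]
          rfl
        · rw [h, swapAct_gen, swapAct_gen, swapGLHom_gen, planeDiag_swap]
      rw [h1, ← map_mul, map_mul]
      rfl
    · rfl

/-- With eigenvalues a and a⁻¹, exchanging the coordinates inverts the matrix, so the swap is
compatible with inversion on C_q. The compatible pairs are the monomial matrices, with the C_2
component acting on C_q by inversion. -/
theorem nonempty_mulAut_kindD1 (hpq : p ≠ q) {φ : Cyc q →* GL (Fin 2) (ZMod p)}
    (h : KindD1 (φ (cgen q))) :
    Nonempty (MulAut (Plane p ⋊[(glAct p).comp φ] Cyc q) ≃*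
      (Hol (Cyc p) × Hol (Cyc p)) ⋊[swapAct (Hol (Cyc p))] Cyc 2) := by
  obtain ⟨a, hne, ha, hφ⟩ := kindD1_iff.mp h
  obtain ⟨haq, -⟩ := diagGL_pow_eq_one hφ
  have hφk : ∀ k, ∃ m : ℕ, φ k = diagGL p (a ^ m, (a ^ m)⁻¹) := fun k =>
    ⟨k.toAdd.val, by rw [eq_cgen_pow k, map_pow, hφ, ← map_pow, Prod.pow_mk, inv_pow]; simp⟩
  have hcomm : ∀ l k, monomialGL p l * φ k = φ (invAct (Cyc q) l.right k) * monomialGL p l := by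
    intro l k
    obtain ⟨m, hm⟩ := hφk k
    rw [monomialGL_apply]
    rcases cyc_two_cases l.right with h1 | h1
    · rw [h1, map_one, map_one, mul_one, MulAut.one_apply, hm, diagGL_commute]
    · rw [h1, swapGLHom_gen, invAct_gen, map_inv, hm, mul_assoc, swapGL_mul_diagGL, ← map_inv,
        Prod.inv_mk, inv_inv, ← mul_assoc, diagGL_commute, mul_assoc]
  have hinj : Function.Injective φ := injective_of_map_cgen_ne_one fun h1 => by
    rw [hφ, ← map_one (diagGL p)] at h1
    exact ha (congrArg Prod.fst (diagGL_injective h1))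
  obtain ⟨e⟩ := nonempty_mulAut_semidirect (φ := (glAct p).comp φ) ((glAct p).comp (monomialGL p))
    ((invAct (Cyc q)).comp SemidirectProduct.rightHom) (fun l k n => by
      have h1 := congrArg (glAct p) (hcomm l k)
      rw [map_mul, map_mul] at h1
      exact DFunLike.congr_fun h1 n) (coprime_card_plane hpq)
    (plane_fixedPointFree h.1.props.1) (fun l hl _ => by
      have h1 : monomialGL p l = 1 := by
        apply glAct_bijective.1
        rw [map_one]
        exact hl
      rw [monomialGL_apply] at h1
      have hr : l.right = 1 := by
        rcases cyc_two_cases l.right with h2 | h2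
        · exact h2
        · exfalso
          rw [h2, swapGLHom_gen] at h1
          have h3 : (Matrix.diagonal ![(l.left.1 : ZMod p), (l.left.2 : ZMod p)] * !![0, 1; 1, 0] :
              Matrix (Fin 2) (Fin 2) (ZMod p)) 0 0 = 1 :=
            congrArg (fun A : GL (Fin 2) (ZMod p) => (A : Matrix (Fin 2) (Fin 2) (ZMod p)) 0 0) h1
          rw [Matrix.diagonal_mul] at h3
          simp at h3
      rw [hr, map_one, mul_one, ← map_one (diagGL p)] at h1
      ext1
      · exact diagGL_injective h1
      · exact hr) (fun α β hαβ => by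
      obtain ⟨A, rfl⟩ := glAct_bijective.2 α
      have h1 : A * φ (cgen q) = φ (β (cgen q)) * A := by
        apply glAct_bijective.1
        rw [map_mul, map_mul]
        exact MulEquiv.ext (hαβ (cgen q))
      obtain ⟨m, h2⟩ := hφk (β (cgen q))
      rw [h2, hφ] at h1
      rcases intertwine_diagGL hne h1 with ⟨u, hu, h3, h4⟩ | ⟨u, hu, h3, h4⟩
      · refine ⟨⟨u, 1⟩, ?_, ?_⟩
        · rw [MonoidHom.comp_apply, monomialGL_apply, map_one, mul_one, hu]
        · symm
          apply mulAut_cyc_ext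
          apply hinj
          rw [h2, h4, h3, ← hφ]
          simp
      · refine ⟨⟨u, cgen 2⟩, ?_, ?_⟩
        · rw [MonoidHom.comp_apply, monomialGL_apply, swapGLHom_gen, hu]
        · symm
          apply mulAut_cyc_ext
          apply hinj
          rw [h2, h4, h3]
          change _ = φ (invAct (Cyc q) (cgen 2) (cgen q))
          rw [invAct_gen, map_inv, hφ, ← map_inv, Prod.inv_mk, inv_inv])
  exact ⟨e.trans (planeMonomial p)⟩

end

/-! ### Type 10: multiplications and semilinear maps of the field with p² elements -/

section

variable {p q : ℕ} [Fact p.Prime] [Fact q.Prime]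

theorem frobAct_gen (x : Fpp p) : frobAct p (cgen 2) x = x ^ p := by
  rw [frobAct, cycLift_gen]
  rfl

/-- Ring endomorphisms are linear over the prime field, hence powers of Frobenius with exponent
below the degree 2. -/
theorem exists_frobAct_eq (f : Fpp p →+* Fpp p) : ∃ c : Cyc 2, ∀ x, frobAct p c x = f x := by
  have hfin : Module.finrank (ZMod p) (Fpp p) = 2 := GaloisField.finrank p two_ne_zero
  let F : Fpp p →ₐ[ZMod p] Fpp p :=
    { f with
      commutes' := fun c => by
        have h1 : f.comp (algebraMap (ZMod p) (Fpp p)) = algebraMap (ZMod p) (Fpp p) :=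
          RingHom.ext_zmod _ _
        exact DFunLike.congr_fun h1 c }
  obtain ⟨n, hn⟩ := (FiniteField.bijective_frobeniusAlgHom_pow (ZMod p) (Fpp p)).2 F
  have hn2 : n.1 = 0 ∨ n.1 = 1 := by
    have := n.2
    omega
  rcases hn2 with h | h
  · refine ⟨1, fun x => ?_⟩
    have h1 := DFunLike.congr_fun hn x
    simp only [h, pow_zero] at h1
    rw [map_one]
    exact h1
  · refine ⟨cgen 2, fun x => ?_⟩
    have h1 := DFunLike.congr_fun hn x
    simp only [h, pow_one] at h1
    rw [frobAct_gen]
    refine Eq.trans ?_ h1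
    rw [FiniteField.coe_frobeniusAlgHom, ZMod.card]

/-- The prime field already contains an element of order q, and the cyclic group of units of the
larger field has only one subgroup of that order. -/
theorem exists_algebraMap_eq (h : q ∣ p - 1) {ζ : (Fpp p)ˣ} (hζ : ζ ^ q = 1) :
    ∃ c : ZMod p, (ζ : Fpp p) = algebraMap (ZMod p) (Fpp p) c := by
  obtain ⟨u, hu⟩ := exists_unit_orderOf h
  have hq := (Fact.out : q.Prime)
  let m := Units.map (algebraMap (ZMod p) (Fpp p)).toMonoidHom
  have hm : Function.Injective m := Units.map_injective (algebraMap (ZMod p) (Fpp p)).injective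
  have h1 : orderOf (m u) = q := by rw [orderOf_injective m hm, hu]
  obtain ⟨k, hk⟩ := exists_pow_eq_of_pow_eq_one hζ (orderOf_dvd_iff_pow_eq_one.mp h1.dvd)
    (fun h2 => hq.one_lt.ne (by rw [← h1, h2, orderOf_one]))
  refine ⟨((u ^ k : (ZMod p)ˣ) : ZMod p), ?_⟩
  rw [hk, ← map_pow]
  rfl

/-- Type `10` in terms of the field with `p ^ 2` elements. -/
theorem exists_field_semidirect (hpq : p ≠ q) {G : Type*} [Group G]
    (h : IsPlaneSemidirect p q KindC G) :
    ∃ χ : Cyc q →* (Fpp p)ˣ,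
      (∀ c : ZMod p, (χ (cgen q) : Fpp p) ≠ algebraMap (ZMod p) (Fpp p) c) ∧
      Nonempty (G ≃* Multiplicative (Fpp p) ⋊[(unitsAdd (Fpp p)).comp χ] Cyc q) := by
  obtain ⟨φ, hφ, ⟨e⟩⟩ := h
  obtain ⟨γ, ζ, hγ, hζ⟩ := exists_field_model ((kindC_iff hpq (map_cgen_pow φ)).mp hφ)
  have hζq : ζ ^ q = 1 := by
    apply unitsAdd_injective
    apply (MulAut.congr γ).injective
    rw [map_pow, map_pow, hγ, ← map_pow, map_cgen_pow, map_one, map_one, map_one]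
  obtain ⟨χ, hχ⟩ := exists_hom_map_cgen hζq
  refine ⟨χ, by rwa [hχ], ?_⟩
  obtain ⟨f⟩ := nonempty_semidirect_congr γ (φ := (unitsAdd (Fpp p)).comp χ)
    (ψ := (glAct p).comp φ) (by
      rw [MonoidHom.comp_apply, MonoidHom.comp_apply, hχ, hγ])
  exact ⟨e.trans f.symm⟩

theorem orderOf_of_ne_algebraMap {χ : Cyc q →* (Fpp p)ˣ}
    (h : ∀ c : ZMod p, (χ (cgen q) : Fpp p) ≠ algebraMap (ZMod p) (Fpp p) c) :
    orderOf (χ (cgen q)) = q :=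
  orderOf_eq_prime (map_cgen_pow χ) fun h1 => h 1 (by rw [h1, Units.val_one, map_one])

/-- In the field model both actions have as image the unique subgroup of order q of the cyclic group
of units. -/
theorem nonempty_congr_kindC (hpq : p ≠ q) {G H : Type*} [Group G] [Group H]
    (hG : IsPlaneSemidirect p q KindC G) (hH : IsPlaneSemidirect p q KindC H) :
    Nonempty (G ≃* H) := by
  obtain ⟨χ, hχ, ⟨e⟩⟩ := exists_field_semidirect hpq hG
  obtain ⟨χ', hχ', ⟨e'⟩⟩ := exists_field_semidirect hpq hH
  have h1 := zpowers_eq_of_orderOf_eq ((orderOf_of_ne_algebraMap hχ).trans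
    (orderOf_of_ne_algebraMap hχ').symm)
  obtain ⟨f⟩ := nonempty_semidirect_congr (MulEquiv.refl _) (φ := (unitsAdd (Fpp p)).comp χ)
    (ψ := (unitsAdd (Fpp p)).comp χ') (by
      have h2 := congrArg (Subgroup.map (unitsAdd (Fpp p))) h1
      rw [MonoidHom.map_zpowers, MonoidHom.map_zpowers] at h2
      exact h2)
  exact ⟨(e.trans f).trans e'.symm⟩

theorem sq_sub_one_eq {p : ℕ} : p ^ 2 - 1 = (p + 1) * (p - 1) := by
  simpa using Nat.sq_sub_sq p 1

/-- The order q divides p² - 1 = (p + 1)(p - 1), but not p - 1, since otherwise the root of unity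
would lie in the prime field. In particular q ≠ 2, because p is odd when q = 2. -/
theorem condition_of_field (hpq : p ≠ q) {χ : Cyc q →* (Fpp p)ˣ}
    (h : ∀ c : ZMod p, (χ (cgen q) : Fpp p) ≠ algebraMap (ZMod p) (Fpp p) c) :
    2 < q ∧ q ∣ p + 1 := by
  have hq := (Fact.out : q.Prime)
  have hp := (Fact.out : p.Prime)
  have h1 : ¬ q ∣ p - 1 := fun h1 => by
    obtain ⟨c, hc⟩ := exists_algebraMap_eq h1 (map_cgen_pow χ)
    exact h c hc
  have h2 : q ∣ p ^ 2 - 1 := by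
    have h3 := orderOf_dvd_natCard (χ (cgen q))
    rwa [orderOf_of_ne_algebraMap h, Nat.card_units, card_fpp] at h3
  rw [sq_sub_one_eq] at h2
  refine ⟨lt_of_le_of_ne hq.two_le fun h3 => h1 ?_, (hq.dvd_mul.mp h2).resolve_right h1⟩
  subst h3
  have := hp.eq_two_or_odd.resolve_left hpq
  have := hp.two_le
  omega

/-- Multiplication by a unit of order q, carried to the plane by any linear isomorphism, works. It
is not scalar, since a scalar of order q would need q ∣ p - 1, and q > 2 cannot divide both p - 1
and p + 1. -/
theorem exists_hom_kindC (hq2 : 2 < q) (h : q ∣ p + 1) :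
    ∃ φ : Cyc q →* GL (Fin 2) (ZMod p), KindC (φ (cgen q)) := by
  have hq := (Fact.out : q.Prime)
  have hp := (Fact.out : p.Prime)
  have hnd : ¬ q ∣ p - 1 := fun h1 => by
    have h2 := Nat.dvd_sub h h1
    have h3 : p + 1 - (p - 1) = 2 := by
      have := hp.two_le
      omega
    rw [h3] at h2
    exact absurd (Nat.le_of_dvd two_pos h2) (by omega)
  obtain ⟨ζ, hζ⟩ := exists_orderOf_eq (A := (Fpp p)ˣ) (d := q) (by
    rw [Nat.card_units, card_fpp, sq_sub_one_eq]
    exact h.mul_right _)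
  have hfin : Module.finrank (ZMod p) (Fpp p) = Module.finrank (ZMod p) (Fin 2 → ZMod p) := by
    rw [GaloisField.finrank p two_ne_zero, Module.finrank_fin_fun]
  let γ : Multiplicative (Fpp p) ≃* Plane p :=
    AddEquiv.toMultiplicative (LinearEquiv.ofFinrankEq (Fpp p) (Fin 2 → ZMod p) hfin).toAddEquiv
  obtain ⟨Z, hZ⟩ := glAct_bijective.2 (MulAut.congr γ (unitsAdd (Fpp p) ζ))
  have hord : orderOf Z = q := by
    rw [← orderOf_injective (glAct p) glAct_bijective.1, hZ, MulEquiv.orderOf_eq,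
      orderOf_injective _ unitsAdd_injective, hζ]
  have hZq : Z ^ q = 1 := orderOf_dvd_iff_pow_eq_one.mp hord.dvd
  obtain ⟨φ, hφ⟩ := exists_hom_map_cgen hZq
  refine ⟨φ, ?_⟩
  rw [hφ]
  refine kindC_of_field_model (fun hs => ?_) γ ζ hZ.symm
  by_cases h1 : Z = 1
  · rw [h1, orderOf_one] at hord
    exact hq.one_lt.ne hord
  · obtain ⟨u, hu, rfl⟩ := kindS_iff.mp ⟨hs, h1⟩
    exact hnd (dvd_sub_one_of_pow_eq_one (diagGL_pow_eq_one hφ).1 hu)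

theorem eq_top_of_ne_algebraMap (S : Subalgebra (ZMod p) (Fpp p)) {ζ : Fpp p} (hζ : ζ ∈ S)
    (h : ∀ c : ZMod p, ζ ≠ algebraMap (ZMod p) (Fpp p) c) : S = ⊤ := by
  have := Subalgebra.isSimpleOrder_of_finrank_prime (ZMod p) (Fpp p) (by
    rw [GaloisField.finrank p two_ne_zero]
    exact Nat.prime_two)
  refine (eq_bot_or_eq_top S).resolve_left fun hb => ?_
  rw [hb, Algebra.mem_bot] at hζ
  obtain ⟨c, hc⟩ := hζ
  exact h c hc.symm

/-- An additive bijection of the field with `p ^ 2` elements that is semilinear for a generator is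
the composition of a multiplication and a field automorphism. -/
theorem exists_semilinear (f : Fpp p →+ Fpp p) (hf : Function.Injective f) {ζ ζ' : Fpp p}
    (hζ : ∀ c : ZMod p, ζ ≠ algebraMap (ZMod p) (Fpp p) c) (h : ∀ x, f (ζ * x) = ζ' * f x) :
    ∃ (u : (Fpp p)ˣ) (c : Cyc 2), (∀ x, f x = u * frobAct p c x) ∧ ζ' = frobAct p c ζ := by
  have h1 : f 1 ≠ 0 := fun h0 => one_ne_zero (hf (h0.trans (map_zero f).symm))
  -- The x for which f / f(1) is multiplicative against all y form a subalgebra. It contains ζ, and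
  -- an extension of degree 2 has no proper intermediate subalgebra, so f / f(1) is a ring
  -- homomorphism.
  let S : Subalgebra (ZMod p) (Fpp p) :=
    { carrier := {x | ∀ y, f (x * y) * f 1 = f x * f y}
      mul_mem' := fun {x y} hx hy z => by
        apply mul_right_cancel₀ h1
        have e1 := hx (y * z)
        have e2 := hy z
        have e3 := hx y
        rw [← mul_assoc] at e1
        linear_combination f 1 * e1 + f x * e2 - f z * e3
      add_mem' := fun {x y} hx hy z => by
        have e1 := hx z
        have e2 := hy z
        rw [add_mul, map_add, map_add]
        linear_combination e1 + e2
      algebraMap_mem' := fun c y => by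
        have e1 : ∀ y, f (algebraMap (ZMod p) (Fpp p) c * y) =
            algebraMap (ZMod p) (Fpp p) c * f y := fun y => by
          rw [← Algebra.smul_def, ← Algebra.smul_def, ZMod.map_smul]
        have e2 := e1 1
        rw [mul_one] at e2
        rw [e1, e2]
        ring }
  have hS : ζ ∈ S := fun y => by
    have := h 1
    rw [mul_one] at this
    rw [h, this]
    ring
  have hall : ∀ x y, f (x * y) * f 1 = f x * f y := fun x => by
    have : x ∈ S := by rw [eq_top_of_ne_algebraMap S hS hζ]; exact Algebra.mem_top
    exact this
  let F : Fpp p →+* Fpp p :=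
    { toFun := fun x => (f 1)⁻¹ * f x
      map_one' := inv_mul_cancel₀ h1
      map_zero' := by rw [map_zero, mul_zero]
      map_add' := fun x y => by rw [map_add, mul_add]
      map_mul' := fun x y => by
        have := hall x y
        field_simp
        rw [mul_comm, this] }
  obtain ⟨c, hc⟩ := exists_frobAct_eq F
  have hfx : ∀ x, f x = f 1 * frobAct p c x := fun x => by
    rw [hc]
    change f x = f 1 * ((f 1)⁻¹ * f x)
    rw [mul_inv_cancel_left₀ h1]
  refine ⟨Units.mk0 (f 1) h1, c, hfx, ?_⟩
  have h2 := h 1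
  rw [mul_one, hfx ζ, mul_comm] at h2
  exact (mul_right_cancel₀ h1 h2).symm

/-- Since q ∣ p + 1, Frobenius inverts the elements of order q, so it is compatible with inversion
on C_q. By `exists_semilinear` the compatible pairs are exactly the semilinear maps. -/
theorem nonempty_mulAut_field (hpq : p ≠ q) {χ : Cyc q →* (Fpp p)ˣ}
    (h : ∀ c : ZMod p, (χ (cgen q) : Fpp p) ≠ algebraMap (ZMod p) (Fpp p) c) :
    Nonempty (MulAut (Multiplicative (Fpp p) ⋊[(unitsAdd (Fpp p)).comp χ] Cyc q) ≃*
      Multiplicative (Fpp p) ⋊[semiLinAct p] SemiLin p) := by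
  obtain ⟨hq2, hqp⟩ := condition_of_field hpq h
  have hinj : Function.Injective χ :=
    injective_of_orderOf_map_cgen (orderOf_of_ne_algebraMap h)
  have hχ : ∀ c k, frobAct p c (χ k : Fpp p) = (χ (invAct (Cyc q) c k) : Fpp p) := fun c k => by
    rcases cyc_two_cases c with rfl | rfl
    · rw [map_one, map_one]
      rfl
    · rw [frobAct_gen, invAct_gen, map_inv, ← Units.val_pow_eq_pow_val]
      congr 1
      rw [eq_inv_iff_mul_eq_one, ← pow_succ, ← map_pow]
      obtain ⟨m, hm⟩ := hqp
      have := pow_card_eq_one' (x := k)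
      rw [card_cyc] at this
      rw [hm, pow_mul, this, one_pow, map_one]
  refine nonempty_mulAut_semidirect (φ := (unitsAdd (Fpp p)).comp χ) (semiLinAct p)
    ((invAct (Cyc q)).comp SemidirectProduct.rightHom) (fun l k n => ?_) ?_ (fun n hn => ?_)
    (fun l hl1 hl2 => ?_) (fun α β hαβ => ?_)
  · apply Multiplicative.toAdd.injective
    change (l.left : Fpp p) * frobAct p l.right ((χ k : Fpp p) * n.toAdd) =
      (χ (invAct (Cyc q) l.right k) : Fpp p) * (l.left * frobAct p l.right n.toAdd)
    rw [map_mul, hχ]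
    ring
  · rw [Nat.card_congr Multiplicative.toAdd, card_fpp, card_cyc]
    exact coprime_sq hpq
  · by_contra hne
    have hne' : n.toAdd ≠ 0 := hne
    have h1 : (χ (cgen q) : Fpp p) * n.toAdd = n.toAdd := hn (cgen q)
    exact h 1 (by rw [map_one]; exact mul_right_cancel₀ hne' (h1.trans (one_mul _).symm))
  -- The C_2 component is detected on C_q, where inversion is non-trivial because q > 2.
  · have hr : l.right = 1 := by
      refine (cyc_two_cases l.right).resolve_right fun h1 => ?_
      have h2 : invAct (Cyc q) l.right (cgen q) = cgen q := DFunLike.congr_fun hl2 (cgen q)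
      rw [h1, invAct_gen, inv_eq_iff_mul_eq_one, ← sq] at h2
      have h3 := orderOf_dvd_of_pow_eq_one h2
      rw [orderOf_cgen] at h3
      exact absurd (Nat.le_of_dvd two_pos h3) (by omega)
    ext1
    · have h1 : (l.left : Fpp p) * frobAct p l.right 1 = 1 :=
        DFunLike.congr_fun hl1 (Multiplicative.ofAdd 1)
      rw [map_one, mul_one] at h1
      exact Units.ext h1
    · exact hr
  · let f : Fpp p →+ Fpp p := AddMonoidHom.toMultiplicative.symm α.toMonoidHom
    obtain ⟨u, c, hu, hc⟩ := exists_semilinear f α.injective h (hαβ (cgen q))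
    refine ⟨⟨u, c⟩, ?_, ?_⟩
    · refine MulEquiv.ext fun x => ?_
      exact (hu x.toAdd).symm
    · apply mulAut_cyc_ext
      apply hinj
      apply Units.ext
      rw [hc, hχ]
      rfl

end

/-! ### Counting the isomorphism classes of type 8 -/

section

variable {p q : ℕ} [Fact p.Prime] [Fact q.Prime]

/-- Representatives of the pairs `{k, k⁻¹}` of residues different from `0`, `1` and `-1`. -/
def pairReps (q : ℕ) [Fact q.Prime] : Finset (ZMod q) :=
  Finset.univ.filter fun k => k ≠ 0 ∧ k ≠ 1 ∧ k ≠ -1 ∧ k.val < (k⁻¹).val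

theorem mem_pairReps {k : ZMod q} :
    k ∈ pairReps q ↔ k ≠ 0 ∧ k ≠ 1 ∧ k ≠ -1 ∧ k.val < (k⁻¹).val := by
  rw [pairReps, Finset.mem_filter, and_iff_right (Finset.mem_univ k)]

theorem mem_pairReps_or {k : ZMod q} (h0 : k ≠ 0) (h1 : k ≠ 1) (h2 : k ≠ -1) :
    k ∈ pairReps q ∨ k⁻¹ ∈ pairReps q := by
  have hne : k.val ≠ (k⁻¹).val := fun h => by
    have h3 : k = k⁻¹ := ZMod.val_injective q h
    have h4 : k * k = 1 := by
      nth_rewrite 2 [h3]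
      exact mul_inv_cancel₀ h0
    rcases mul_self_eq_one_iff.mp h4 with h4 | h4
    · exact h1 h4
    · exact h2 h4
  rcases lt_or_gt_of_ne hne with h | h
  · exact Or.inl (mem_pairReps.mpr ⟨h0, h1, h2, h⟩)
  · refine Or.inr (mem_pairReps.mpr ⟨inv_ne_zero h0, ?_, ?_, by rwa [inv_inv]⟩)
    · rwa [Ne, inv_eq_one]
    · rwa [Ne, inv_eq_iff_eq_inv, inv_neg_one]

/-- The q - 3 residues other than 0, 1 and -1 split into pairs {k, k⁻¹} of distinct elements, each
contributing one representative. -/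
theorem card_pairReps (hq : 3 < q) : (pairReps q).card = (q - 3) / 2 := by
  classical
  have hd : Disjoint (pairReps q) ((pairReps q).image (·⁻¹)) := by
    rw [Finset.disjoint_left]
    intro k hk hk'
    obtain ⟨l, hl, rfl⟩ := Finset.mem_image.mp hk'
    have h1 := (mem_pairReps.mp hk).2.2.2
    have h2 := (mem_pairReps.mp hl).2.2.2
    rw [inv_inv] at h1
    omega
  have hu : pairReps q ∪ (pairReps q).image (·⁻¹) =
      Finset.univ \ ({0, 1, -1} : Finset (ZMod q)) := by
    ext k
    simp only [Finset.mem_union, Finset.mem_image, Finset.mem_sdiff, Finset.mem_univ, true_and,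
      Finset.mem_insert, Finset.mem_singleton, not_or]
    constructor
    · rintro (h | ⟨l, hl, rfl⟩)
      · exact ⟨(mem_pairReps.mp h).1, (mem_pairReps.mp h).2.1, (mem_pairReps.mp h).2.2.1⟩
      · obtain ⟨h0, h1, h2, -⟩ := mem_pairReps.mp hl
        exact ⟨inv_ne_zero h0, by rwa [inv_eq_one], by rwa [inv_eq_iff_eq_inv, inv_neg_one]⟩
    · rintro ⟨h0, h1, h2⟩
      rcases mem_pairReps_or h0 h1 h2 with h | h
      · exact Or.inl h
      · exact Or.inr ⟨_, h, inv_inv k⟩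
  have : Fact (2 < q) := ⟨by omega⟩
  have h3 : ({0, 1, -1} : Finset (ZMod q)).card = 3 := by
    rw [Finset.card_eq_three]
    exact ⟨0, 1, -1, zero_ne_one, (neg_ne_zero.mpr one_ne_zero).symm, ZMod.neg_one_ne_one.symm, rfl⟩
  have h4 := congrArg Finset.card hu
  rw [Finset.card_union_of_disjoint hd, Finset.card_image_of_injective _ inv_injective,
    Finset.card_sdiff_of_subset (Finset.subset_univ _), h3, Finset.card_univ, ZMod.card] at h4
  omega

theorem pow_eq_pow_iff_cast {A : Type*} [Group A] {g : A} (hg : orderOf g = q) {m n : ℕ} :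
    g ^ m = g ^ n ↔ (m : ZMod q) = n := by
  rw [pow_eq_pow_iff_modEq, hg, ZMod.natCast_eq_natCast_iff]

/-- Writing a = g^i gives diag(a, a^j) = diag(g, g^j)^i, so only the ratio j of the exponents of the
two eigenvalues matters. -/
theorem exists_mulEquiv_family {g : (ZMod p)ˣ} (hg : orderOf g = q)
    {ψ : ZMod q → Cyc q →* GL (Fin 2) (ZMod p)}
    (hψ : ∀ k, ψ k (cgen q) = diagGL p (g, g ^ k.val)) {φ : Cyc q →* GL (Fin 2) (ZMod p)}
    {a b : (ZMod p)ˣ} (ha : a ^ q = 1) (ha1 : a ≠ 1) {j : ℕ} (hj : b = a ^ j)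
    (P : GL (Fin 2) (ZMod p)) (hφ : P * φ (cgen q) * P⁻¹ = diagGL p (a, b)) :
    Nonempty (Plane p ⋊[(glAct p).comp φ] Cyc q ≃*
      Plane p ⋊[(glAct p).comp (ψ (j : ZMod q))] Cyc q) := by
  have hgq : g ^ q = 1 := orderOf_dvd_iff_pow_eq_one.mp hg.dvd
  have hg1 : g ≠ 1 := fun h => (Fact.out : q.Prime).one_lt.ne (by rw [← hg, h, orderOf_one])
  obtain ⟨i, hi⟩ := exists_pow_eq_of_pow_eq_one ha hgq hg1
  refine nonempty_plane_congr P i ?_ fun h1 => ha1 ?_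
  · rw [hφ, hψ, ← map_pow, Prod.pow_mk, ← hi, hj]
    congr 2
    rw [hi, ← pow_mul, ← pow_mul, pow_eq_pow_iff_cast hg]
    push_cast
    rw [ZMod.natCast_zmod_val, mul_comm]
  · rw [h1, mul_one, mul_inv_cancel, ← map_one (diagGL p)] at hφ
    exact (congrArg Prod.fst (diagGL_injective hφ)).symm

theorem exists_family_kindD0 (hpq : p ≠ q) (hq : 3 < q) (h : q ∣ p - 1) :
    ∃ (F : Fin ((q - 3) / 2) → Type u) (_ : ∀ i, Group (F i)),
      (∀ i, IsPlaneSemidirect p q KindD0 (F i)) ∧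
      (∀ i j, Nonempty (F i ≃* F j) → i = j) ∧
      ∀ (G : Type u) [Group G], IsPlaneSemidirect p q KindD0 G → ∃ i, Nonempty (G ≃* F i) := by
  obtain ⟨g, hg⟩ := exists_unit_orderOf h
  have hgq : g ^ q = 1 := orderOf_dvd_iff_pow_eq_one.mp hg.dvd
  choose ψ hψ using fun k : ZMod q => exists_hom_diagGL hgq
    (show (g ^ k.val) ^ q = 1 by rw [← pow_mul, mul_comm, pow_mul, hgq, one_pow])
  let e := ((pairReps q).equivFinOfCardEq (card_pairReps hq)).symm
  refine ⟨fun i => ULift.{u} (Plane p ⋊[(glAct p).comp (ψ (e i))] Cyc q), fun i => inferInstance,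
    fun i => ?_, fun i j hij => ?_, fun G _ hG => ?_⟩
  · refine ⟨ψ (e i), ?_, ⟨MulEquiv.ulift⟩⟩
    obtain ⟨h0, h1, h2, -⟩ := mem_pairReps.mp (e i).2
    generalize ((e i : ZMod q)) = k at *
    change KindD0 (ψ k (cgen q))
    rw [kindD0_iff]
    refine ⟨g, g ^ k.val, fun h3 => h1 ?_, fun h3 => ?_, fun h3 => h0 ?_, fun h3 => h2 ?_, hψ k⟩
    · have h4 : g ^ 1 = g ^ k.val := by rwa [pow_one]
      rw [pow_eq_pow_iff_cast hg, ZMod.natCast_zmod_val, Nat.cast_one] at h4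
      exact h4.symm
    · rw [h3, orderOf_one] at hg
      omega
    · rw [← pow_zero g, pow_eq_pow_iff_cast hg, ZMod.natCast_zmod_val, Nat.cast_zero] at h3
      exact h3
    · have h4 : g ^ (k.val + 1) = g ^ 0 := by rw [pow_succ', h3, pow_zero]
      rw [pow_eq_pow_iff_cast hg] at h4
      push_cast at h4
      rw [ZMod.natCast_zmod_val] at h4
      exact eq_neg_of_add_eq_zero_left h4
  · obtain ⟨f⟩ := hij
    obtain ⟨P, m, hP⟩ := exists_conj_eq_pow hpq ⟨(MulEquiv.ulift.symm.trans f).trans MulEquiv.ulift⟩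
    obtain ⟨h0, h1, h2, h3⟩ := mem_pairReps.mp (e i).2
    have h3' := (mem_pairReps.mp (e j).2).2.2.2
    rw [hψ, hψ, ← map_pow, Prod.pow_mk, mul_inv_eq_iff_eq_mul] at hP
    have hne : g ≠ g ^ (e i : ZMod q).val := fun h4 => h1 (by
      have h5 : g ^ 1 = g ^ (e i : ZMod q).val := by rwa [pow_one]
      rw [pow_eq_pow_iff_cast hg, ZMod.natCast_zmod_val, Nat.cast_one] at h5
      exact h5.symm)
    apply e.injective
    apply Subtype.ext
    -- A diagonal intertwiner gives m = 1 and equal exponents. A monomial one makes the two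
    -- exponents mutually inverse, which two chosen representatives cannot be.
    rcases intertwine_diagGL hne hP with ⟨-, -, h4, h5⟩ | ⟨-, -, h4, h5⟩
    · have h4' : g ^ m = g ^ 1 := by rwa [pow_one]
      rw [pow_eq_pow_iff_cast hg, Nat.cast_one] at h4'
      rw [← pow_mul, pow_eq_pow_iff_cast hg] at h5
      push_cast at h5
      rw [h4', ZMod.natCast_zmod_val, ZMod.natCast_zmod_val, mul_one] at h5
      exact h5.symm
    · exfalso
      rw [pow_eq_pow_iff_cast hg, ZMod.natCast_zmod_val] at h4
      have h5' : g ^ ((e j : ZMod q).val * m) = g ^ 1 := by rwa [pow_mul, pow_one]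
      rw [pow_eq_pow_iff_cast hg] at h5'
      push_cast at h5'
      rw [h4, ZMod.natCast_zmod_val] at h5'
      have h6 := eq_inv_of_mul_eq_one_left h5'
      rw [h6, inv_inv] at h3'
      omega
  · obtain ⟨φ, hφ, ⟨f⟩⟩ := hG
    obtain ⟨a, b, hab, ha1, hb1, hab1, h1⟩ := kindD0_iff.mp hφ
    obtain ⟨ha, hb⟩ := diagGL_pow_eq_one h1
    have hoa := orderOf_eq_prime ha ha1
    obtain ⟨j, hj⟩ := exists_pow_eq_of_pow_eq_one hb ha ha1
    have hj0 : (j : ZMod q) ≠ 0 := fun h2 => hb1 (by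
      rw [hj, ← pow_zero a, pow_eq_pow_iff_cast hoa, h2, Nat.cast_zero])
    have hj1 : (j : ZMod q) ≠ 1 := fun h2 => hab (by
      rw [hj]
      conv_lhs => rw [← pow_one a]
      rw [pow_eq_pow_iff_cast hoa, h2, Nat.cast_one])
    have hj2 : (j : ZMod q) ≠ -1 := fun h2 => hab1 (by
      rw [hj, ← pow_succ', ← pow_zero a, pow_eq_pow_iff_cast hoa]
      push_cast
      rw [h2, neg_add_cancel])
    have key : ∀ k ∈ pairReps q, Nonempty (G ≃* Plane p ⋊[(glAct p).comp (ψ k)] Cyc q) →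
        ∃ i, Nonempty (G ≃* ULift.{u} (Plane p ⋊[(glAct p).comp (ψ (e i))] Cyc q)) :=
      fun k hk ⟨f⟩ => ⟨e.symm ⟨k, hk⟩, by
        rw [Equiv.apply_symm_apply]
        exact ⟨f.trans MulEquiv.ulift.symm⟩⟩
    rcases mem_pairReps_or hj0 hj1 hj2 with hk | hk
    · obtain ⟨f'⟩ := exists_mulEquiv_family hg hψ ha ha1 hj 1 (by
        rw [one_mul, inv_one, mul_one, h1])
      exact key _ hk ⟨f.trans f'⟩
    -- When the representative is j⁻¹, the coordinates are exchanged: a is then the power of b with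
    -- exponent j⁻¹.
    · obtain ⟨i, hi⟩ := exists_pow_eq_of_pow_eq_one ha hb hb1
      have hij : (i : ZMod q) = (j : ZMod q)⁻¹ := by
        apply eq_inv_of_mul_eq_one_left
        have h2 : a ^ (i * j) = a ^ 1 := by rw [mul_comm, pow_mul, ← hj, ← hi, pow_one]
        rw [pow_eq_pow_iff_cast hoa] at h2
        exact_mod_cast h2
      obtain ⟨f'⟩ := exists_mulEquiv_family hg hψ (φ := φ) hb hb1 hi (swapGL p) (by
        rw [h1, swapGL_mul_diagGL, mul_assoc, mul_inv_cancel, mul_one])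
      rw [hij] at f'
      exact key _ hk ⟨f.trans f'⟩

end

/-! ### Sylow theory: every group has a type -/

section

variable {p q : ℕ} [Fact p.Prime] [Fact q.Prime]

section Sylow

variable {G : Type*} [Group G]

theorem finite_of_card_eq {G : Type*} (hG : Nat.card G = p ^ 2 * q) : Finite G :=
  Nat.finite_of_card_ne_zero (by
    rw [hG]
    exact mul_ne_zero (pow_ne_zero 2 (Fact.out : p.Prime).ne_zero) (Fact.out : q.Prime).ne_zero)

theorem card_sylow_left (hpq : p ≠ q) (hG : Nat.card G = p ^ 2 * q) (P : Sylow p G) :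
    Nat.card P = p ^ 2 := by
  have := finite_of_card_eq hG
  have hp := (Fact.out : p.Prime)
  have hq := (Fact.out : q.Prime)
  rw [Sylow.card_eq_multiplicity, hG, Nat.factorization_mul (pow_ne_zero 2 hp.ne_zero) hq.ne_zero,
    hp.factorization_pow, hq.factorization]
  simp [hpq.symm]

theorem card_sylow_right (hpq : p ≠ q) (hG : Nat.card G = p ^ 2 * q) (Q : Sylow q G) :
    Nat.card Q = q := by
  have := finite_of_card_eq hG
  have hp := (Fact.out : p.Prime)
  have hq := (Fact.out : q.Prime)
  rw [Sylow.card_eq_multiplicity, hG, Nat.factorization_mul (pow_ne_zero 2 hp.ne_zero) hq.ne_zero,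
    hp.factorization_pow, hq.factorization]
  simp [hpq]

theorem normal_of_card_sylow_eq_one {r : ℕ} [Fact r.Prime] [Finite G]
    (h : Nat.card (Sylow r G) = 1) (P : Sylow r G) : (P : Subgroup G).Normal := by
  have := (Nat.card_eq_one_iff_unique.mp h).1
  exact Sylow.normal_of_subsingleton P

/-- A group of order `p ^ 2 * q` has a normal Sylow subgroup. -/
theorem exists_normal_sylow (hpq : p ≠ q) (hG : Nat.card G = p ^ 2 * q) :
    (∃ P : Sylow p G, (P : Subgroup G).Normal) ∨ (∃ Q : Sylow q G, (Q : Subgroup G).Normal) := by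
  have := finite_of_card_eq hG
  have hp := (Fact.out : p.Prime)
  have hq := (Fact.out : q.Prime)
  let P : Sylow p G := default
  let Q : Sylow q G := default
  have hP : (P : Subgroup G).index = q := by
    have h1 := (P : Subgroup G).card_mul_index
    rw [hG] at h1
    change Nat.card P * _ = _ at h1
    rw [card_sylow_left hpq hG] at h1
    exact Nat.eq_of_mul_eq_mul_left (pow_pos hp.pos 2) h1
  have hQ : (Q : Subgroup G).index = p ^ 2 := by
    have h1 := (Q : Subgroup G).card_mul_index
    rw [hG] at h1
    change Nat.card Q * _ = _ at h1
    rw [card_sylow_right hpq hG, mul_comm] at h1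
    exact Nat.eq_of_mul_eq_mul_right hq.pos h1
  have hnp := P.card_dvd_index
  rw [hP] at hnp
  rcases (Nat.dvd_prime hq).mp hnp with h1 | h1
  · exact Or.inl ⟨P, normal_of_card_sylow_eq_one h1 P⟩
  -- The number of Sylow p-subgroups is now q, and it is congruent to 1 modulo p.
  have hlt : p < q := by
    have h2 := card_sylow_modEq_one p G
    rw [h1] at h2
    have h3 := (Nat.modEq_iff_dvd' hq.one_le).mp h2.symm
    have := Nat.le_of_dvd (by have := hq.two_le; omega) h3
    have := hq.two_le
    omega
  have hnq := Q.card_dvd_index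
  rw [hQ] at hnq
  obtain ⟨k, hk, h2⟩ := (Nat.dvd_prime_pow hp).mp hnq
  have hmod := card_sylow_modEq_one q G
  interval_cases k
  · exact Or.inr ⟨Q, normal_of_card_sylow_eq_one (by rw [h2, pow_zero]) Q⟩
  -- Exactly p Sylow q-subgroups would give q ∣ p - 1, contrary to p < q.
  · exfalso
    rw [h2, pow_one] at hmod
    have h3 := (Nat.modEq_iff_dvd' hp.one_le).mp hmod.symm
    have := Nat.le_of_dvd (by have := hp.two_le; omega) h3
    omega
  -- With p² Sylow q-subgroups, Q is its own normalizer. Being abelian, it is central there, so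
  -- Burnside's transfer theorem yields a normal complement of order p², which is a Sylow
  -- p-subgroup.
  · left
    have hnorm : Subgroup.normalizer ((Q : Subgroup G) : Set G) = Q := by
      symm
      refine Subgroup.eq_of_le_of_card_ge Subgroup.le_normalizer ?_
      have h3 := (Subgroup.normalizer ((Q : Subgroup G) : Set G)).card_mul_index
      have h4 := Q.card_eq_index_normalizer
      have h5 : (Subgroup.normalizer ((Q : Subgroup G) : Set G)).index = p ^ 2 := h4.symm.trans h2
      rw [h5, hG, mul_comm] at h3
      rw [Nat.eq_of_mul_eq_mul_left (pow_pos hp.pos 2) h3]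
      exact (card_sylow_right hpq hG Q).ge
    have hcyc : IsCyclic (Q : Subgroup G) := isCyclic_of_prime_card (card_sylow_right hpq hG Q)
    have hcent : Subgroup.normalizer ((Q : Subgroup G) : Set G) ≤
        Subgroup.centralizer ((Q : Subgroup G) : Set G) := by
      rw [hnorm]
      intro x hx
      rw [Subgroup.mem_centralizer_iff]
      intro y hy
      let _ : CommGroup (Q : Subgroup G) := IsCyclic.commGroup
      have h6 : (⟨y, hy⟩ : (Q : Subgroup G)) * ⟨x, hx⟩ = ⟨x, hx⟩ * ⟨y, hy⟩ := mul_comm _ _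
      exact congrArg Subtype.val h6
    have hcomp := MonoidHom.ker_transferSylow_isComplement' Q hcent
    set N := (MonoidHom.transferSylow Q hcent).ker with hN
    have hcard : Nat.card N = p ^ 2 := by
      have h6 := hcomp.card_mul_card
      rw [hG] at h6
      change _ * Nat.card Q = _ at h6
      rw [card_sylow_right hpq hG] at h6
      exact Nat.eq_of_mul_eq_mul_right hq.pos h6
    have hNP : IsPGroup p N := IsPGroup.of_card hcard
    obtain ⟨P', hP'⟩ := hNP.exists_le_sylow
    refine ⟨P', ?_⟩
    have h7 : N = (P' : Subgroup G) := by
      refine Subgroup.eq_of_le_of_card_ge hP' ?_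
      rw [hcard]
      exact (card_sylow_left hpq hG P').le
    rw [← h7, hN]
    infer_instance

theorem nonempty_addEquiv_of_card {V : Type*} [AddCommGroup V] [Module (ZMod p) V]
    (h : Nat.card V = p ^ 2) : Nonempty (V ≃+ (Fin 2 → ZMod p)) := by
  have hp := (Fact.out : p.Prime)
  have hfin : Finite V := Nat.finite_of_card_ne_zero (by
    rw [h]
    exact pow_ne_zero 2 hp.ne_zero)
  have hrank : Module.finrank (ZMod p) V = Module.finrank (ZMod p) (Fin 2 → ZMod p) := by
    rw [Module.finrank_fin_fun]
    have h1 := Module.natCard_eq_pow_finrank (K := ZMod p) (V := V)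
    rw [Nat.card_zmod, h] at h1
    exact (Nat.pow_right_injective hp.two_le h1).symm
  exact ⟨(LinearEquiv.ofFinrankEq V (Fin 2 → ZMod p) hrank).toAddEquiv⟩

theorem nonempty_plane_of_pow_eq_one {P : Type*} [CommGroup P] (h : Nat.card P = p ^ 2)
    (hexp : ∀ x : P, x ^ p = 1) : Nonempty (P ≃* Plane p) := by
  let _ : Module (ZMod p) (Additive P) := AddCommGroup.zmodModule fun x => hexp x.toMul
  obtain ⟨e⟩ := nonempty_addEquiv_of_card (p := p) (V := Additive P) h
  exact ⟨AddEquiv.toMultiplicativeRight e⟩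

theorem nonempty_cyc_or_plane {P : Type*} [Group P] (h : Nat.card P = p ^ 2) :
    Nonempty (P ≃* Cyc (p ^ 2)) ∨ Nonempty (P ≃* Plane p) := by
  by_cases hc : IsCyclic P
  · exact Or.inl (nonempty_mulEquiv_cyc_of_card h)
  · right
    have : Finite P := Nat.finite_of_card_ne_zero (by
      rw [h]
      exact pow_ne_zero 2 (Fact.out : p.Prime).ne_zero)
    let _ : CommGroup P := IsPGroup.commGroupOfCardEqPrimeSq h
    refine nonempty_plane_of_pow_eq_one h fun x => ?_
    have h1 := orderOf_dvd_natCard x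
    rw [h] at h1
    obtain ⟨k, hk, h2⟩ := (Nat.dvd_prime_pow Fact.out).mp h1
    have h3 : k ≠ 2 := by
      rintro rfl
      exact hc (isCyclic_of_orderOf_eq_card x (h2.trans h.symm))
    rw [← orderOf_dvd_iff_pow_eq_one, h2]
    exact (pow_dvd_pow p (by omega : k ≤ 1)).trans (pow_one p).dvd

theorem nonempty_semidirect_of_normal {N K : Subgroup G} [N.Normal] [Finite G]
    (hcard : Nat.card N * Nat.card K = Nat.card G) (h : (Nat.card N).Coprime (Nat.card K))
    {N' K' : Type*} [Group N'] [Group K'] (e : N ≃* N') (f : K ≃* K') :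
    ∃ φ : K' →* MulAut N', Nonempty (G ≃* N' ⋊[φ] K') :=
  ⟨_, ⟨(SemidirectProduct.mulEquivSubgroup
    (Subgroup.isComplement'_of_coprime hcard h)).symm.trans (SemidirectProduct.congr' e f)⟩⟩

end Sylow

/-- The images of the two standard generators are killed by p in a cyclic group, so one is a power
of the other. A swap or a shear of C_p × C_p then makes the first coordinate act trivially, which
splits off the direct factor in type 11. -/
theorem exists_factor_snd {A : Type*} [Group A] [Finite A] [IsCyclic A]
    (φ : Cyc p × Cyc p →* A) : ∃ (β : MulAut (Cyc p × Cyc p)) (χ : Cyc p →* A),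
      ∀ x, χ (β x).2 = φ x := by
  have hpow : ∀ x : Cyc p × Cyc p, φ x ^ p = 1 := fun x => by
    have h1 : ∀ y : Cyc p, y ^ p = 1 := fun y => by
      have := pow_card_eq_one' (x := y)
      rwa [card_cyc] at this
    rw [← map_pow]
    have : x ^ p = 1 := Prod.ext (h1 x.1) (h1 x.2)
    rw [this, map_one]
  have hsplit : ∀ x : Cyc p × Cyc p, φ x = φ (1, x.2) * φ (x.1, 1) := fun x => by
    rw [← map_mul]
    simp
  by_cases hb : φ (1, cgen p) = 1
  · refine ⟨MulEquiv.prodComm, φ.comp (MonoidHom.inl _ _), fun x => ?_⟩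
    have h1 : φ.comp (MonoidHom.inr _ _) = 1 := cyc_hom_ext hb
    have h2 : φ (1, x.2) = 1 := DFunLike.congr_fun h1 x.2
    rw [hsplit x, h2, one_mul]
    rfl
  · obtain ⟨k, hk⟩ := exists_pow_eq_of_pow_eq_one (q := p) (hpow (cgen p, 1)) (hpow (1, cgen p)) hb
    refine ⟨{ toFun := fun x => (x.1, x.2 * x.1 ^ k)
              invFun := fun x => (x.1, x.2 * (x.1 ^ k)⁻¹)
              left_inv := fun x => by simp
              right_inv := fun x => by simp
              map_mul' := fun x y => by
                ext1
                · rfl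
                · simp only [Prod.snd_mul, Prod.fst_mul, mul_pow]
                  exact mul_mul_mul_comm _ _ _ _ }, φ.comp (MonoidHom.inr _ _), fun x => ?_⟩
    have h1 : φ.comp ((MonoidHom.inr _ _).comp (powMonoidHom k)) = φ.comp (MonoidHom.inl _ _) := by
      apply cyc_hom_ext
      change φ (1, cgen p ^ k) = φ (cgen p, 1)
      rw [hk, ← map_pow φ]
      exact congrArg φ (Prod.ext (one_pow k).symm rfl)
    have h2 : φ (1, x.1 ^ k) = φ (x.1, 1) := DFunLike.congr_fun h1 x.1
    change φ (1, x.2 * x.1 ^ k) = φ x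
    rw [hsplit x, ← h2, ← map_mul, Prod.mk_mul_mk, one_mul]

theorem IsPlaneSemidirect.mono {q : ℕ} {Q R : GL (Fin 2) (ZMod p) → Prop} {G : Type*} [Group G]
    (h : ∀ Z, Z ^ q = 1 → Q Z → R Z) : IsPlaneSemidirect p q Q G → IsPlaneSemidirect p q R G :=
  fun ⟨φ, hφ, e⟩ => ⟨φ, h _ (map_cgen_pow φ) hφ, e⟩

theorem exists_isOfType_of_sylow_left {G : Type*} [Group G] (hpq : p ≠ q)
    (hG : Nat.card G = p ^ 2 * q) (P : Sylow p G) (hP : (P : Subgroup G).Normal) :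
    ∃ t, IsOfType p q t G := by
  have := finite_of_card_eq hG
  let Q : Sylow q G := default
  have hPc : Nat.card (P : Subgroup G) = p ^ 2 := card_sylow_left hpq hG P
  have hQc : Nat.card (Q : Subgroup G) = q := card_sylow_right hpq hG Q
  have := isCyclic_of_prime_card hQc
  obtain ⟨f⟩ := nonempty_mulEquiv_cyc_of_card hQc
  have hcard : Nat.card (P : Subgroup G) * Nat.card (Q : Subgroup G) = Nat.card G := by
    rw [hPc, hQc, hG]
  have hcop : (Nat.card (P : Subgroup G)).Coprime (Nat.card (Q : Subgroup G)) := by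
    rw [hPc, hQc]
    exact coprime_sq hpq
  rcases nonempty_cyc_or_plane hPc with ⟨⟨e⟩⟩ | ⟨⟨e⟩⟩
  · obtain ⟨φ, ⟨g⟩⟩ := nonempty_semidirect_of_normal hcard hcop e f
    by_cases h : φ = 1
    · subst h
      exact ⟨.t1, ⟨g.trans SemidirectProduct.mulEquivProd⟩⟩
    · exact ⟨.t4, φ, h, ⟨g⟩⟩
  · obtain ⟨φ, ⟨g⟩⟩ := nonempty_semidirect_of_normal hcard hcop e f
    rcases exists_planeSemidirect hpq φ g with h | h | h | h | h | h
    · exact ⟨.t5, isOfType_five_iff.mpr h⟩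
    · exact ⟨.t6, isOfType_six_iff.mpr h⟩
    · exact ⟨.t7, h⟩
    · exact ⟨.t8, h⟩
    · exact ⟨.t9, h⟩
    · exact ⟨.t10, h⟩

/-- For a cyclic Sylow p-subgroup the order 1, p or p² of the action on C_q gives types 1, 2 and 3.
For an elementary abelian one a trivial action gives type 5 and any other type 11. -/
theorem exists_isOfType_of_sylow_right {G : Type*} [Group G] (hpq : p ≠ q)
    (hG : Nat.card G = p ^ 2 * q) (Q : Sylow q G) (hQ : (Q : Subgroup G).Normal) :
    ∃ t, IsOfType p q t G := by
  have := finite_of_card_eq hG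
  let P : Sylow p G := default
  have hPc : Nat.card (P : Subgroup G) = p ^ 2 := card_sylow_left hpq hG P
  have hQc : Nat.card (Q : Subgroup G) = q := card_sylow_right hpq hG Q
  have := isCyclic_of_prime_card hQc
  obtain ⟨f⟩ := nonempty_mulEquiv_cyc_of_card hQc
  have hcard : Nat.card (Q : Subgroup G) * Nat.card (P : Subgroup G) = Nat.card G := by
    rw [hPc, hQc, hG, mul_comm]
  have hcop : (Nat.card (Q : Subgroup G)).Coprime (Nat.card (P : Subgroup G)) := by
    rw [hPc, hQc]
    exact (coprime_sq hpq).symm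
  rcases nonempty_cyc_or_plane hPc with ⟨⟨e⟩⟩ | ⟨⟨e⟩⟩
  · obtain ⟨φ, ⟨g⟩⟩ := nonempty_semidirect_of_normal hcard hcop f e
    have h1 : orderOf (φ (cgen _)) ∣ p ^ 2 := orderOf_dvd_of_pow_eq_one (map_cgen_pow φ)
    obtain ⟨k, hk, h2⟩ := (Nat.dvd_prime_pow Fact.out).mp h1
    interval_cases k
    · rw [pow_zero, orderOf_eq_one_iff] at h2
      obtain rfl := (map_eq_one_iff_orderOf φ).mpr h2
      exact ⟨.t1, ⟨(g.trans SemidirectProduct.mulEquivProd).trans MulEquiv.prodComm⟩⟩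
    · rw [pow_one] at h2
      exact ⟨.t2, φ, (card_center_eq_prime_iff φ).mpr h2, ⟨g⟩⟩
    · exact ⟨.t3, φ, (center_eq_bot_iff φ).mpr h2, ⟨g⟩⟩
  · obtain ⟨φ, ⟨g⟩⟩ := nonempty_semidirect_of_normal hcard hcop f (e.trans (planeProd p))
    by_cases h : φ = 1
    · subst h
      exact ⟨.t5, ⟨((g.trans SemidirectProduct.mulEquivProd).trans MulEquiv.prodComm).trans
        MulEquiv.prodAssoc⟩⟩
    · obtain ⟨β, χ, hχ⟩ := exists_factor_snd φ
      refine ⟨.t11, χ, fun h1 => h ?_, ⟨(g.trans (SemidirectProduct.congr (MulEquiv.refl _) β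
        fun k => ?_)).trans (prodSemidirect (Cyc p) χ).symm⟩⟩
      · refine MonoidHom.ext fun x => ?_
        rw [← hχ, h1]
        rfl
      · rw [← hχ]
        rfl

end

/-! ### Invariants and disjointness of the types -/

/-- The elements killed by `n` are closed under multiplication. -/
def PowClosed (G : Type*) [Group G] (n : ℕ) : Prop :=
  ∀ x y : G, x ^ n = 1 → y ^ n = 1 → (x * y) ^ n = 1

theorem PowClosed.of_mulEquiv {G H : Type*} [Group G] [Group H] (e : G ≃* H) {n : ℕ}
    (h : PowClosed H n) : PowClosed G n := fun x y hx hy => by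
  apply e.injective
  rw [map_pow, map_mul, map_one]
  exact h _ _ (by rw [← map_pow, hx, map_one]) (by rw [← map_pow, hy, map_one])

theorem exists_orderOf_of_mulEquiv {G H : Type*} [Group G] [Group H] (e : G ≃* H) {n : ℕ}
    (h : ∃ x : H, orderOf x = n) : ∃ x : G, orderOf x = n := by
  obtain ⟨x, hx⟩ := h
  exact ⟨e.symm x, by rw [MulEquiv.orderOf_eq, hx]⟩

section Semidirect

open SemidirectProduct

variable {G N K : Type*} [Group G] [CommGroup N] [CommGroup K] {φ : K →* MulAut N}

theorem powClosed_kernel [Finite N] [Finite K] (h : (Nat.card N).Coprime (Nat.card K))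
    (e : G ≃* N ⋊[φ] K) : PowClosed G (Nat.card N) :=
  PowClosed.of_mulEquiv e fun x y => by
    rw [← right_eq_one_iff_pow_card h, ← right_eq_one_iff_pow_card h,
      ← right_eq_one_iff_pow_card h]
    intro hx hy
    rw [mul_right, hx, hy, one_mul]

theorem powClosed_complement_iff [Finite N] [Finite K] (h : (Nat.card N).Coprime (Nat.card K))
    (e : G ≃* N ⋊[φ] K) : PowClosed G (Nat.card K) ↔ φ = 1 := by
  refine ⟨fun hc => trivial_of_pow_card_closed h (PowClosed.of_mulEquiv e.symm hc), ?_⟩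
  rintro rfl
  refine PowClosed.of_mulEquiv (e.trans mulEquivProd) fun x y hx hy => ?_
  rw [mul_pow, hx, hy, one_mul]

/-- The b-th power of any element lies in N, where a kills it, so every order divides pq; but p²
does not divide pq. -/
theorem not_exists_orderOf_sq {p q a b : ℕ} [Fact p.Prime] [Fact q.Prime] (hpq : p ≠ q)
    (e : G ≃* N ⋊[φ] K) (hN : ∀ n : N, n ^ a = 1) (hK : ∀ k : K, k ^ b = 1) (hab : b * a = p * q) :
    ¬ ∃ x : G, orderOf x = p ^ 2 := by
  rintro ⟨x, hx⟩
  have h1 : x ^ (p * q) = 1 := by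
    apply e.injective
    have h2 : e x ^ b = inl (e x ^ b).left := by
      ext
      · rw [left_inl]
      · rw [right_inl, ← rightHom_eq_right, map_pow, hK]
    rw [map_pow, ← hab, pow_mul, h2, ← map_pow, hN, map_one, map_one]
  have h2 := orderOf_dvd_of_pow_eq_one h1
  rw [hx, sq] at h2
  exact hpq ((Nat.prime_dvd_prime_iff_eq Fact.out Fact.out).mp
    (Nat.dvd_of_mul_dvd_mul_left (Fact.out : p.Prime).pos h2))

end Semidirect

section Types

variable {p q : ℕ} [Fact p.Prime] [Fact q.Prime]

theorem comp_glAct_eq_one_iff {φ : Cyc q →* GL (Fin 2) (ZMod p)} :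
    (glAct p).comp φ = 1 ↔ φ (cgen q) = 1 := by
  rw [map_eq_one_iff_orderOf, MonoidHom.comp_apply, map_eq_one_iff _ glAct_bijective.1]

theorem plane_pow_eq_one (n : Plane p) : n ^ p = 1 := by
  apply Multiplicative.toAdd.injective
  rw [toAdd_pow, toAdd_one]
  ext i
  simp

theorem IsPlaneSemidirect.invariants (hpq : p ≠ q) {Q : GL (Fin 2) (ZMod p) → Prop} {G : Type*}
    [Group G] (h : IsPlaneSemidirect p q Q G) :
    (¬ ∃ x : G, orderOf x = p ^ 2) ∧ PowClosed G (p ^ 2) ∧ ((∀ Z, Q Z → Z = 1) → PowClosed G q) ∧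
      ((∀ Z, Q Z → Z ≠ 1) → ¬ PowClosed G q) := by
  obtain ⟨φ, hφ, ⟨e⟩⟩ := h
  have hcop : (Nat.card (Plane p)).Coprime (Nat.card (Cyc q)) := by
    rw [card_plane, card_cyc]
    exact coprime_sq hpq
  have h1 := powClosed_kernel hcop e
  have h2 := powClosed_complement_iff hcop e
  rw [card_plane] at h1
  rw [card_cyc, comp_glAct_eq_one_iff] at h2
  refine ⟨not_exists_orderOf_sq hpq e plane_pow_eq_one (fun k => ?_) (mul_comm q p), h1,
    fun h => h2.mpr (h _ hφ), fun h h3 => h _ hφ (h2.mp h3)⟩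
  simpa [card_cyc] using pow_card_eq_one' (x := k)

/-- Whether groups of a given type have elements of order `p ^ 2`, and whether their elements
of order dividing `p ^ 2`, respectively `q`, form a subgroup. -/
def signature : TypeLabel → Bool × Bool × Bool
  | .t1 => (true, true, true)
  | .t2 => (true, false, true)
  | .t3 => (true, false, true)
  | .t4 => (true, true, false)
  | .t5 => (false, true, true)
  | .t6 => (false, true, false)
  | .t7 => (false, true, false)
  | .t8 => (false, true, false)
  | .t9 => (false, true, false)
  | .t10 => (false, true, false)
  | .t11 => (false, false, true)

theorem exists_orderOf_cyc_semidirect_left {n : ℕ} {K G : Type*} [Group K] [Group G]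
    {φ : K →* MulAut (Cyc n)} (e : G ≃* Cyc n ⋊[φ] K) : ∃ x : G, orderOf x = n :=
  exists_orderOf_of_mulEquiv e ⟨SemidirectProduct.inl (cgen n), by
    rw [orderOf_injective _ SemidirectProduct.inl_injective, orderOf_cgen]⟩

theorem exists_orderOf_cyc_semidirect_right {n : ℕ} {N G : Type*} [Group N] [Group G]
    {φ : Cyc n →* MulAut N} (e : G ≃* N ⋊[φ] Cyc n) : ∃ x : G, orderOf x = n :=
  exists_orderOf_of_mulEquiv e ⟨SemidirectProduct.inr (cgen n), by
    rw [orderOf_injective _ SemidirectProduct.inr_injective, orderOf_cgen]⟩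

theorem invariants_cyc_sq_kernel (hpq : p ≠ q) {G : Type*} [Group G]
    {φ : Cyc q →* MulAut (Cyc (p ^ 2))} (e : G ≃* Cyc (p ^ 2) ⋊[φ] Cyc q) :
    (∃ x : G, orderOf x = p ^ 2) ∧ PowClosed G (p ^ 2) ∧ (PowClosed G q ↔ φ = 1) := by
  have hcop : (Nat.card (Cyc (p ^ 2))).Coprime (Nat.card (Cyc q)) := by
    rw [card_cyc, card_cyc]
    exact coprime_sq hpq
  have h1 := powClosed_kernel hcop e
  have h2 := powClosed_complement_iff hcop e
  rw [card_cyc] at h1 h2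
  exact ⟨exists_orderOf_cyc_semidirect_left e, h1, h2⟩

theorem invariants_cyc_sq_complement (hpq : p ≠ q) {G : Type*} [Group G]
    {φ : Cyc (p ^ 2) →* MulAut (Cyc q)} (e : G ≃* Cyc q ⋊[φ] Cyc (p ^ 2)) :
    (∃ x : G, orderOf x = p ^ 2) ∧ (PowClosed G (p ^ 2) ↔ φ = 1) ∧ PowClosed G q := by
  have hcop : (Nat.card (Cyc q)).Coprime (Nat.card (Cyc (p ^ 2))) := by
    rw [card_cyc, card_cyc]
    exact (coprime_sq hpq).symm
  have h1 := powClosed_kernel hcop e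
  have h2 := powClosed_complement_iff hcop e
  rw [card_cyc] at h1 h2
  exact ⟨exists_orderOf_cyc_semidirect_right e, h2, h1⟩

theorem invariants_cyc_prod (hpq : p ≠ q) {G : Type*} [Group G] {φ : Cyc p →* MulAut (Cyc q)}
    (hφ : φ ≠ 1) (e : G ≃* Cyc p × (Cyc q ⋊[φ] Cyc p)) :
    (¬ ∃ x : G, orderOf x = p ^ 2) ∧ ¬ PowClosed G (p ^ 2) ∧ PowClosed G q := by
  have hcop : (Nat.card (Cyc q)).Coprime (Nat.card (Cyc p × Cyc p)) := by
    rw [Nat.card_prod, card_cyc, card_cyc, ← sq]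
    exact (coprime_sq hpq).symm
  let f := e.trans (prodSemidirect (Cyc p) φ)
  have h1 := powClosed_kernel hcop f
  have h2 := powClosed_complement_iff hcop f
  rw [card_cyc] at h1
  rw [Nat.card_prod, card_cyc, ← sq] at h2
  have hpow : ∀ (n : ℕ) (x : Cyc n), x ^ n = 1 := fun n x => by
    simpa [card_cyc] using pow_card_eq_one' (x := x)
  refine ⟨not_exists_orderOf_sq hpq f (hpow q) (fun k => Prod.ext (hpow p _) (hpow p _)) rfl,
    fun h => hφ ?_, h1⟩
  exact MonoidHom.ext fun k => DFunLike.congr_fun (h2.mp h) (1, k)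

theorem kindF_ne_one (Z : GL (Fin 2) (ZMod p)) (h : KindF Z) : Z ≠ 1 := by
  rintro rfl
  exact h.props.2 ⟨1, by simp⟩

theorem kindD_ne_one (Z : GL (Fin 2) (ZMod p)) (h : KindD Z) : Z ≠ 1 := by
  rintro rfl
  exact h.props.2.1 ⟨1, by simp⟩

theorem kindC_ne_one (Z : GL (Fin 2) (ZMod p)) (h : KindC Z) : Z ≠ 1 := by
  rintro rfl
  exact h.2 ⟨1, by simp⟩

theorem IsOfType.invariants (hpq : p ≠ q) {G : Type*} [Group G] {t : TypeLabel}
    (h : IsOfType p q t G) :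
    ((∃ x : G, orderOf x = p ^ 2) ↔ (signature t).1 = true) ∧
      (PowClosed G (p ^ 2) ↔ (signature t).2.1 = true) ∧
      (PowClosed G q ↔ (signature t).2.2 = true) := by
  have hp1 := (Fact.out : p.Prime).one_lt
  have hplane : ∀ Q : GL (Fin 2) (ZMod p) → Prop, (∀ Z, Q Z → Z ≠ 1) →
      IsPlaneSemidirect p q Q G → ((∃ x : G, orderOf x = p ^ 2) ↔ false = true) ∧
        (PowClosed G (p ^ 2) ↔ true = true) ∧ (PowClosed G q ↔ false = true) := fun Q hQ h => by
    obtain ⟨h1, h2, -, h3⟩ := h.invariants hpq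
    have h4 := h3 hQ
    tauto
  cases t with
  | t1 =>
    obtain ⟨e⟩ := h
    obtain ⟨h1, h2, h3⟩ :=
      invariants_cyc_sq_kernel hpq (e.trans SemidirectProduct.mulEquivProd.symm)
    simp [signature, h1, h2, h3]
  | t2 =>
    obtain ⟨φ, hφ, ⟨e⟩⟩ := h
    obtain ⟨h1, h2, h3⟩ := invariants_cyc_sq_complement hpq e
    have h4 : φ ≠ 1 := ne_one_of_one_lt_orderOf (by
      rwa [(card_center_eq_prime_iff φ).mp hφ])
    simp only [signature, h1, h2, h3, h4]
    tauto
  | t3 =>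
    obtain ⟨φ, hφ, ⟨e⟩⟩ := h
    obtain ⟨h1, h2, h3⟩ := invariants_cyc_sq_complement hpq e
    have h4 : φ ≠ 1 := ne_one_of_one_lt_orderOf (by
      rw [(center_eq_bot_iff φ).mp hφ]
      exact Nat.one_lt_pow two_ne_zero hp1)
    simp only [signature, h1, h2, h3, h4]
    tauto
  | t4 =>
    obtain ⟨φ, hφ, ⟨e⟩⟩ := h
    obtain ⟨h1, h2, h3⟩ := invariants_cyc_sq_kernel hpq e
    simp only [signature, h1, h2, h3, hφ]
    tauto
  | t5 =>
    obtain ⟨h1, h2, h3, -⟩ := (isOfType_five_iff.mp h).invariants hpq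
    have h4 := h3 fun _ => id
    simp only [signature]
    tauto
  | t6 => exact hplane _ kindF_ne_one (isOfType_six_iff.mp h)
  | t7 => exact hplane _ (fun _ h => h.2) h
  | t8 => exact hplane _ (fun Z h => kindD_ne_one Z h.1) h
  | t9 => exact hplane _ (fun Z h => kindD_ne_one Z h.1) h
  | t10 => exact hplane _ kindC_ne_one h
  | t11 =>
    obtain ⟨φ, hφ, ⟨e⟩⟩ := h
    obtain ⟨h1, h2, h3⟩ := invariants_cyc_prod hpq hφ e
    simp only [signature]
    tauto

theorem signature_eq (hpq : p ≠ q) {G : Type*} [Group G] {t t' : TypeLabel}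
    (h : IsOfType p q t G) (h' : IsOfType p q t' G) : signature t = signature t' := by
  obtain ⟨h1, h2, h3⟩ := h.invariants hpq
  obtain ⟨h1', h2', h3'⟩ := h'.invariants hpq
  exact Prod.ext (Bool.eq_iff_iff.mpr (h1.symm.trans h1'))
    (Prod.ext (Bool.eq_iff_iff.mpr (h2.symm.trans h2')) (Bool.eq_iff_iff.mpr (h3.symm.trans h3')))

/-- Properties, invariant under conjugation and passage to generators of the same cyclic group,
of the matrices in a group of a given type. -/
def matrixInvariant (t : TypeLabel) (Z : GL (Fin 2) (ZMod p)) : Prop :=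
  match t with
  | .t6 => HasFix Z ∧ HasEig Z ∧ ¬ IsScalarMat Z
  | .t7 => ¬ HasFix Z ∧ HasEig Z ∧ IsScalarMat Z
  | .t8 => ¬ HasFix Z ∧ HasEig Z ∧ ¬ IsScalarMat Z ∧
    (Z : Matrix (Fin 2) (Fin 2) (ZMod p)).det ≠ 1
  | .t9 => ¬ HasFix Z ∧ HasEig Z ∧ ¬ IsScalarMat Z ∧
    (Z : Matrix (Fin 2) (Fin 2) (ZMod p)).det = 1
  | .t10 => ¬ HasEig Z
  | _ => False

theorem isPlaneSemidirect_matrixInvariant (hpq : p ≠ q) {G : Type*} [Group G] {t : TypeLabel}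
    (h : IsOfType p q t G) (ht : signature t = (false, true, false)) :
    IsPlaneSemidirect p q (matrixInvariant t) G := by
  cases t with
  | t6 =>
    exact (isOfType_six_iff.mp h).mono fun Z _ hZ => ⟨hZ.props.1, hZ.props.1.hasEig, hZ.props.2⟩
  | t7 => exact IsPlaneSemidirect.mono (fun Z _ hZ => ⟨hZ.props.1, hZ.props.2.hasEig, hZ.props.2⟩) h
  | t8 =>
    exact IsPlaneSemidirect.mono
      (fun Z _ hZ => ⟨hZ.1.props.1, hZ.1.props.2.2, hZ.1.props.2.1, hZ.2⟩) h
  | t9 =>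
    exact IsPlaneSemidirect.mono
      (fun Z _ hZ => ⟨hZ.1.props.1, hZ.1.props.2.2, hZ.1.props.2.1, hZ.2⟩) h
  | t10 => exact IsPlaneSemidirect.mono (fun Z hZq hZ => (kindC_iff hpq hZq).mp hZ) h
  | _ => exact absurd ht (by decide)

theorem eq_of_matrixInvariant {t t' : TypeLabel} {Z Z' : GL (Fin 2) (ZMod p)}
    (h : matrixInvariant t Z) (h' : matrixInvariant t' Z')
    (h1 : ∃ (P : GL (Fin 2) (ZMod p)) (k : ℕ), P * Z * P⁻¹ = Z' ^ k)
    (h2 : ∃ (P : GL (Fin 2) (ZMod p)) (k : ℕ), P * Z' * P⁻¹ = Z ^ k) : t = t' := by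
  obtain ⟨P, k, hP⟩ := h1
  obtain ⟨P', k', hP'⟩ := h2
  have hF : HasFix Z ↔ HasFix Z' := ⟨HasFix.of_conj hP', HasFix.of_conj hP⟩
  have hE : HasEig Z ↔ HasEig Z' := ⟨HasEig.of_conj hP', HasEig.of_conj hP⟩
  have hS : IsScalarMat Z ↔ IsScalarMat Z' := ⟨IsScalarMat.of_conj hP', IsScalarMat.of_conj hP⟩
  have hD : (Z : Matrix (Fin 2) (Fin 2) (ZMod p)).det = 1 ↔
      (Z' : Matrix (Fin 2) (Fin 2) (ZMod p)).det = 1 :=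
    ⟨det_eq_one_of_conj hP', det_eq_one_of_conj hP⟩
  have hEE := HasFix.hasEig (Z := Z')
  clear hP hP'
  cases t <;> try exact h.elim
  all_goals
    simp only [matrixInvariant, ne_eq, hF, hE, hS, hD] at h
    clear hF hE hS hD
    cases t' <;> first
      | exact h'.elim
      | rfl
      | (exfalso; simp only [matrixInvariant, ne_eq] at h'; tauto)

/-- The signature leaves only two ambiguities. Types 2 and 3 differ in the order of the centre, and
types 6 to 10 are told apart by `matrixInvariant`. -/
theorem IsOfType.unique (hpq : p ≠ q) {G : Type*} [Group G] {t t' : TypeLabel}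
    (h : IsOfType p q t G) (h' : IsOfType p q t' G) : t = t' := by
  have hs := signature_eq hpq h h'
  have hcenter : IsOfType p q .t2 G → IsOfType p q .t3 G → False := by
    rintro ⟨φ, hφ, ⟨e⟩⟩ ⟨ψ, hψ, ⟨e'⟩⟩
    have h1 := Nat.card_congr (Subgroup.centerCongr (e.symm.trans e')).toEquiv
    rw [hφ, hψ, Subgroup.card_bot] at h1
    exact (Fact.out : p.Prime).one_lt.ne' h1
  by_cases ht : signature t = (false, true, false)
  · by_contra hne
    exact isPlaneSemidirect_exclusive hpq
      (fun Z Z' _ _ hZ hZ' h1 h2 => hne (eq_of_matrixInvariant hZ hZ' h1 h2))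
      (isPlaneSemidirect_matrixInvariant hpq h ht)
      (isPlaneSemidirect_matrixInvariant hpq h' (hs ▸ ht))
  · cases t <;> cases t' <;> first
      | rfl
      | exact absurd hs (by decide)
      | exact absurd rfl ht
      | exact (hcenter h h').elim
      | exact (hcenter h' h).elim

end Types

/-! ### Arithmetic conditions, orders and assembly of the results -/

section Conditions

variable {p q : ℕ} [Fact p.Prime] [Fact q.Prime]

theorem dvd_sub_one_of_hom_ne_one {φ : Cyc q →* MulAut (Cyc p)} (h : φ ≠ 1) : q ∣ p - 1 := by
  rw [← card_mulAut_cyc_prime p, ← orderOf_map_cgen_of_ne_one h]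
  exact orderOf_dvd_natCard _

theorem condition_of_isOfType (hpq : p ≠ q) {G : Type*} [Group G] {t : TypeLabel}
    (h : IsOfType p q t G) : Condition p q t := by
  cases t with
  | t1 => trivial
  | t2 =>
    obtain ⟨φ, hφ, -⟩ := h
    have h1 := orderOf_dvd_natCard (φ (cgen _))
    rwa [(card_center_eq_prime_iff φ).mp hφ, card_mulAut_cyc_prime] at h1
  | t3 =>
    obtain ⟨φ, hφ, -⟩ := h
    have h1 := orderOf_dvd_natCard (φ (cgen _))
    rwa [(center_eq_bot_iff φ).mp hφ, card_mulAut_cyc_prime] at h1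
  | t4 =>
    obtain ⟨φ, hφ, -⟩ := h
    have h1 := orderOf_dvd_natCard (φ (cgen _))
    rw [orderOf_map_cgen_of_ne_one hφ, card_mulAut_cyc_sq] at h1
    exact Nat.Coprime.dvd_of_dvd_mul_left
      ((Nat.coprime_primes Fact.out Fact.out).mpr hpq.symm) h1
  | t5 => trivial
  | t6 =>
    obtain ⟨φ, hφ, -⟩ := h
    exact dvd_sub_one_of_hom_ne_one hφ
  | t7 =>
    obtain ⟨φ, hφ, -⟩ := h
    obtain ⟨u, hu, h1⟩ := kindS_iff.mp hφ
    exact dvd_sub_one_of_pow_eq_one (diagGL_pow_eq_one h1).1 hu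
  | t8 =>
    obtain ⟨φ, hφ, -⟩ := h
    exact condition_of_kindD0 hφ
  | t9 =>
    obtain ⟨φ, hφ, -⟩ := h
    exact condition_of_kindD1 hφ
  | t10 =>
    obtain ⟨χ, hχ, -⟩ := exists_field_semidirect hpq h
    exact condition_of_field hpq hχ
  | t11 =>
    obtain ⟨φ, hφ, -⟩ := h
    exact dvd_sub_one_of_hom_ne_one hφ

theorem exists_hom_ne_one (h : q ∣ p - 1) : ∃ φ : Cyc q →* MulAut (Cyc p), φ ≠ 1 := by
  rw [← card_mulAut_cyc_prime p] at h
  obtain ⟨φ, hφ⟩ := exists_hom_orderOf_eq dvd_rfl h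
  exact ⟨φ, ne_one_of_one_lt_orderOf (hφ.symm ▸ (Fact.out : q.Prime).one_lt)⟩

/-- The divisibility conditions provide elements of the required order in the relevant cyclic group
of automorphisms or units. `ULift` moves the models to an arbitrary universe. -/
theorem exists_isOfType_of_condition (hpq : p ≠ q) {t : TypeLabel} (h : Condition p q t) :
    ∃ (G : Type u) (_ : Group G), IsOfType p q t G := by
  cases t with
  | t1 => exact ⟨ULift (Cyc (p ^ 2) × Cyc q), inferInstance, ⟨MulEquiv.ulift⟩⟩
  | t2 =>
    obtain ⟨φ, hφ⟩ := exists_hom_orderOf_eq (A := MulAut (Cyc q)) (dvd_pow_self p two_ne_zero)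
      (by rw [card_mulAut_cyc_prime]; exact h)
    exact ⟨ULift (Cyc q ⋊[φ] Cyc (p ^ 2)), inferInstance, φ, (card_center_eq_prime_iff φ).mpr hφ,
      ⟨MulEquiv.ulift⟩⟩
  | t3 =>
    obtain ⟨φ, hφ⟩ := exists_hom_orderOf_eq (A := MulAut (Cyc q)) (dvd_refl (p ^ 2))
      (by rw [card_mulAut_cyc_prime]; exact h)
    exact ⟨ULift (Cyc q ⋊[φ] Cyc (p ^ 2)), inferInstance, φ, (center_eq_bot_iff φ).mpr hφ,
      ⟨MulEquiv.ulift⟩⟩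
  | t4 =>
    obtain ⟨φ, hφ⟩ := exists_hom_orderOf_eq (A := MulAut (Cyc (p ^ 2))) (dvd_refl q)
      (by rw [card_mulAut_cyc_sq]; exact dvd_mul_of_dvd_right h p)
    exact ⟨ULift (Cyc (p ^ 2) ⋊[φ] Cyc q), inferInstance, φ,
      ne_one_of_one_lt_orderOf (hφ.symm ▸ (Fact.out : q.Prime).one_lt), ⟨MulEquiv.ulift⟩⟩
  | t5 => exact ⟨ULift (Cyc p × Cyc p × Cyc q), inferInstance, ⟨MulEquiv.ulift⟩⟩
  | t6 =>
    obtain ⟨φ, hφ⟩ := exists_hom_ne_one h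
    exact ⟨ULift (Cyc p × (Cyc p ⋊[φ] Cyc q)), inferInstance, φ, hφ, ⟨MulEquiv.ulift⟩⟩
  | t7 =>
    obtain ⟨u, hu⟩ := exists_unit_orderOf h
    have huq : u ^ q = 1 := orderOf_dvd_iff_pow_eq_one.mp hu.dvd
    have hu1 : u ≠ 1 := fun h1 => (Fact.out : q.Prime).one_lt.ne (by rw [← hu, h1, orderOf_one])
    obtain ⟨φ, hφ⟩ := exists_hom_diagGL huq huq
    exact ⟨ULift (Plane p ⋊[(glAct p).comp φ] Cyc q), inferInstance, φ,
      kindS_iff.mpr ⟨u, hu1, hφ⟩, ⟨MulEquiv.ulift⟩⟩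
  | t8 =>
    obtain ⟨hq3, hqp⟩ := h
    obtain ⟨F, hF, h1, -⟩ := exists_family_kindD0.{u} hpq hq3 hqp
    -- A prime q > 3 is odd, hence at least 5, so the family of type 8 is not empty.
    have hpos : 0 < (q - 3) / 2 := by
      have hodd := (Fact.out : q.Prime).eq_two_or_odd
      omega
    exact ⟨F ⟨0, hpos⟩, hF _, h1 _⟩
  | t9 =>
    obtain ⟨hq2, hqp⟩ := h
    obtain ⟨u, hu⟩ := exists_unit_orderOf hqp
    have huq : u ^ q = 1 := orderOf_dvd_iff_pow_eq_one.mp hu.dvd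
    have hu1 : u ≠ 1 := fun h1 => by
      rw [h1, orderOf_one] at hu
      omega
    have hu2 : u ≠ u⁻¹ := fun h1 => by
      have h2 := orderOf_le_of_pow_eq_one two_pos
        (show u ^ 2 = 1 by rw [sq]; nth_rw 2 [h1]; exact mul_inv_cancel u)
      omega
    obtain ⟨φ, hφ⟩ := exists_hom_diagGL huq (show u⁻¹ ^ q = 1 by rw [inv_pow, huq, inv_one])
    exact ⟨ULift (Plane p ⋊[(glAct p).comp φ] Cyc q), inferInstance, φ,
      kindD1_iff.mpr ⟨u, hu2, hu1, hφ⟩, ⟨MulEquiv.ulift⟩⟩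
  | t10 =>
    obtain ⟨φ, hφ⟩ := exists_hom_kindC h.1 h.2
    exact ⟨ULift (Plane p ⋊[(glAct p).comp φ] Cyc q), inferInstance, φ, hφ, ⟨MulEquiv.ulift⟩⟩
  | t11 =>
    obtain ⟨φ, hφ⟩ := exists_hom_ne_one h
    exact ⟨ULift (Cyc p × (Cyc q ⋊[φ] Cyc p)), inferInstance, φ, hφ, ⟨MulEquiv.ulift⟩⟩

theorem IsPlaneSemidirect.card {q : ℕ} {Q : GL (Fin 2) (ZMod p) → Prop} {G : Type*} [Group G]
    (h : IsPlaneSemidirect p q Q G) : Nat.card G = p ^ 2 * q := by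
  obtain ⟨φ, -, ⟨e⟩⟩ := h
  rw [Nat.card_congr e.toEquiv, SemidirectProduct.card, card_plane, card_cyc]

theorem IsOfType.card {G : Type*} [Group G] {t : TypeLabel} (h : IsOfType p q t G) :
    Nat.card G = p ^ 2 * q := by
  cases t with
  | t1 =>
    obtain ⟨e⟩ := h
    rw [Nat.card_congr e.toEquiv, Nat.card_prod, card_cyc, card_cyc]
  | t2 | t3 =>
    obtain ⟨φ, -, ⟨e⟩⟩ := h
    rw [Nat.card_congr e.toEquiv, card_cyc_semidirect, mul_comm]
  | t4 =>
    obtain ⟨φ, -, ⟨e⟩⟩ := h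
    rw [Nat.card_congr e.toEquiv, card_cyc_semidirect]
  | t5 => exact (isOfType_five_iff.mp h).card
  | t6 => exact (isOfType_six_iff.mp h).card
  | t7 | t8 | t9 | t10 => exact IsPlaneSemidirect.card h
  | t11 =>
    obtain ⟨φ, -, ⟨e⟩⟩ := h
    rw [Nat.card_congr e.toEquiv, Nat.card_prod, card_cyc_semidirect, card_cyc]
    ring

theorem nonempty_mulAut_congr {G H A : Type*} [Group G] [Group H] [Group A] (e : G ≃* H) :
    Nonempty (MulAut H ≃* A) → Nonempty (MulAut G ≃* A) :=
  fun ⟨f⟩ => ⟨(MulAut.congr e).trans f⟩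

theorem IsOfType.hasListedAut (hpq : p ≠ q) {G : Type*} [Group G] {t : TypeLabel}
    (h : IsOfType p q t G) : HasListedAut p q t (MulAut G) := by
  cases t with
  | t1 =>
    obtain ⟨e⟩ := h
    exact nonempty_mulAut_congr e (nonempty_mulAut_cyc_sq_prod hpq)
  | t2 =>
    obtain ⟨φ, hφ, ⟨e⟩⟩ := h
    exact nonempty_mulAut_congr e
      (nonempty_mulAut_cyc_semidirect_prime hpq ((card_center_eq_prime_iff φ).mp hφ))
  | t3 =>
    obtain ⟨φ, hφ, ⟨e⟩⟩ := h
    exact nonempty_mulAut_congr e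
      (nonempty_mulAut_cyc_semidirect_sq hpq ((center_eq_bot_iff φ).mp hφ))
  | t4 =>
    obtain ⟨φ, hφ, ⟨e⟩⟩ := h
    exact nonempty_mulAut_congr e (nonempty_mulAut_cyc_sq_semidirect hpq hφ)
  | t5 =>
    obtain ⟨e⟩ := h
    exact nonempty_mulAut_congr e (nonempty_mulAut_five hpq)
  | t6 =>
    obtain ⟨φ, hφ, ⟨e⟩⟩ := h
    exact nonempty_mulAut_congr e (nonempty_mulAut_six hpq hφ)
  | t7 =>
    obtain ⟨φ, hφ, ⟨e⟩⟩ := h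
    exact nonempty_mulAut_congr e (nonempty_mulAut_kindS hpq hφ)
  | t8 =>
    obtain ⟨φ, hφ, ⟨e⟩⟩ := h
    exact nonempty_mulAut_congr e (nonempty_mulAut_kindD0 hpq hφ)
  | t9 =>
    obtain ⟨φ, hφ, ⟨e⟩⟩ := h
    exact nonempty_mulAut_congr e (nonempty_mulAut_kindD1 hpq hφ)
  | t10 =>
    obtain ⟨χ, hχ, ⟨e⟩⟩ := exists_field_semidirect hpq h
    exact nonempty_mulAut_congr e (nonempty_mulAut_field hpq hχ)
  | t11 =>
    obtain ⟨φ, hφ, ⟨e⟩⟩ := h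
    exact nonempty_mulAut_congr e (nonempty_mulAut_cyc_prod_semidirect hpq hφ)

theorem nonempty_mulEquiv_of_isOfType (hpq : p ≠ q) {t : TypeLabel} (ht : t ≠ .t8)
    {G H : Type*} [Group G] [Group H] (hG : IsOfType p q t G) (hH : IsOfType p q t H) :
    Nonempty (G ≃* H) := by
  cases t with
  | t1 | t5 =>
    obtain ⟨e⟩ := hG
    obtain ⟨f⟩ := hH
    exact ⟨e.trans f.symm⟩
  | t2 =>
    obtain ⟨φ, hφ, ⟨e⟩⟩ := hG
    obtain ⟨ψ, hψ, ⟨f⟩⟩ := hH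
    obtain ⟨g⟩ := nonempty_cyc_semidirect_congr
      (((card_center_eq_prime_iff φ).mp hφ).trans ((card_center_eq_prime_iff ψ).mp hψ).symm)
    exact ⟨(e.trans g).trans f.symm⟩
  | t3 =>
    obtain ⟨φ, hφ, ⟨e⟩⟩ := hG
    obtain ⟨ψ, hψ, ⟨f⟩⟩ := hH
    obtain ⟨g⟩ := nonempty_cyc_semidirect_congr
      (((center_eq_bot_iff φ).mp hφ).trans ((center_eq_bot_iff ψ).mp hψ).symm)
    exact ⟨(e.trans g).trans f.symm⟩
  | t4 =>
    obtain ⟨φ, hφ, ⟨e⟩⟩ := hG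
    obtain ⟨ψ, hψ, ⟨f⟩⟩ := hH
    obtain ⟨g⟩ := nonempty_cyc_semidirect_congr
      ((orderOf_map_cgen_of_ne_one hφ).trans (orderOf_map_cgen_of_ne_one hψ).symm)
    exact ⟨(e.trans g).trans f.symm⟩
  | t6 => exact nonempty_congr_kindF (isOfType_six_iff.mp hG) (isOfType_six_iff.mp hH)
  | t7 => exact nonempty_congr_kindS hG hH
  | t8 => exact absurd rfl ht
  | t9 => exact nonempty_congr_kindD1 hG hH
  | t10 => exact nonempty_congr_kindC hpq hG hH
  | t11 =>
    obtain ⟨φ, hφ, ⟨e⟩⟩ := hG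
    obtain ⟨ψ, hψ, ⟨f⟩⟩ := hH
    obtain ⟨g⟩ := nonempty_cyc_semidirect_congr
      ((orderOf_map_cgen_of_ne_one hφ).trans (orderOf_map_cgen_of_ne_one hψ).symm)
    exact ⟨(e.trans (MulEquiv.prodCongr (MulEquiv.refl _) g)).trans f.symm⟩

end Conditions

end PSqQ

theorem mainTheorem1 (p q : ℕ) [Fact p.Prime] [Fact q.Prime] (hpq : p ≠ q) :
    -- every group of order `p ^ 2 * q` has a normal Sylow subgroup and exactly one type
    (∀ (G : Type u) [Group G], Nat.card G = p ^ 2 * q →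
      ((∃ P : Sylow p G, (P : Subgroup G).Normal) ∨ (∃ Q : Sylow q G, (Q : Subgroup G).Normal)) ∧
      ∃! t : PSqQ.TypeLabel, PSqQ.IsOfType p q t G) ∧
    -- a type occurs exactly under the arithmetic condition that goes with it
    (∀ t : PSqQ.TypeLabel,
      (∃ (G : Type u) (_ : Group G), PSqQ.IsOfType p q t G) ↔ PSqQ.Condition p q t) ∧
    -- groups of each type have order `p ^ 2 * q` and the listed automorphism group
    (∀ (t : PSqQ.TypeLabel) (G : Type u) [Group G], PSqQ.IsOfType p q t G →
      Nat.card G = p ^ 2 * q ∧ PSqQ.HasListedAut p q t (MulAut G)) ∧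
    -- each type other than type 8 consists of at most one isomorphism class
    (∀ t : PSqQ.TypeLabel, t ≠ PSqQ.TypeLabel.t8 →
      ∀ (G H : Type u) [Group G] [Group H],
        PSqQ.IsOfType p q t G → PSqQ.IsOfType p q t H → Nonempty (G ≃* H)) ∧
    -- type 8, when it occurs, consists of exactly `(q - 3) / 2` isomorphism classes
    (PSqQ.Condition p q PSqQ.TypeLabel.t8 →
      ∃ (F : Fin ((q - 3) / 2) → Type u) (_ : ∀ i, Group (F i)),
        (∀ i, PSqQ.IsOfType p q PSqQ.TypeLabel.t8 (F i)) ∧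
        (∀ i j, Nonempty (F i ≃* F j) → i = j) ∧
        ∀ (G : Type u) [Group G], PSqQ.IsOfType p q PSqQ.TypeLabel.t8 G →
          ∃ i, Nonempty (G ≃* F i)) := by
  refine ⟨fun G _ hG => ?_, fun t => ?_, fun t G _ h => ⟨h.card, h.hasListedAut hpq⟩,
    fun t ht G H _ _ hG hH => PSqQ.nonempty_mulEquiv_of_isOfType hpq ht hG hH,
    fun h => PSqQ.exists_family_kindD0 hpq h.1 h.2⟩
  · have hS := PSqQ.exists_normal_sylow hpq hG
    refine ⟨hS, ?_⟩
    obtain ⟨t, ht⟩ : ∃ t, PSqQ.IsOfType p q t G := by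
      rcases hS with ⟨P, hP⟩ | ⟨Q, hQ⟩
      · exact PSqQ.exists_isOfType_of_sylow_left hpq hG P hP
      · exact PSqQ.exists_isOfType_of_sylow_right hpq hG Q hQ
    exact ⟨t, ht, fun t' ht' => PSqQ.IsOfType.unique hpq ht' ht⟩
  · exact ⟨fun ⟨G, _, h⟩ => PSqQ.condition_of_isOfType hpq h,
      fun h => PSqQ.exists_isOfType_of_condition hpq h⟩
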